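/- For each $n\ge 1$ let $\mathcal C_n$ be a closed network with $n$ queues and $m_n\in\mathbb N$ customers. Queue $k$ has service rate $\mu_{k,n}(q)>0$ when it holds $q\ge1$ customers, and the routing matrix $P_n$ is stochastic and irreducible, with invariant probability vector $\pi_n=(\pi_{1,n},\dots,\pi_{n,n})$. Let $f_{k,n}(z)=\sum_{q\ge0} z^q/(\mu_{k,n}(1)\cdots\mu_{k,n}(q))$. Let $\lambda_n\ge0$ be such that there are independent $\mathbb N$-valued variables $X_{1,n},\dots,X_{n,n}$ with $$P(X_{k,n}=x)=\frac{1}{f_{k,n}(\lambda_n\pi_{k,n})}\,\frac{(\lambda_n\pi_{k,n})^x}{\mu_{k,n}(1)\cdots\mu_{k,n}(x)},$$ with finite means $m_{k,n}=E X_{k,n}$, and such that $E S_n=m_n$, where $S_n=\sum_{k=1}^n X_{k,n}$. Put $\phi_{k,n}(\theta)=E e^{i(X_{k,n}-m_{k,n})\theta}$. Let $\rho^0_n\in[0,1)$, $\omega_n(\theta)=\dfrac{1-\rho_n^0}{1-\rho_n^0e^{i\theta}}$ and $\alpha_n=\dfrac{\rho^0_n}{1-\rho^0_n}$. Let $\mathcal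 F^0_n\subset\{1,\dots,n\}$ be a nonempty set of queues such that, for all $k\in\mathcal F_n^0$ and all real $\theta$, $$\phi_{k,n}(\theta)=e^{-im_{k,n}\theta}\,\omega_n(\theta)^{\xi_{k,n}}\,\psi_{k,n}(\theta),$$ where $1\le\xi_{k,n}<\xi_{\max}<\infty$ with $\xi_{\max}$ independent of $k$ and $n$, and $\psi_{k,n}$ is differentiable with $\psi'_{k,n}(\theta)$ bounded uniformly in $\theta$, $k\in\mathcal F^0_n$ and $n$ (the power is the principal one). Put $\xi_n=\sum_{k\in\mathcal F_n^0}\xi_{k,n}$. Let $0<r\le1$, assume that $E X_{k,n}^{2+r}<\infty$ for $k\notin\mathcal F_n^0$, and put $$\hat\sigma_n^2=\sum_{k\notin\mathcal F^0_n}\operatorname{Var}X_{k,n},\qquad \hat\beta_n^{(2+r)}=\sum_{k\notin\mathcal F^0_n}E|X_{k,n}-m_{k,n}|^{2+r},\qquad \hat\delta_n^{\,r}=\frac{\hat\sigma_n^2}{2\hat\beta^{(2+r)}_n},$$ $$\hat\gamma_n^2=\sum_{k\notin\mathcal F^0_n}\ \sum_{j\ge0}\frac{P(X_{k,n}=2j)\,P(X_{k,n}=2j+1)}{P(X_{k,n}=2j)+P(X_{k,n}=2j+1)},$$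 where a summand $0/0$ is read as $0$. Assume that, as $n\to\infty$, $\rho^0_n\to1$, $\xi_n$ is bounded, $\hat\sigma_n/\alpha_n\to0$ and $\hat\delta_n\hat\gamma_n\to\infty$. Let $g_\xi(y)=y^{\xi-1}e^{-y}/\Gamma(\xi)$ for $y\ge0$ (with $0^0=1$) and $g_\xi(y)=0$ for $y<0$. Then for every $\varepsilon>0$ there is a constant $K$ such that, for all sufficiently large $n$ and all integers $x$ with $\bigl|\xi_n+\tfrac{x}{\alpha_n}\bigr|\ge\varepsilon$, $$\Bigl|\alpha_nP(S_n-m_n=x)-g_{\xi_n}\Bigl(\xi_n+\frac{x}{\alpha_n}\Bigr)\Bigr|\le K\left[\Bigl(\frac{\hat\sigma_n}{\alpha_n}\Bigr)^2+\frac1{\alpha_n}+\frac{\hat\beta_n^{(2+r)}}{\hat\sigma_n^{2+r}}\Bigl(\frac{\hat\sigma_n}{\alpha_n}\Bigr)^{2+r}+\frac{\hat\beta_n^{(2+r)}}{\hat\sigma_n^{2+r}}\Bigl(\frac{\hat\sigma_n}{\alpha_n}\Bigr)^{\xi_n-1}+\frac{e^{-\hat\gamma_n^2\hat\delta_n^2/5}}{\hat\gamma_n^2\,\hat\delta_n^{\,\xi_n+1}\,\alpha_n^{\xi_n-1}}\right].$$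 In particular, the estimate holds for each fixed integer $x$, and uniformly over all integers $x$ with $\xi_n+x/\alpha_n\ge\varepsilon$. -/

import Mathlib

open MeasureTheory ProbabilityTheory Filter
open scoped Topology

/-- A closed product-form network with `n` queues. `rate k q` is the service rate of queue `k` when
it holds `q ≥ 1` customers (`rate k 0` is never used), `routing` is the transition matrix of the
routing chain, and `visit` is its invariant probability vector. -/
structure ClosedNetwork (n : ℕ) where
  customers : ℕ
  rate : Fin n → ℕ → ℝ
  rate_pos : ∀ k q, 1 ≤ q → 0 < rate k q
  routing : Matrix (Fin n) (Fin n) ℝ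
  routing_nonneg : ∀ k l, 0 ≤ routing k l
  routing_sum : ∀ k, ∑ l, routing k l = 1
  routing_irreducible : routing.IsIrreducible
  visit : Fin n → ℝ
  visit_nonneg : ∀ k, 0 ≤ visit k
  visit_invariant : Matrix.vecMul visit routing = visit
  visit_sum : ∑ k, visit k = 1

namespace ClosedNetwork

variable {n : ℕ} (C : ClosedNetwork n)

/-- The generating function `f_k(z) = ∑_q z^q / (μ_k(1) ⋯ μ_k(q))` of queue `k`. -/
noncomputable def genFun (k : Fin n) (z : ℝ) : ℝ :=
  ∑' q : ℕ, z ^ q / ∏ i ∈ Finset.Icc 1 q, C.rate k i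

/-- The stationary probability of the value `x` for queue `k` taken in isolation, with arrival
intensity `lam * visit k`. -/
noncomputable def openProb (lam : ℝ) (k : Fin n) (x : ℕ) : ℝ :=
  (1 / C.genFun k (lam * C.visit k)) *
    ((lam * C.visit k) ^ x / ∏ i ∈ Finset.Icc 1 x, C.rate k i)

/-- `X` is the family of queue lengths of the open system of parallel queues with load `lam`:
independent variables, `X k` having point probabilities `openProb lam k`. Since `P` is a probability
measure, the law condition forces the series `genFun k (lam * visit k)` to converge. -/
structure IsOpenSystem {Ω : Type*} [MeasurableSpace Ω] (P : Measure Ω) (lam : ℝ)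
    (X : Fin n → Ω → ℕ) : Prop where
  load_nonneg : 0 ≤ lam
  measurable : ∀ k, Measurable (X k)
  indep : iIndepFun X P
  law : ∀ k x, P.real {ω | X k ω = x} = C.openProb lam k x

end ClosedNetwork

section QueueLength

variable {Ω : Type*} [MeasurableSpace Ω]

/-- The mean of an integer-valued variable. -/
noncomputable def qMean (P : Measure Ω) (Y : Ω → ℕ) : ℝ := ∫ ω, (Y ω : ℝ) ∂P

/-- The variance of an integer-valued variable. -/
noncomputable def qVar (P : Measure Ω) (Y : Ω → ℕ) : ℝ := variance (fun ω => (Y ω : ℝ)) P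

/-- The absolute central moment of order `s`. -/
noncomputable def qAbsMoment (P : Measure Ω) (Y : Ω → ℕ) (s : ℝ) : ℝ :=
  ∫ ω, |(Y ω : ℝ) - qMean P Y| ^ s ∂P

/-- The characteristic function of the centred variable. -/
noncomputable def qCharFun (P : Measure Ω) (Y : Ω → ℕ) (θ : ℝ) : ℂ :=
  ∫ ω, Complex.exp (Complex.I * (((Y ω : ℝ) - qMean P Y : ℝ) : ℂ) * (θ : ℂ)) ∂P

/-- `γ² = ∑_j p_{2j} p_{2j+1} / (p_{2j} + p_{2j+1})`, where `p_j = P(Y = j)`; a summand with zero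
denominator is zero. -/
noncomputable def qGammaSq (P : Measure Ω) (Y : Ω → ℕ) : ℝ :=
  ∑' j : ℕ, P.real {ω | Y ω = 2 * j} * P.real {ω | Y ω = 2 * j + 1} /
    (P.real {ω | Y ω = 2 * j} + P.real {ω | Y ω = 2 * j + 1})

variable {ι : Type*}

/-- `σ`, for the queues in the finite set `A`. -/
noncomputable def totSigma (P : Measure Ω) (X : ι → Ω → ℕ) (A : Finset ι) : ℝ :=
  √(∑ k ∈ A, qVar P (X k))

/-- `β^{(s)}`, for the queues in the finite set `A`. -/
noncomputable def totMoment (P : Measure Ω) (X : ι → Ω → ℕ) (A : Finset ι) (s : ℝ) : ℝ :=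
  ∑ k ∈ A, qAbsMoment P (X k) s

/-- `γ`, for the queues in the finite set `A`. -/
noncomputable def totGamma (P : Measure Ω) (X : ι → Ω → ℕ) (A : Finset ι) : ℝ :=
  √(∑ k ∈ A, qGammaSq P (X k))

/-- `δ`, for the queues in the finite set `A`: the number with `δ^r = σ² / (2 β^{(2+r)})`. -/
noncomputable def totDelta (P : Measure Ω) (X : ι → Ω → ℕ) (A : Finset ι) (r : ℝ) : ℝ :=
  ((1 / 2) * (totSigma P X A ^ 2 / totMoment P X A (2 + r))) ^ (1 / r)

end QueueLength

/-- `ω(θ) = (1 - ρ) / (1 - ρ e^{iθ})`. -/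
noncomputable def poleFactor (ρ θ : ℝ) : ℂ :=
  (1 - (ρ : ℂ)) / (1 - (ρ : ℂ) * Complex.exp (Complex.I * (θ : ℂ)))

/-- `α = ρ / (1 - ρ)`. -/
noncomputable def poleScale (ρ : ℝ) : ℝ := ρ / (1 - ρ)

/-- The error of the gamma approximation, in terms of `α`, `ξ`, `r`, `σ`, `β = β^{(2+r)}`, `γ`
and `δ`. -/
noncomputable def gammaError (α ξ r σ β γ δ : ℝ) : ℝ :=
  ((σ / α) ^ 2 + 1 / α + β / σ ^ (2 + r) * (σ / α) ^ (2 + r) + β / σ ^ (2 + r) * (σ / α) ^ (ξ - 1))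
    + Real.exp (-(γ ^ 2 * δ ^ 2 / 5)) / (γ ^ 2 * δ ^ (ξ + 1) * α ^ (ξ - 1))

/-! ### Smoothness of the gamma density away from the origin -/

/-! Since the means add up to the integer `m_n`, the product of the centred characteristic functions
is that of an integer-valued variable, and `P(S_n - m_n = x)` is its Fourier coefficient over `[-π,
π]`. The proof compares this integral with the inversion integral of a gamma law of shape `ξ`.

The saturable queues produce the gamma factor. With `α = ρ / (1 - ρ)`, the pole factor is the
inverse of `1 - α (e^{iθ} - 1)`, close to `1 - iαθ`; the logarithm of the ratio of the two has
derivative bounded independently of `α`. Moreover, a centred characteristic function has zero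
derivative at `0`, which forces `m_k = α ξ_k + O(1)`. Hence the saturable product is `(1 - iαθ)^{-ξ}
e^{-iαξθ} Ψ(θ)` with `Ψ(0) = 1` and `Ψ'` bounded near `0` (`exists_saturable_factor`).

The other queues are treated as in a local limit theorem. On `|θ| ≤ δ` their product is close to
`e^{-σ²θ²/2}` (`norm_prod_qCharFun_sub_gaussian_le`). Elsewhere, pairing the atoms `2j` and `2j + 1`
gives the decay `e^{-γ²θ²/5}` (`norm_prod_qCharFun_le_exp_gamma`).

`exists_norm_fourier_sub_gammaPDFReal_le` assembles the error: cut the integral at `δ`, replace the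
non-saturable product by the Gaussian, replace `Ψ` by `1`, and extend the integral to the whole
line. Replacing `Ψ` uses integration by parts: the phase has frequency `αy` with `y = ξ + x/α` and
`|y| ≥ ε`, and the resulting factor `1/(αε)` offsets the prefactor `α`. What remains is the gamma
density smoothed by a centred Gaussian of standard deviation `σ/α`. Away from the origin the density
has a quadratic Taylor bound, whose linear term averages to zero, so smoothing costs only `(σ/α)²`.
-/

theorem rpow_le_factorial_mul_exp {M : ℝ} {q z : ℝ} (hq : q ≤ M) (hz : 1 ≤ z) :
    z ^ q ≤ (⌈M⌉₊.factorial : ℝ) * Real.exp z := by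
  have h1 : z ^ q ≤ z ^ (⌈M⌉₊ : ℝ) :=
    Real.rpow_le_rpow_of_exponent_le hz (hq.trans (Nat.le_ceil M))
  rw [Real.rpow_natCast] at h1
  have h2 := Real.pow_div_factorial_le_exp z (by linarith) ⌈M⌉₊
  rw [div_le_iff₀ (by positivity)] at h2
  linarith

/-- The lower limit `-2` on the exponent is the worst case `ξ - 3` met in the second derivative of
`z^{ξ-1} e^{-z}` when `ξ ≥ 1`. The exponential absorbs large `z`, and `a` keeps `z` away from the
singularity. -/
theorem rpow_mul_exp_neg_le {M a : ℝ} (ha : 0 < a) {q z : ℝ} (hq2 : -2 ≤ q)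
    (hq : q ≤ M) (hz : a ≤ z) :
    z ^ q * Real.exp (-z) ≤ a ^ (-2 : ℝ) + (⌈M⌉₊.factorial : ℝ) := by
  have hz0 : 0 < z := ha.trans_le hz
  have hexp : Real.exp (-z) ≤ 1 := by simpa using hz0.le
  rcases le_total 1 z with h | h
  · have h1 := rpow_le_factorial_mul_exp hq h
    have : z ^ q * Real.exp (-z) ≤ (⌈M⌉₊.factorial : ℝ) * Real.exp z * Real.exp (-z) := by gcongr
    rw [mul_assoc, ← Real.exp_add] at this
    simp only [add_neg_cancel, Real.exp_zero, mul_one] at this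
    have : 0 ≤ a ^ (-2 : ℝ) := by positivity
    linarith
  · have h1 : z ^ q ≤ z ^ (-2 : ℝ) := Real.rpow_le_rpow_of_exponent_ge hz0 h hq2
    have h2 : z ^ (-2 : ℝ) ≤ a ^ (-2 : ℝ) := Real.rpow_le_rpow_of_nonpos ha hz (by norm_num)
    have h3 : z ^ q * Real.exp (-z) ≤ a ^ (-2 : ℝ) * 1 := by
      gcongr
      exact h1.trans h2
    have : (0 : ℝ) ≤ (⌈M⌉₊.factorial : ℝ) := by positivity
    linarith

theorem exists_pos_le_Gamma (M : ℝ) : ∃ c : ℝ, 0 < c ∧ ∀ ξ : ℝ, 1 ≤ ξ → ξ ≤ M → c ≤ Real.Gamma ξ := by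
  by_cases hM : 1 ≤ M
  · obtain ⟨x, hx, hmin⟩ := isCompact_Icc.exists_isMinOn (s := Set.Icc (1 : ℝ) M)
      (f := Real.Gamma) ⟨1, by simp [hM]⟩ (fun x hx =>
        (Real.differentiableAt_Gamma (fun m => by
          have := hx.1; have : (0 : ℝ) ≤ m := m.cast_nonneg; linarith)).continuousAt.continuousWithinAt)
    exact ⟨_, Real.Gamma_pos_of_pos (lt_of_lt_of_le one_pos hx.1), fun ξ h1 h2 => hmin ⟨h1, h2⟩⟩
  · exact ⟨1, one_pos, fun ξ h1 h2 => absurd (h1.trans h2) hM⟩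

theorem gammaPDFReal_one_of_nonneg {ξ z : ℝ} (hz : 0 ≤ z) :
    gammaPDFReal ξ 1 z = (Real.Gamma ξ)⁻¹ * (z ^ (ξ - 1) * Real.exp (-z)) := by
  simp [gammaPDFReal, hz, mul_assoc]

theorem exists_gammaPDFReal_le (M : ℝ) :
    ∃ C : ℝ, 0 < C ∧ ∀ ξ : ℝ, 1 ≤ ξ → ξ ≤ M → ∀ z, gammaPDFReal ξ 1 z ≤ C := by
  obtain ⟨c, hc, hG⟩ := exists_pos_le_Gamma M
  refine ⟨c⁻¹ * (1 + (⌈M⌉₊.factorial : ℝ)), by positivity, fun ξ h1 h2 z => ?_⟩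
  by_cases hz : 0 ≤ z
  · rw [gammaPDFReal_one_of_nonneg hz]
    have hb : z ^ (ξ - 1) * Real.exp (-z) ≤ 1 + (⌈M⌉₊.factorial : ℝ) := by
      rcases le_total 1 z with h | h
      · have := rpow_mul_exp_neg_le (M := M) one_pos (q := ξ - 1) (by linarith)
          (by linarith) h
        simpa using this
      · have h3 : z ^ (ξ - 1) ≤ 1 := Real.rpow_le_one hz h (by linarith)
        have h4 : Real.exp (-z) ≤ 1 := by simpa using hz
        have h5 : z ^ (ξ - 1) * Real.exp (-z) ≤ 1 * 1 := by gcongr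
        have : (0 : ℝ) ≤ (⌈M⌉₊.factorial : ℝ) := by positivity
        linarith
    have := hG ξ h1 h2
    gcongr
  · have : gammaPDFReal ξ 1 z = 0 := by simp [gammaPDFReal, hz]
    rw [this]; positivity

/-- The mean value inequality is applied twice, first to `f'` and then to `f z - f' y * z`.
Derivatives are needed only within distance `|h|` of `y`, so a singularity farther away is harmless.
-/
theorem abs_sub_sub_mul_le_of_hasDerivAt {f f' f'' : ℝ → ℝ} {C y h : ℝ}
    (hf : ∀ z, |z - y| ≤ |h| → HasDerivAt f (f' z) z)
    (hf' : ∀ z, |z - y| ≤ |h| → HasDerivAt f' (f'' z) z)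
    (hC : ∀ z, |z - y| ≤ |h| → |f'' z| ≤ C) :
    |f (y + h) - f y - f' y * h| ≤ C * h ^ 2 := by
  have hconv : Convex ℝ (Metric.closedBall y |h|) := convex_closedBall y |h|
  have hy : y ∈ Metric.closedBall y |h| := by simp
  have hyh : y + h ∈ Metric.closedBall y |h| := by simp
  have h1 : ∀ z ∈ Metric.closedBall y |h|, ‖f' z - f' y‖ ≤ C * |h| := by
    intro z hz
    have := hconv.norm_image_sub_le_of_norm_hasDerivWithin_le (f := f') (f' := f'') (C := C)
      (fun x hx => (hf' x (by simpa [Real.dist_eq] using hx)).hasDerivWithinAt)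
      (fun x hx => hC x (by simpa [Real.dist_eq] using hx)) hy hz
    refine this.trans ?_
    have h0 : 0 ≤ C := (abs_nonneg _).trans (hC y (by simp))
    have : ‖z - y‖ ≤ |h| := by simpa [Real.dist_eq] using hz
    gcongr
  have h2 := hconv.norm_image_sub_le_of_norm_hasDerivWithin_le
      (f := fun z => f z - f' y * z) (f' := fun z => f' z - f' y) (C := C * |h|)
      (fun x hx => ?_) h1 hy hyh
  · have e : f (y + h) - f y - f' y * h = f (y + h) - f' y * (y + h) - (f y - f' y * y) := by ring
    rw [e]
    refine h2.trans_eq ?_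
    rw [add_sub_cancel_left, Real.norm_eq_abs, mul_assoc, ← abs_mul, ← pow_two, abs_sq]
  · have := (hf x (by simpa [Real.dist_eq] using hx)).sub ((hasDerivAt_id x).const_mul (f' y))
    simpa using! this.hasDerivWithinAt

/-- The bound has to hold for every `h`, even when `y + h` crosses the origin, where the density
need not be smooth, because `h` will be a Gaussian variable. Crossing requires `|h|` bounded below,
and then boundedness of the density and of its slope at `y` is enough, since `h ^ 2` is bounded
below too. -/
theorem exists_gammaPDFReal_taylor (M : ℝ) {ε : ℝ} (hε : 0 < ε) :
    ∃ C : ℝ, 0 < C ∧ ∀ ξ : ℝ, 1 ≤ ξ → ξ ≤ M → ∀ y : ℝ, ε ≤ |y| → ∃ d : ℝ, ∀ h : ℝ,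
      |gammaPDFReal ξ 1 (y + h) - gammaPDFReal ξ 1 y - d * h| ≤ C * h ^ 2 := by
  obtain ⟨c, hc, hG⟩ := exists_pos_le_Gamma M
  obtain ⟨C0, hC0, hg⟩ := exists_gammaPDFReal_le M
  -- The same number serves as Taylor radius and as distance from the origin: `y ≥ ε` and `|h| ≤ a`
  -- give `y + h ≥ ε / 2 ≥ a`.
  set a : ℝ := min (ε / 2) 1 with ha
  have ha0 : 0 < a := by positivity
  have ha1 : a ≤ 1 := min_le_right _ _
  have haε : a ≤ ε / 2 := min_le_left _ _
  set D : ℝ := a ^ (-2 : ℝ) + (⌈M⌉₊.factorial : ℝ) with hD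
  have hD0 : 0 < D := by positivity
  set E : ℝ := c⁻¹ * ((M + 2) ^ 2 * 4 * D) with hE
  refine ⟨C0 / ε ^ 2 + |E| + (2 * C0 / a ^ 2 + |E| / a), by positivity, ?_⟩
  intro ξ h1 h2 y hy
  have hGξ := hG ξ h1 h2
  have hΓ : 0 < Real.Gamma ξ := hc.trans_le hGξ
  have hM : 1 ≤ M := h1.trans h2
  have hnn : ∀ z, 0 ≤ gammaPDFReal ξ 1 z := fun z => gammaPDFReal_nonneg (by linarith) one_pos z
  have hE0 : 0 ≤ E := by positivity
  rcases lt_or_ge y 0 with hyneg | hypos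
  · refine ⟨0, fun h => ?_⟩
    rw [abs_of_neg hyneg] at hy
    have hy0 : gammaPDFReal ξ 1 y = 0 := by simp [gammaPDFReal, hyneg]
    rw [hy0, zero_mul, sub_zero, sub_zero, abs_of_nonneg (hnn _)]
    have hrest : 0 ≤ |E| + (2 * C0 / a ^ 2 + |E| / a) := by positivity
    rcases lt_or_ge (y + h) 0 with hh | hh
    · have : gammaPDFReal ξ 1 (y + h) = 0 := by simp [gammaPDFReal, hh]
      rw [this]; positivity
    · have h3 : ε ^ 2 ≤ h ^ 2 := by gcongr; linarith
      calc gammaPDFReal ξ 1 (y + h) ≤ C0 := hg ξ h1 h2 _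
        _ ≤ C0 / ε ^ 2 * h ^ 2 := by
            rw [div_mul_eq_mul_div, le_div_iff₀ (by positivity)]; gcongr
        _ ≤ _ := by
            gcongr
            linarith
  · rw [abs_of_nonneg hypos] at hy
    set G : ℝ → ℝ := fun z => (Real.Gamma ξ)⁻¹ * (z ^ (ξ - 1) * Real.exp (-z)) with hGdef
    set G' : ℝ → ℝ := fun z => (Real.Gamma ξ)⁻¹ *
      ((ξ - 1) * z ^ (ξ - 1 - 1) * Real.exp (-z) - z ^ (ξ - 1) * Real.exp (-z)) with hG'def
    set G'' : ℝ → ℝ := fun z => (Real.Gamma ξ)⁻¹ *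
      ((ξ - 1) * ((ξ - 1 - 1) * z ^ (ξ - 1 - 1 - 1)) * Real.exp (-z)
        - 2 * ((ξ - 1) * z ^ (ξ - 1 - 1) * Real.exp (-z)) + z ^ (ξ - 1) * Real.exp (-z)) with hG''def
    have hexp : ∀ z : ℝ, HasDerivAt (fun z => Real.exp (-z)) (-Real.exp (-z)) z := fun z => by
      simpa using! (Real.hasDerivAt_exp (-z)).comp z (hasDerivAt_neg z)
    have hpw : ∀ p z : ℝ, 0 < z → HasDerivAt (fun z : ℝ => z ^ p) (p * z ^ (p - 1)) z :=
      fun p z hz => Real.hasDerivAt_rpow_const (Or.inl hz.ne')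
    have hd1 : ∀ z, 0 < z → HasDerivAt G (G' z) z := fun z hz => by
      refine (((hpw (ξ - 1) z hz).mul (hexp z)).const_mul (Real.Gamma ξ)⁻¹).congr_deriv ?_
      simp only [hG'def]; ring
    have hd2 : ∀ z, 0 < z → HasDerivAt G' (G'' z) z := fun z hz => by
      refine (((((hpw (ξ - 1 - 1) z hz).const_mul (ξ - 1)).mul (hexp z)).sub
        ((hpw (ξ - 1) z hz).mul (hexp z))).const_mul (Real.Gamma ξ)⁻¹).congr_deriv ?_
      simp only [hG''def]; ring
    have hpe : ∀ q z : ℝ, -2 ≤ q → q ≤ M → a ≤ z → 0 ≤ z ^ q * Real.exp (-z) ∧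
        z ^ q * Real.exp (-z) ≤ D := fun q z hq hq' hz =>
      ⟨by have := ha0.trans_le hz; positivity, rpow_mul_exp_neg_le ha0 hq hq' hz⟩
    have hinv : (Real.Gamma ξ)⁻¹ ≤ c⁻¹ := by gcongr
    have hinv0 : 0 ≤ (Real.Gamma ξ)⁻¹ := by positivity
    have hmul : ∀ w v : ℝ, |w| ≤ (M + 2) ^ 2 → 0 ≤ v → v ≤ D → |w * v| ≤ (M + 2) ^ 2 * D := by
      intro w v hw hv hvD
      rw [abs_mul, abs_of_nonneg hv]; gcongr
    have w1 : |ξ - 1| ≤ M + 2 := by rw [abs_le]; constructor <;> linarith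
    have w2 : |ξ - 1 - 1| ≤ M + 2 := by rw [abs_le]; constructor <;> linarith
    have w3 : M + 2 ≤ (M + 2) ^ 2 := le_self_pow₀ (by linarith) two_ne_zero
    have w4 : |(ξ - 1) * (ξ - 1 - 1)| ≤ (M + 2) ^ 2 := by
      rw [abs_mul, pow_two]; gcongr
    have w5 : |(1 : ℝ)| ≤ (M + 2) ^ 2 := by rw [abs_one]; linarith
    have hb2 : ∀ z, a ≤ z → |G'' z| ≤ E := by
      intro z hz
      have k1 := hpe (ξ - 1 - 1 - 1) z (by linarith) (by linarith) hz
      have k2 := hpe (ξ - 1 - 1) z (by linarith) (by linarith) hz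
      have k3 := hpe (ξ - 1) z (by linarith) (by linarith) hz
      have l1 := hmul ((ξ - 1) * (ξ - 1 - 1)) _ w4 k1.1 k1.2
      have l2 := hmul (-(ξ - 1)) _ (by rw [abs_neg]; exact w1.trans w3) k2.1 k2.2
      have l3 := hmul 1 _ w5 k3.1 k3.2
      have e : G'' z = (Real.Gamma ξ)⁻¹ * ((ξ - 1) * (ξ - 1 - 1) * (z ^ (ξ - 1 - 1 - 1) * Real.exp (-z))
          + 2 * (-(ξ - 1) * (z ^ (ξ - 1 - 1) * Real.exp (-z))) + 1 * (z ^ (ξ - 1) * Real.exp (-z))) := by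
        simp only [hG''def]; ring
      rw [e, abs_mul, abs_of_nonneg hinv0, hE]
      refine mul_le_mul hinv ?_ (abs_nonneg _) (by positivity)
      rw [abs_le] at l1 l2 l3 ⊢
      constructor <;> linarith
    have hb1 : ∀ z, a ≤ z → |G' z| ≤ E := by
      intro z hz
      have k2 := hpe (ξ - 1 - 1) z (by linarith) (by linarith) hz
      have k3 := hpe (ξ - 1) z (by linarith) (by linarith) hz
      have l2 := hmul (ξ - 1) _ (w1.trans w3) k2.1 k2.2
      have l3 := hmul 1 _ w5 k3.1 k3.2
      have e : G' z = (Real.Gamma ξ)⁻¹ * ((ξ - 1) * (z ^ (ξ - 1 - 1) * Real.exp (-z))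
          - 1 * (z ^ (ξ - 1) * Real.exp (-z))) := by
        simp only [hG'def]; ring
      rw [e, abs_mul, abs_of_nonneg hinv0, hE]
      refine mul_le_mul hinv ?_ (abs_nonneg _) (by positivity)
      have : 0 ≤ (M + 2) ^ 2 * D := by positivity
      rw [abs_le] at l2 l3 ⊢
      constructor <;> linarith
    refine ⟨G' y, fun h => ?_⟩
    have hgy : gammaPDFReal ξ 1 y = G y := gammaPDFReal_one_of_nonneg hypos
    rcases le_or_gt |h| a with hh | hh
    · have hz : ∀ z, |z - y| ≤ |h| → a ≤ z := fun z hz => by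
        have := (abs_le.1 (hz.trans hh)).1; linarith
      have hyh : gammaPDFReal ξ 1 (y + h) = G (y + h) :=
        gammaPDFReal_one_of_nonneg (by linarith [(abs_le.1 hh).1])
      have := abs_sub_sub_mul_le_of_hasDerivAt (f := G) (f' := G') (f'' := G'') (y := y) (h := h)
        (C := E) (fun z hz' => hd1 z (ha0.trans_le (hz z hz')))
        (fun z hz' => hd2 z (ha0.trans_le (hz z hz'))) (fun z hz' => hb2 z (hz z hz'))
      rw [hgy, hyh]
      refine this.trans ?_
      gcongr
      have k1 : 0 ≤ C0 / ε ^ 2 := by positivity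
      have k2 : 0 ≤ 2 * C0 / a ^ 2 + |E| / a := by positivity
      linarith [le_abs_self E]
    · have k1 := hb1 y (by linarith)
      have k2 : |gammaPDFReal ξ 1 (y + h) - gammaPDFReal ξ 1 y| ≤ 2 * C0 := by
        have := hg ξ h1 h2 (y + h)
        have := hg ξ h1 h2 y
        have := hnn (y + h)
        have := hnn y
        rw [abs_le]; constructor <;> linarith
      have k3 : |G' y * h| ≤ E * |h| := by rw [abs_mul]; gcongr
      have k4 : |h| ≤ h ^ 2 / a := by
        rw [le_div_iff₀ ha0, ← sq_abs, pow_two]; gcongr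
      have k5 : 1 ≤ h ^ 2 / a ^ 2 := by
        rw [le_div_iff₀ (by positivity), one_mul, ← sq_abs h]; gcongr
      calc _ ≤ |gammaPDFReal ξ 1 (y + h) - gammaPDFReal ξ 1 y| + |G' y * h| := abs_sub _ _
        _ ≤ 2 * C0 * (h ^ 2 / a ^ 2) + E * (h ^ 2 / a) := by
            refine add_le_add ?_ ?_
            · exact k2.trans (le_mul_of_one_le_right (by positivity) k5)
            · exact k3.trans (by gcongr)
        _ = (2 * C0 / a ^ 2 + E / a) * h ^ 2 := by ring
        _ ≤ _ := by
            refine mul_le_mul_of_nonneg_right ?_ (sq_nonneg h)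
            have k1 : 0 ≤ C0 / ε ^ 2 := by positivity
            have : E / a ≤ |E| / a := by gcongr; exact le_abs_self E
            linarith [abs_nonneg E]

/-! ### The characteristic function of the gamma distribution -/

/-- The function `t ↦ (1 - i t) ^ (-ξ)`, the characteristic function of the gamma law with shape `ξ`
and rate `1`. -/
noncomputable def gammaChar (ξ t : ℝ) : ℂ :=
  Complex.exp (-(ξ : ℂ) * Complex.log (1 - Complex.I * (t : ℂ)))

theorem one_sub_I_mul_mem_slitPlane (t : ℝ) : 1 - Complex.I * (t : ℂ) ∈ Complex.slitPlane :=
  Or.inl (by simp)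

theorem continuous_gammaChar (ξ : ℝ) : Continuous (gammaChar ξ) := by
  unfold gammaChar
  refine Complex.continuous_exp.comp (continuous_const.mul ?_)
  exact Continuous.clog (by fun_prop) one_sub_I_mul_mem_slitPlane

theorem norm_one_sub_I_mul (t : ℝ) : ‖1 - Complex.I * (t : ℂ)‖ = √(1 + t ^ 2) := by
  rw [Complex.norm_def, Complex.normSq_apply]
  congr 1
  simp
  ring

theorem norm_gammaChar (ξ t : ℝ) : ‖gammaChar ξ t‖ = (1 + t ^ 2) ^ (-ξ / 2) := by
  have h : 0 < 1 + t ^ 2 := by positivity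
  rw [gammaChar, Complex.norm_exp, Real.rpow_def_of_pos h]
  congr 1
  rw [← Complex.ofReal_neg, Complex.re_ofReal_mul, Complex.log_re, norm_one_sub_I_mul,
    Real.log_sqrt h.le]
  ring

theorem norm_gammaChar_le_one {ξ : ℝ} (hξ : 0 ≤ ξ) (t : ℝ) : ‖gammaChar ξ t‖ ≤ 1 := by
  rw [norm_gammaChar]
  exact Real.rpow_le_one_of_one_le_of_nonpos (by nlinarith [sq_nonneg t]) (by linarith)

/-- The freedom to choose a decay exponent `η` below `ξ` matters later: the full power `|t| ^ (-ξ)`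
may fail to be integrable at `0`. -/
theorem norm_gammaChar_le_rpow {ξ η : ℝ} (hη : 0 ≤ η) (hξ : η ≤ ξ) {t : ℝ} (ht : t ≠ 0) :
    ‖gammaChar ξ t‖ ≤ |t| ^ (-η) := by
  rw [norm_gammaChar]
  have ht' : 0 < |t| := abs_pos.2 ht
  calc (1 + t ^ 2) ^ (-ξ / 2) ≤ (1 + t ^ 2) ^ (-η / 2) :=
        Real.rpow_le_rpow_of_exponent_le (by nlinarith [sq_nonneg t]) (by linarith)
    _ ≤ (|t| ^ (2 : ℝ)) ^ (-η / 2) := by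
        refine Real.rpow_le_rpow_of_nonpos (by positivity) ?_ (by linarith)
        rw [Real.rpow_two, sq_abs]; linarith
    _ = |t| ^ (-η) := by
        rw [← Real.rpow_mul ht'.le]; congr 1; ring

theorem gammaPDFReal_smul_ae_eq {E : Type*} [NormedAddCommGroup E] [NormedSpace ℝ E] (ξ : ℝ)
    (f : ℝ → E) :
    (fun z => gammaPDFReal ξ 1 z • f z) =ᵐ[volume] Set.indicator (Set.Ioi 0)
      (fun z => (Real.Gamma ξ)⁻¹ • ((z ^ (ξ - 1) * Real.exp (-z)) • f z)) := by
  have : ∀ᵐ z : ℝ, z ≠ 0 := by simp [ae_iff]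
  filter_upwards [this] with z hz
  rcases lt_or_gt_of_ne hz with h | h
  · simp [gammaPDFReal, h.not_ge, h.le]
  · rw [gammaPDFReal_one_of_nonneg h.le, Set.indicator_of_mem (Set.mem_Ioi.2 h), mul_smul]

theorem integrable_gammaMeasure_iff {E : Type*} [NormedAddCommGroup E] [NormedSpace ℝ E] {ξ : ℝ}
    (hξ : 0 < ξ) {f : ℝ → E} :
    Integrable f (gammaMeasure ξ 1) ↔ Integrable (fun z => gammaPDFReal ξ 1 z • f z) := by
  have hm : Measurable (gammaPDF ξ 1) := (measurable_gammaPDFReal ξ 1).ennreal_ofReal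
  rw [gammaMeasure, integrable_withDensity_iff_integrable_smul' hm
    (Eventually.of_forall fun x => ENNReal.ofReal_lt_top)]
  simp only [gammaPDF, ENNReal.toReal_ofReal (gammaPDFReal_nonneg hξ one_pos _)]

theorem integral_gammaMeasure {E : Type*} [NormedAddCommGroup E] [NormedSpace ℝ E] {ξ : ℝ}
    (hξ : 0 < ξ) (f : ℝ → E) :
    ∫ z, f z ∂gammaMeasure ξ 1 = ∫ z, gammaPDFReal ξ 1 z • f z := by
  have hm : Measurable (gammaPDF ξ 1) := (measurable_gammaPDFReal ξ 1).ennreal_ofReal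
  rw [gammaMeasure, integral_withDensity_eq_integral_toReal_smul hm
    (Eventually.of_forall fun x => ENNReal.ofReal_lt_top)]
  simp only [gammaPDF, ENNReal.toReal_ofReal (gammaPDFReal_nonneg hξ one_pos _)]

theorem Iio_one_subset_integrableExpSet_gammaMeasure {ξ : ℝ} (hξ : 0 < ξ) :
    Set.Iio 1 ⊆ integrableExpSet id (gammaMeasure ξ 1) := by
  intro t ht
  rw [integrableExpSet, Set.mem_ofPred_eq, integrable_gammaMeasure_iff hξ,
    integrable_congr (gammaPDFReal_smul_ae_eq ξ _), integrable_indicator_iff measurableSet_Ioi]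
  have := integrableOn_rpow_mul_exp_neg_mul_rpow (s := ξ - 1) (p := 1) (b := 1 - t)
    (by linarith) one_pos (by simpa using ht)
  refine Integrable.smul (Real.Gamma ξ)⁻¹ (IntegrableOn.congr_fun this (fun z _ => ?_) measurableSet_Ioi)
  simp only [Real.rpow_one, smul_eq_mul, id, mul_assoc, ← Real.exp_add]
  ring_nf

theorem mgf_id_gammaMeasure {ξ t : ℝ} (hξ : 0 < ξ) (ht : t < 1) :
    mgf id (gammaMeasure ξ 1) t = (1 - t) ^ (-ξ) := by
  rw [mgf, integral_gammaMeasure hξ, integral_congr_ae (gammaPDFReal_smul_ae_eq ξ _),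
    integral_indicator measurableSet_Ioi]
  have h1 : 0 < 1 - t := by linarith
  have := Real.integral_rpow_mul_exp_neg_mul_Ioi hξ h1
  have hΓ := (Real.Gamma_pos_of_pos hξ).ne'
  calc _ = ∫ z in Set.Ioi (0 : ℝ), (Real.Gamma ξ)⁻¹ * (z ^ (ξ - 1) * Real.exp (-((1 - t) * z))) := by
        refine setIntegral_congr_fun measurableSet_Ioi fun z _ => ?_
        simp only [smul_eq_mul, id, mul_assoc, ← Real.exp_add]
        ring_nf
    _ = _ := by
        rw [integral_const_mul, this, one_div, Real.inv_rpow h1.le, ← Real.rpow_neg h1.le]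
        field_simp

/-- Both sides are analytic on the half-plane `re z < 1` and agree on its real points, so the
identity theorem applies. The logarithm is the principal one because `1 - z` has positive real part.
-/
theorem complexMGF_id_gammaMeasure {ξ : ℝ} (hξ : 0 < ξ) {z : ℂ} (hz : z.re < 1) :
    complexMGF id (gammaMeasure ξ 1) z = Complex.exp (-(ξ : ℂ) * Complex.log (1 - z)) := by
  have hU : IsOpen {z : ℂ | z.re < 1} := isOpen_lt Complex.continuous_re continuous_const
  have hf : AnalyticOnNhd ℂ (complexMGF id (gammaMeasure ξ 1)) {z : ℂ | z.re < 1} :=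
    analyticOnNhd_complexMGF.mono fun w hw => mem_interior.2
      ⟨Set.Iio 1, Iio_one_subset_integrableExpSet_gammaMeasure hξ, isOpen_Iio, hw⟩
  have hg : AnalyticOnNhd ℂ (fun z : ℂ => Complex.exp (-(ξ : ℂ) * Complex.log (1 - z)))
      {z : ℂ | z.re < 1} := by
    refine DifferentiableOn.analyticOnNhd (fun w hw => ?_) hU
    have : (1 - w) ∈ Complex.slitPlane := Or.inl (by simpa using hw)
    exact (((differentiableAt_id.const_sub 1).clog this).const_mul _).cexp.differentiableWithinAt
  have hconv : IsPreconnected {z : ℂ | z.re < 1} :=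
    (convex_halfSpace_re_lt 1).isPreconnected
  refine hf.eqOn_of_preconnected_of_frequently_eq hg hconv (z₀ := 0) (by simp) ?_ hz
  have hreal : ∀ x : ℝ, x < 1 → complexMGF id (gammaMeasure ξ 1) x =
      Complex.exp (-(ξ : ℂ) * Complex.log (1 - x)) := by
    intro x hx
    have h1 : 0 < 1 - x := by linarith
    rw [complexMGF_ofReal, mgf_id_gammaMeasure hξ hx, Real.rpow_def_of_pos h1]
    push_cast [Complex.ofReal_log h1.le]
    ring_nf
  -- A sequence of real points accumulating at `0` suffices for the identity theorem.
  have ht : Tendsto (fun n : ℕ => ((-(1 / ((n : ℝ) + 1)) : ℝ) : ℂ)) atTop (𝓝[≠] 0) := by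
    refine tendsto_nhdsWithin_iff.2 ⟨?_, Eventually.of_forall fun n => ?_⟩
    · have := (tendsto_one_div_add_atTop_nhds_zero_nat (𝕜 := ℝ)).neg
      rw [neg_zero] at this
      exact (Complex.continuous_ofReal.tendsto' 0 0 (by simp)).comp this
    · have : (0 : ℝ) < 1 / ((n : ℝ) + 1) := by positivity
      simp only [Set.mem_compl_iff, Set.mem_singleton_iff, Complex.ofReal_eq_zero]
      linarith
  refine ht.frequently (Frequently.of_forall fun n => ?_)
  refine hreal _ ?_
  have : (0 : ℝ) < 1 / ((n : ℝ) + 1) := by positivity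
  linarith

theorem integral_cexp_gammaMeasure {ξ : ℝ} (hξ : 0 < ξ) (t : ℝ) :
    ∫ z, Complex.exp (Complex.I * t * z) ∂gammaMeasure ξ 1 = gammaChar ξ t := by
  rw [gammaChar, ← complexMGF_id_gammaMeasure hξ (by simp)]
  rfl

/-- Writing `gammaChar` as an expectation and integrating in `t` first leaves a Gaussian density
centred at `y`. The Gaussian factor is what justifies Fubini, since `gammaChar` itself is not
integrable for `ξ ≤ 1`. -/
theorem integral_gammaChar_mul_gaussian {ξ s : ℝ} (hξ : 0 < ξ) (hs : 0 < s) (y : ℝ) :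
    ∫ t : ℝ, gammaChar ξ t * (Real.exp (-(s ^ 2 * t ^ 2 / 2)) : ℂ) *
        Complex.exp (-(Complex.I * y * t)) =
      ((2 * Real.pi * ∫ h, gammaPDFReal ξ 1 (y + h) ∂gaussianReal 0 (Real.toNNReal (s ^ 2)) : ℝ) : ℂ) := by
  have := isProbabilityMeasure_gammaMeasure hξ one_pos
  set v : NNReal := Real.toNNReal (s ^ 2) with hv
  have hvs : (v : ℝ) = s ^ 2 := Real.coe_toNNReal _ (by positivity)
  have hv0 : v ≠ 0 := by
    rw [← NNReal.coe_ne_zero, hvs]; positivity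
  have hgauss : ∀ z : ℝ, ∫ t : ℝ, Complex.exp (Complex.I * t * z) *
      ((Real.exp (-(s ^ 2 * t ^ 2 / 2)) : ℂ) * Complex.exp (-(Complex.I * y * t))) =
        ((2 * Real.pi * gaussianPDFReal 0 v (z - y) : ℝ) : ℂ) := by
    intro z
    have h := fourierIntegral_gaussian (b := ((s ^ 2 / 2 : ℝ) : ℂ))
      (by rw [Complex.ofReal_re]; positivity) ((z - y : ℝ) : ℂ)
    have e : ∀ t : ℝ, Complex.exp (Complex.I * t * z) *
      ((Real.exp (-(s ^ 2 * t ^ 2 / 2)) : ℂ) * Complex.exp (-(Complex.I * y * t))) =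
        Complex.exp (Complex.I * ((z - y : ℝ) : ℂ) * t) *
          Complex.exp (-((s ^ 2 / 2 : ℝ) : ℂ) * (t : ℂ) ^ 2) := by
      intro t
      rw [Complex.ofReal_exp, ← Complex.exp_add, ← Complex.exp_add, ← Complex.exp_add]
      congr 1
      push_cast
      ring
    simp_rw [e, h]
    rw [gaussianPDFReal, hvs]
    have h1 : ((Real.pi : ℂ) / ((s ^ 2 / 2 : ℝ) : ℂ)) ^ (1 / 2 : ℂ) =
        ((2 * Real.pi * (√(2 * Real.pi * s ^ 2))⁻¹ : ℝ) : ℂ) := by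
      rw [← Complex.ofReal_div, show (1 / 2 : ℂ) = ((1 / 2 : ℝ) : ℂ) by push_cast; rfl,
        ← Complex.ofReal_cpow (by positivity), ← Real.sqrt_eq_rpow]
      congr 1
      rw [Real.sqrt_eq_iff_mul_self_eq (by positivity) (by positivity)]
      field_simp
      rw [Real.sq_sqrt (by positivity)]
    have h2 : Complex.exp (-((z - y : ℝ) : ℂ) ^ 2 / (4 * ((s ^ 2 / 2 : ℝ) : ℂ))) =
        ((Real.exp (-(z - y - 0) ^ 2 / (2 * s ^ 2)) : ℝ) : ℂ) := by
      rw [Complex.ofReal_exp]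
      congr 1
      push_cast
      rw [sub_zero]
      congr 1
      ring
    rw [h1, h2, ← Complex.ofReal_mul, mul_assoc]
  have hint : Integrable (Function.uncurry fun (t z : ℝ) => Complex.exp (Complex.I * t * z) *
      ((Real.exp (-(s ^ 2 * t ^ 2 / 2)) : ℂ) * Complex.exp (-(Complex.I * y * t))))
      (volume.prod (gammaMeasure ξ 1)) := by
    have h0 : Integrable (fun t : ℝ => Real.exp (-(s ^ 2 / 2) * t ^ 2)) :=
      integrable_exp_neg_mul_sq (by positivity)
    have h1 : Integrable (fun _ : ℝ => (1 : ℝ)) (gammaMeasure ξ 1) := integrable_const _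
    refine (h0.mul_prod h1).mono' (Continuous.aestronglyMeasurable (by fun_prop)) ?_
    refine Eventually.of_forall fun p => ?_
    have e1 : ‖Complex.exp (Complex.I * p.1 * p.2)‖ = 1 := by
      rw [Complex.norm_exp]; simp
    have e2 : ‖Complex.exp (-(Complex.I * y * p.1))‖ = 1 := by
      rw [Complex.norm_exp]; simp
    simp only [Function.uncurry, norm_mul, e1, e2, Complex.norm_real, Real.norm_eq_abs,
      Real.abs_exp]
    apply le_of_eq; ring_nf
  calc _ = ∫ t : ℝ, ∫ z, Complex.exp (Complex.I * t * z) *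
      ((Real.exp (-(s ^ 2 * t ^ 2 / 2)) : ℂ) * Complex.exp (-(Complex.I * y * t)))
        ∂gammaMeasure ξ 1 := by
        congr 1 with t
        rw [integral_mul_const, integral_cexp_gammaMeasure hξ, mul_assoc]
    _ = ∫ z, ((2 * Real.pi * gaussianPDFReal 0 v (z - y) : ℝ) : ℂ) ∂gammaMeasure ξ 1 := by
        rw [integral_integral_swap hint]
        congr 1 with z
        exact hgauss z
    _ = _ := by
        rw [integral_complex_ofReal, integral_gammaMeasure hξ, integral_gaussianReal_eq_integral_smul hv0,
          ← integral_const_mul, ← integral_add_left_eq_self _ y]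
        congr 2 with z
        simp only [smul_eq_mul, add_sub_cancel_left]
        ring

/-- The Taylor bound is averaged against a centred Gaussian: the linear term vanishes and the
quadratic one gives the variance `s ^ 2`. -/
theorem exists_abs_integral_gammaChar_sub_le (M : ℝ) {ε : ℝ} (hε : 0 < ε) :
    ∃ C : ℝ, 0 < C ∧ ∀ ξ : ℝ, 1 ≤ ξ → ξ ≤ M → ∀ s : ℝ, 0 < s → ∀ y : ℝ, ε ≤ |y| →
      ‖(1 / (2 * Real.pi) : ℂ) * (∫ t : ℝ, gammaChar ξ t * (Real.exp (-(s ^ 2 * t ^ 2 / 2)) : ℂ) *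
        Complex.exp (-(Complex.I * y * t))) - (gammaPDFReal ξ 1 y : ℂ)‖ ≤ C * s ^ 2 := by
  obtain ⟨C, hC, hT⟩ := exists_gammaPDFReal_taylor M hε
  obtain ⟨C0, hC0, hg⟩ := exists_gammaPDFReal_le M
  refine ⟨C, hC, fun ξ h1 h2 s hs y hy => ?_⟩
  obtain ⟨d, hd⟩ := hT ξ h1 h2 y hy
  set v : NNReal := Real.toNNReal (s ^ 2) with hv
  have hvs : (v : ℝ) = s ^ 2 := Real.coe_toNNReal _ (by positivity)
  rw [integral_gammaChar_mul_gaussian (by linarith) hs]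
  have e : (1 / (2 * Real.pi) : ℂ) * ((2 * Real.pi * ∫ h, gammaPDFReal ξ 1 (y + h)
      ∂gaussianReal 0 v : ℝ) : ℂ) - (gammaPDFReal ξ 1 y : ℂ) =
      (((∫ h, gammaPDFReal ξ 1 (y + h) ∂gaussianReal 0 v) - gammaPDFReal ξ 1 y : ℝ) : ℂ) := by
    have : (Real.pi : ℂ) ≠ 0 := by exact_mod_cast Real.pi_ne_zero
    push_cast
    field_simp
  rw [e, Complex.norm_real, Real.norm_eq_abs]
  have hi1 : Integrable (fun h => gammaPDFReal ξ 1 (y + h)) (gaussianReal 0 v) := by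
    refine Integrable.mono' (integrable_const C0)
      ((measurable_gammaPDFReal ξ 1).comp (measurable_const_add y)).aestronglyMeasurable ?_
    refine Eventually.of_forall fun h => ?_
    rw [Real.norm_eq_abs, abs_of_nonneg (gammaPDFReal_nonneg (by linarith) one_pos _)]
    exact hg ξ h1 h2 _
  have hi2 : Integrable (fun h : ℝ => h) (gaussianReal 0 v) :=
    (memLp_id_gaussianReal' 1 (by simp)).integrable le_rfl
  have hi3 : Integrable (fun h : ℝ => h ^ 2) (gaussianReal 0 v) :=
    (memLp_id_gaussianReal' 2 (by simp)).integrable_sq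
  have hvar : ∫ h : ℝ, h ^ 2 ∂gaussianReal 0 v = s ^ 2 := by
    have := variance_fun_id_gaussianReal (μ := 0) (v := v)
    rw [variance_eq_integral (by fun_prop), integral_id_gaussianReal, hvs] at this
    simpa using this
  have e2 : (∫ h, gammaPDFReal ξ 1 (y + h) ∂gaussianReal 0 v) - gammaPDFReal ξ 1 y =
      ∫ h, (gammaPDFReal ξ 1 (y + h) - gammaPDFReal ξ 1 y - d * h) ∂gaussianReal 0 v := by
    have := integral_sub (hi1.sub (integrable_const (gammaPDFReal ξ 1 y))) (hi2.const_mul d)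
    simp only [Pi.sub_apply] at this
    rw [this, integral_sub hi1 (integrable_const _), integral_const_mul, integral_id_gaussianReal]
    simp
  rw [e2, ← hvar, ← integral_const_mul]
  refine (abs_integral_le_integral_abs).trans ?_
  refine integral_mono ((hi1.sub (integrable_const _)).sub (hi2.const_mul d)).abs
    (hi3.const_mul C) (fun h => ?_)
  exact hd h

/-! ### Estimates of Fourier integrals -/

theorem norm_intervalIntegral_le_two_mul_integral_Ioi {F : ℝ → ℂ} {f : ℝ → ℝ} {δ : ℝ} (hδ : 0 ≤ δ)
    (hf : IntegrableOn f (Set.Ioi 0)) (hf0 : ∀ x, 0 < x → 0 ≤ f x)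
    (hF : ∀ θ, θ ≠ 0 → |θ| ≤ δ → ‖F θ‖ ≤ f |θ|) :
    ‖∫ θ in (-δ)..δ, F θ‖ ≤ 2 * ∫ x in Set.Ioi 0, f x := by
  rw [← integral_comp_abs, intervalIntegral.integral_of_le (by linarith)]
  have hi : Integrable (fun x => f |x|) := integrableOn_univ.1 (by
    have h1 : IntegrableOn (fun x => f |x|) (Set.Ioi 0) :=
      hf.congr_fun (fun x hx => by simp only [abs_of_pos (Set.mem_Ioi.1 hx)]) measurableSet_Ioi
    have h2 : IntegrableOn (fun x => f |x|) (Set.Iic 0) := by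
      have h3 : IntegrableOn (fun x => f |x|) (Set.Ioi (-0)) := by rwa [neg_zero]
      have h4 := h3.comp_neg_Iio
      simp only [abs_neg] at h4
      exact (integrableOn_Iic_iff_integrableOn_Iio (by simp)).2 h4
    rw [← Set.Iic_union_Ioi (a := (0 : ℝ))]
    exact h2.union h1)
  have hne : ∀ᵐ z : ℝ, z ≠ 0 := by simp [ae_iff]
  have hpos : 0 ≤ᵐ[volume] (fun x => f |x|) := by
    filter_upwards [hne] with x hx using hf0 _ (abs_pos.2 hx)
  refine (norm_integral_le_of_norm_le (g := fun x => f |x|) hi.integrableOn ?_).trans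
    (setIntegral_le_integral hi hpos)
  filter_upwards [ae_restrict_of_ae hne, ae_restrict_mem measurableSet_Ioc] with x hx hx2
  exact hF x hx (abs_le.2 ⟨hx2.1.le, hx2.2⟩)

/-- The integral is an explicit Gamma value times `σ ^ (-(p + 1))`. The constant is uniform because
that value is continuous on the compact range of `p`, kept away from the pole by `p₀ > -1`. -/
theorem exists_integral_rpow_mul_exp_neg_sq_le {p₀ : ℝ} (p₁ : ℝ) {c : ℝ} (hp : -1 < p₀) (hc : 0 < c) :
    ∃ C : ℝ, 0 < C ∧ ∀ p : ℝ, p₀ ≤ p → p ≤ p₁ → ∀ σ : ℝ, 0 < σ →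
      IntegrableOn (fun x : ℝ => x ^ p * Real.exp (-(c * σ ^ 2 * x ^ 2))) (Set.Ioi 0) ∧
      ∫ x in Set.Ioi (0 : ℝ), x ^ p * Real.exp (-(c * σ ^ 2 * x ^ 2)) ≤ C * σ ^ (-(p + 1)) := by
  have hcont : ContinuousOn (fun p : ℝ => c ^ (-(p + 1) / 2) * (1 / 2) * Real.Gamma ((p + 1) / 2))
      (Set.Icc p₀ p₁) := by
    intro p hp'
    refine ContinuousAt.continuousWithinAt ?_
    refine ContinuousAt.mul (ContinuousAt.mul ?_ continuousAt_const) ?_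
    · exact ContinuousAt.rpow continuousAt_const (by fun_prop) (Or.inl hc.ne')
    · refine ContinuousAt.comp (g := Real.Gamma) (Real.differentiableAt_Gamma fun m => ?_).continuousAt
        (by fun_prop)
      have := hp'.1
      have : (0 : ℝ) ≤ m := m.cast_nonneg
      linarith
  obtain ⟨C, hC⟩ := (isCompact_Icc.image_of_continuousOn hcont).bddAbove
  refine ⟨max C 1, by positivity, fun p h0 h1 σ hσ => ?_⟩
  have hb : 0 < c * σ ^ 2 := by positivity
  have hp1 : -1 < p := by linarith
  constructor
  · simpa only [neg_mul] using integrableOn_rpow_mul_exp_neg_mul_sq hb hp1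
  · have h := integral_rpow_mul_exp_neg_mul_rpow (p := 2) (q := p) two_pos hp1 hb
    simp only [Real.rpow_two, neg_mul] at h
    rw [h, Real.mul_rpow hc.le (by positivity), ← Real.rpow_natCast σ 2, ← Real.rpow_mul hσ.le]
    have e : ((2 : ℕ) : ℝ) * (-(p + 1) / 2) = -(p + 1) := by push_cast; ring
    have hle : c ^ (-(p + 1) / 2) * (1 / 2) * Real.Gamma ((p + 1) / 2) ≤ max C 1 :=
      (hC (Set.mem_image_of_mem _ ⟨h0, h1⟩)).trans (le_max_left _ _)
    rw [e]
    calc _ = c ^ (-(p + 1) / 2) * (1 / 2) * Real.Gamma ((p + 1) / 2) * σ ^ (-(p + 1)) := by ring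
      _ ≤ _ := by gcongr

theorem exists_mul_norm_integral_le_of_gaussian_bound {p₀ : ℝ} (p₁ : ℝ) {c : ℝ} (hp : -1 < p₀)
    (hc : 0 < c) :
    ∃ C : ℝ, 0 < C ∧ ∀ (q η α σ δ A : ℝ) (F : ℝ → ℂ), p₀ ≤ q - η → q - η ≤ p₁ → 0 < α → 0 < σ →
      0 ≤ δ → 0 ≤ A →
      (∀ θ, θ ≠ 0 → |θ| ≤ δ →
        ‖F θ‖ ≤ A * ((α * |θ|) ^ (-η) * |θ| ^ q * Real.exp (-(c * σ ^ 2 * θ ^ 2)))) →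
      α * ‖∫ θ in (-δ)..δ, F θ‖ ≤ C * (A * σ ^ (-q) * (σ / α) ^ (η - 1)) := by
  obtain ⟨C, hC, h⟩ := exists_integral_rpow_mul_exp_neg_sq_le p₁ hp hc
  refine ⟨2 * C, by positivity, fun q η α σ δ A F h0 h1 hα hσ hδ hA hF => ?_⟩
  obtain ⟨hi, hle⟩ := h (q - η) h0 h1 σ hσ
  have := norm_intervalIntegral_le_two_mul_integral_Ioi (F := F)
    (f := fun x => A * α ^ (-η) * (x ^ (q - η) * Real.exp (-(c * σ ^ 2 * x ^ 2)))) hδ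
    (hi.const_mul _) (fun x hx => by positivity) (fun θ hθ hθδ => by
      have hθ' : 0 < |θ| := abs_pos.2 hθ
      refine (hF θ hθ hθδ).trans_eq ?_
      rw [Real.mul_rpow hα.le hθ'.le, sq_abs, sub_eq_add_neg, Real.rpow_add hθ']
      ring)
  rw [integral_const_mul] at this
  -- The scaling identity behind every power of `σ / α` in the error: `α ^ (1 - η) σ ^ (η - 1 - q) =
  -- σ ^ (-q) (σ / α) ^ (η - 1)`.
  have e : α * (A * α ^ (-η) * (C * σ ^ (-(q - η + 1)))) =
      C * (A * σ ^ (-q) * (σ / α) ^ (η - 1)) := by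
    rw [Real.div_rpow hσ.le hα.le, show -(q - η + 1) = -q + (η - 1) by ring, Real.rpow_add hσ,
      show -η = -(η - 1) + -1 by ring, Real.rpow_add hα, Real.rpow_neg hα.le (η - 1),
      Real.rpow_neg_one]
    field_simp
  calc α * ‖∫ θ in (-δ)..δ, F θ‖ ≤ α * (2 * (A * α ^ (-η) * (C * σ ^ (-(q - η + 1))))) := by
        gcongr
        exact this.trans (by gcongr)
    _ = 2 * (α * (A * α ^ (-η) * (C * σ ^ (-(q - η + 1))))) := by ring
    _ = _ := by rw [e]; ring

theorem norm_gammaChar_mul_le {ξ η α θ : ℝ} (hη : 0 ≤ η) (hξ : η ≤ ξ) (hα : 0 < α) (hθ : θ ≠ 0) :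
    ‖gammaChar ξ (α * θ)‖ ≤ (α * |θ|) ^ (-η) := by
  have := norm_gammaChar_le_rpow hη hξ (t := α * θ) (mul_ne_zero hα.ne' hθ)
  rwa [abs_mul, abs_of_pos hα] at this

theorem norm_cexp_neg_I_mul (a θ : ℝ) : ‖Complex.exp (-(Complex.I * (a : ℂ) * (θ : ℂ)))‖ = 1 := by
  rw [Complex.norm_exp]; simp

/-- Replacing a characteristic function by the Gaussian one. -/
theorem exists_norm_integral_sub_gaussian_le {M r c : ℝ} (hM : 0 ≤ M) (hr : 0 < r) (hc : 0 < c) :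
    ∃ C : ℝ, 0 < C ∧ ∀ (ξ α σ β δ A : ℝ) (D H : ℝ → ℂ), 1 ≤ ξ → 0 < α → 0 < σ → σ ≤ α →
      0 ≤ δ → 0 ≤ β → 0 ≤ A → β / σ ^ (2 + r) ≤ M →
      (∀ θ, |θ| ≤ δ → ‖H θ‖ ≤ A) →
      (∀ θ, |θ| ≤ δ → ‖D θ‖ ≤ β * |θ| ^ (2 + r) * Real.exp (-(c * σ ^ 2 * θ ^ 2))) →
      α * ‖∫ θ in (-δ)..δ, gammaChar ξ (α * θ) * H θ * D θ‖ ≤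
        C * (A * (β / σ ^ (2 + r) * (σ / α) ^ (ξ - 1) + (σ / α) ^ 2)) := by
  obtain ⟨C, hC, h⟩ := exists_mul_norm_integral_le_of_gaussian_bound (p₀ := -1 + r / 2) (1 + r)
    (c := c) (by linarith) hc
  refine ⟨C * (1 + M), by positivity, fun ξ α σ β δ A D H hξ hα hσ hσα hδ hβ hA hT hH hD => ?_⟩
  have hs : 0 < σ / α := by positivity
  have hs1 : σ / α ≤ 1 := (div_le_one hα).2 hσα
  have hT0 : 0 ≤ β / σ ^ (2 + r) := by positivity
  -- Capping the decay exponent keeps the power `2 + r - η` at least `-1 + r / 2`, hence integrable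
  -- at `0`. When the cap is active, `η - 1 ≥ 2`, so the result is absorbed by `(σ / α) ^ 2`.
  set η := min ξ (3 + r / 2) with hη
  have hη1 : 1 ≤ η := le_min hξ (by linarith)
  have hη2 : η ≤ 3 + r / 2 := min_le_right _ _
  have key := h (2 + r) η α σ δ (A * β) (fun θ => gammaChar ξ (α * θ) * H θ * D θ)
    (by linarith) (by linarith) hα hσ hδ (by positivity) (fun θ hθ hθδ => by
      have h1 := norm_gammaChar_mul_le (η := η) (by linarith) (min_le_left _ _) hα hθ
      rw [norm_mul, norm_mul]
      calc ‖gammaChar ξ (α * θ)‖ * ‖H θ‖ * ‖D θ‖ ≤ (α * |θ|) ^ (-η) * A *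
          (β * |θ| ^ (2 + r) * Real.exp (-(c * σ ^ 2 * θ ^ 2))) := by
            gcongr
            · exact hH θ hθδ
            · exact hD θ hθδ
        _ = _ := by ring)
  refine key.trans ?_
  have e : A * β * σ ^ (-(2 + r)) * (σ / α) ^ (η - 1) =
      A * (β / σ ^ (2 + r) * (σ / α) ^ (η - 1)) := by
    rw [Real.rpow_neg hσ.le]; ring
  rw [e, mul_assoc C]
  refine mul_le_mul_of_nonneg_left ?_ hC.le
  rw [mul_left_comm (1 + M)]
  refine mul_le_mul_of_nonneg_left ?_ hA
  have k1 : 0 ≤ β / σ ^ (2 + r) * (σ / α) ^ (ξ - 1) := by positivity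
  have k2 : 0 ≤ (σ / α) ^ 2 := by positivity
  rcases le_total ξ (3 + r / 2) with hle | hle
  · rw [hη, min_eq_left hle]
    nlinarith [mul_nonneg hM k1, mul_nonneg hM k2]
  · have : (σ / α) ^ (η - 1) ≤ (σ / α) ^ 2 := by
      rw [← Real.rpow_two]
      refine Real.rpow_le_rpow_of_exponent_ge hs hs1 ?_
      rw [hη, min_eq_right hle]; linarith
    calc β / σ ^ (2 + r) * (σ / α) ^ (η - 1) ≤ M * (σ / α) ^ 2 := by gcongr
      _ ≤ _ := by nlinarith [mul_nonneg hM k1, mul_nonneg hM k2]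

theorem rpow_le_rpow_neg_of_one_le {w r ξ : ℝ} (hw : 1 ≤ w) (hξ : r ≤ ξ) : w ^ (-ξ) ≤ w ^ (-r) :=
  Real.rpow_le_rpow_of_exponent_le hw (by linarith)

/-- The truncation of the Gaussian-smoothed gamma inversion integral. -/
theorem mul_norm_integral_sub_truncation_le {ξ α σ δ r y : ℝ} (hξ : 1 ≤ ξ) (hr1 : r ≤ 1) (hα : 0 < α)
    (hσ : 0 < σ) (hδ : 0 < δ) (hσδ : 1 ≤ σ * δ) :
    α * ‖(∫ θ : ℝ, gammaChar ξ (α * θ) * (Real.exp (-(σ ^ 2 * θ ^ 2 / 2)) : ℂ) *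
          Complex.exp (-(Complex.I * ((α * y : ℝ) : ℂ) * θ))) -
        ∫ θ in (-δ)..δ, gammaChar ξ (α * θ) * (Real.exp (-(σ ^ 2 * θ ^ 2 / 2)) : ℂ) *
          Complex.exp (-(Complex.I * ((α * y : ℝ) : ℂ) * θ))‖ ≤
      4 * ((σ * δ) ^ (-r) * (σ / α) ^ (ξ - 1)) := by
  set F : ℝ → ℂ := fun θ => gammaChar ξ (α * θ) * (Real.exp (-(σ ^ 2 * θ ^ 2 / 2)) : ℂ) *
          Complex.exp (-(Complex.I * ((α * y : ℝ) : ℂ) * θ)) with hF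
  have hFc : Continuous F := by
    have := (continuous_gammaChar ξ).comp (continuous_const_mul α)
    exact (this.mul (by fun_prop)).mul (by fun_prop)
  have hFn : ∀ θ, ‖F θ‖ = ‖gammaChar ξ (α * θ)‖ * Real.exp (-(σ ^ 2 * θ ^ 2 / 2)) := by
    intro θ
    simp only [hF, norm_mul, norm_cexp_neg_I_mul, mul_one, Complex.norm_real, Real.norm_eq_abs,
      Real.abs_exp]
  have hFi : Integrable F := by
    have h0 : Integrable (fun t : ℝ => Real.exp (-(σ ^ 2 / 2) * t ^ 2)) :=
      integrable_exp_neg_mul_sq (by positivity)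
    refine h0.mono' hFc.aestronglyMeasurable (Eventually.of_forall fun θ => ?_)
    rw [hFn]
    have := norm_gammaChar_le_one (ξ := ξ) (by linarith) (α * θ)
    calc _ ≤ 1 * Real.exp (-(σ ^ 2 * θ ^ 2 / 2)) := by gcongr
      _ = _ := by rw [one_mul]; congr 1; ring
  have hsplit : (∫ θ, F θ) - ∫ θ in (-δ)..δ, F θ =
      (∫ θ in Set.Ioi δ, F (-θ)) + ∫ θ in Set.Ioi δ, F θ := by
    have h1 := intervalIntegral.integral_Iic_add_Ioi (b := δ) hFi.integrableOn hFi.integrableOn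
    have h2 := intervalIntegral.integral_Iic_sub_Iic (a := -δ) (b := δ) hFi.integrableOn
      hFi.integrableOn
    rw [integral_comp_neg_Ioi, ← h1, ← h2]
    ring
  have hbound : ∀ θ, δ < |θ| → ‖F θ‖ ≤
      2 * α ^ (-ξ) * δ ^ (-ξ) / σ ^ 2 * |θ| ^ (-2 : ℝ) := by
    intro θ hθ
    have hθ0 : 0 < |θ| := hδ.trans hθ
    rw [hFn]
    have h1 := norm_gammaChar_mul_le (η := ξ) (by linarith) le_rfl hα (abs_pos.1 hθ0)
    have h2 : (α * |θ|) ^ (-ξ) ≤ α ^ (-ξ) * δ ^ (-ξ) := by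
      rw [Real.mul_rpow hα.le hθ0.le]
      exact mul_le_mul_of_nonneg_left (Real.rpow_le_rpow_of_nonpos hδ hθ.le (by linarith))
        (by positivity)
    -- Only polynomial decay of the Gaussian is needed, from `e^{-x} ≤ 1 / x`.
    have h3 : Real.exp (-(σ ^ 2 * θ ^ 2 / 2)) ≤ 2 / σ ^ 2 * |θ| ^ (-2 : ℝ) := by
      have hx : 0 < σ ^ 2 * θ ^ 2 / 2 := by
        have : 0 < θ ^ 2 := by rw [← sq_abs]; positivity
        positivity
      rw [Real.rpow_neg hθ0.le, Real.rpow_two, sq_abs, Real.exp_neg]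
      have := Real.add_one_le_exp (σ ^ 2 * θ ^ 2 / 2)
      calc (Real.exp (σ ^ 2 * θ ^ 2 / 2))⁻¹ ≤ (σ ^ 2 * θ ^ 2 / 2)⁻¹ := by gcongr; linarith
        _ = _ := by field_simp
    calc _ ≤ (α ^ (-ξ) * δ ^ (-ξ)) * (2 / σ ^ 2 * |θ| ^ (-2 : ℝ)) := by
          gcongr; exact h1.trans h2
      _ = _ := by ring
  have htail : IntegrableOn (fun θ : ℝ => 2 * α ^ (-ξ) * δ ^ (-ξ) / σ ^ 2 * θ ^ (-2 : ℝ))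
      (Set.Ioi δ) := (integrableOn_Ioi_rpow_of_lt (by norm_num) hδ).const_mul _
  have htailv : ∫ θ in Set.Ioi δ, 2 * α ^ (-ξ) * δ ^ (-ξ) / σ ^ 2 * θ ^ (-2 : ℝ) =
      2 * α ^ (-ξ) * δ ^ (-ξ) / σ ^ 2 * δ ^ (-1 : ℝ) := by
    rw [integral_const_mul, integral_Ioi_rpow_of_lt (by norm_num) hδ]
    norm_num
  have hpart : ∀ G : ℝ → ℂ, (∀ θ, δ < θ → ‖G θ‖ ≤ 2 * α ^ (-ξ) * δ ^ (-ξ) / σ ^ 2 * θ ^ (-2 : ℝ)) →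
      ‖∫ θ in Set.Ioi δ, G θ‖ ≤ 2 * α ^ (-ξ) * δ ^ (-ξ) / σ ^ 2 * δ ^ (-1 : ℝ) := by
    intro G hG
    rw [← htailv]
    refine norm_integral_le_of_norm_le htail ?_
    filter_upwards [ae_restrict_mem measurableSet_Ioi] with θ hθ using hG θ hθ
  have hp1 := hpart F fun θ hθ => by
    have := hbound θ (by rwa [abs_of_pos (hδ.trans hθ)])
    rwa [abs_of_pos (hδ.trans hθ)] at this
  have hp2 := hpart (fun θ => F (-θ)) fun θ hθ => by
    have := hbound (-θ) (by rwa [abs_neg, abs_of_pos (hδ.trans hθ)])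
    rwa [abs_neg, abs_of_pos (hδ.trans hθ)] at this
  have hval : α * (2 * α ^ (-ξ) * δ ^ (-ξ) / σ ^ 2 * δ ^ (-1 : ℝ)) =
      2 * ((σ * δ) ^ (-(ξ + 1)) * (σ / α) ^ (ξ - 1)) := by
    rw [Real.div_rpow hσ.le hα.le, Real.mul_rpow hσ.le hδ.le,
      show -ξ = -(ξ - 1) + -1 by ring, Real.rpow_add hα, Real.rpow_neg hα.le (ξ - 1),
      show -(ξ + 1) = -(ξ - 1) + -1 + -1 by ring, Real.rpow_add hδ, Real.rpow_add hδ,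
      Real.rpow_add hσ, Real.rpow_add hσ, Real.rpow_neg hσ.le (ξ - 1)]
    have : δ ^ (-(ξ - 1) + -1) = δ ^ (-(ξ - 1)) * δ⁻¹ := by
      rw [Real.rpow_add hδ, Real.rpow_neg_one]
    simp only [Real.rpow_neg_one, this]
    field_simp
  rw [hsplit]
  calc _ ≤ α * (2 * α ^ (-ξ) * δ ^ (-ξ) / σ ^ 2 * δ ^ (-1 : ℝ) +
        2 * α ^ (-ξ) * δ ^ (-ξ) / σ ^ 2 * δ ^ (-1 : ℝ)) := by
        gcongr
        exact (norm_add_le _ _).trans (add_le_add hp2 hp1)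
    _ = 4 * ((σ * δ) ^ (-(ξ + 1)) * (σ / α) ^ (ξ - 1)) := by rw [mul_add, hval]; ring
    _ ≤ _ := by
        gcongr 4 * (?_ * _)
        exact rpow_le_rpow_neg_of_one_le hσδ (by linarith)

/-- The part of the inversion integral away from the origin. -/
theorem mul_norm_integral_sub_truncation_le_exp {Φ : ℝ → ℂ} {ξ α γ δ L : ℝ} (hξ : 1 ≤ ξ) (hα : 0 < α)
    (hγ : 0 < γ) (hδ : 0 < δ) (hδπ : δ ≤ Real.pi) (hΦ : Continuous Φ) (hL : 0 ≤ L)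
    (h : ∀ θ, δ ≤ |θ| → |θ| ≤ Real.pi →
      ‖Φ θ‖ ≤ L * ((α * |θ|) ^ (-ξ) * Real.exp (-(γ ^ 2 * θ ^ 2 / 5)))) :
    α * ‖(∫ θ in (-Real.pi)..Real.pi, Φ θ) - ∫ θ in (-δ)..δ, Φ θ‖ ≤
      5 * L * (Real.exp (-(γ ^ 2 * δ ^ 2 / 5)) / (γ ^ 2 * δ ^ (ξ + 1) * α ^ (ξ - 1))) := by
  have hsplit : (∫ θ in (-Real.pi)..Real.pi, Φ θ) - ∫ θ in (-δ)..δ, Φ θ =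
      (∫ θ in δ..Real.pi, Φ (-θ)) + ∫ θ in δ..Real.pi, Φ θ := by
    rw [intervalIntegral.integral_comp_neg, ← intervalIntegral.integral_add_adjacent_intervals
      (hΦ.intervalIntegrable (-Real.pi) (-δ)) (hΦ.intervalIntegrable (-δ) Real.pi),
      ← intervalIntegral.integral_add_adjacent_intervals
      (hΦ.intervalIntegrable (-δ) δ) (hΦ.intervalIntegrable δ Real.pi)]
    ring
  set a := γ ^ 2 / 5 with ha
  have ha0 : 0 < a := by positivity
  -- For `θ ≥ δ`, `θ ^ (-ξ) ≤ δ ^ (-ξ - 1) θ`. The extra `θ` makes the Gaussian integrand an exact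
  -- derivative, whence `γ ^ 2` and `δ ^ (ξ + 1)` in the denominator of the error.
  set Q := L * (α ^ (-ξ) * δ ^ (-ξ - 1)) with hQ
  have hFTC : ∫ θ in δ..Real.pi, Q * (θ * Real.exp (-(a * θ ^ 2))) =
      Q * ((Real.exp (-(a * δ ^ 2)) - Real.exp (-(a * Real.pi ^ 2))) / (2 * a)) := by
    rw [intervalIntegral.integral_const_mul, intervalIntegral.integral_eq_sub_of_hasDerivAt
      (f := fun θ => -(Real.exp (-(a * θ ^ 2)) / (2 * a))) (fun θ _ => ?_)
      (Continuous.intervalIntegrable (by fun_prop) _ _)]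
    · ring
    · have h1 : HasDerivAt (fun θ : ℝ => -(a * θ ^ 2)) (-(a * (2 * θ))) θ := by
        simpa using! ((hasDerivAt_pow 2 θ).const_mul a).neg
      refine (h1.exp.div_const (2 * a)).neg.congr_deriv ?_
      field_simp
  have hpart : ∀ G : ℝ → ℂ, (∀ θ, δ ≤ θ → θ ≤ Real.pi →
      ‖G θ‖ ≤ L * ((α * θ) ^ (-ξ) * Real.exp (-(γ ^ 2 * θ ^ 2 / 5)))) →
      ‖∫ θ in δ..Real.pi, G θ‖ ≤ Q * (Real.exp (-(a * δ ^ 2)) / (2 * a)) := by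
    intro G hG
    calc ‖∫ θ in δ..Real.pi, G θ‖ ≤ ∫ θ in δ..Real.pi, Q * (θ * Real.exp (-(a * θ ^ 2))) := by
          refine intervalIntegral.norm_integral_le_of_norm_le hδπ
            (Eventually.of_forall fun θ hθ => ?_) (Continuous.intervalIntegrable (by fun_prop) _ _)
          have hθ0 : 0 < θ := hδ.trans hθ.1
          refine (hG θ hθ.1.le hθ.2).trans ?_
          have k1 : (α * θ) ^ (-ξ) ≤ α ^ (-ξ) * δ ^ (-ξ - 1) * θ := by
            rw [Real.mul_rpow hα.le hθ0.le, mul_assoc]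
            refine mul_le_mul_of_nonneg_left ?_ (by positivity)
            calc θ ^ (-ξ) = θ ^ (-ξ - 1) * θ := by
                  rw [← Real.rpow_add_one hθ0.ne']; ring_nf
              _ ≤ _ := by
                  exact mul_le_mul_of_nonneg_right
                    (Real.rpow_le_rpow_of_nonpos hδ hθ.1.le (by linarith)) hθ0.le
          have k2 : -(γ ^ 2 * θ ^ 2 / 5) = -(a * θ ^ 2) := by rw [ha]; ring
          rw [k2, hQ]
          calc _ ≤ L * ((α ^ (-ξ) * δ ^ (-ξ - 1) * θ) * Real.exp (-(a * θ ^ 2))) := by gcongr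
            _ = _ := by ring
      _ ≤ _ := by
          rw [hFTC]
          have : 0 ≤ Q := by positivity
          gcongr
          have := Real.exp_pos (-(a * Real.pi ^ 2))
          linarith
  have hp1 := hpart Φ fun θ hθ hθ2 => by
    have := h θ (by rwa [abs_of_pos (hδ.trans_le hθ)]) (by rwa [abs_of_pos (hδ.trans_le hθ)])
    rwa [abs_of_pos (hδ.trans_le hθ)] at this
  have hp2 := hpart (fun θ => Φ (-θ)) fun θ hθ hθ2 => by
    have := h (-θ) (by rwa [abs_neg, abs_of_pos (hδ.trans_le hθ)])
      (by rwa [abs_neg, abs_of_pos (hδ.trans_le hθ)])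
    rwa [abs_neg, abs_of_pos (hδ.trans_le hθ), neg_sq] at this
  rw [hsplit]
  calc _ ≤ α * (Q * (Real.exp (-(a * δ ^ 2)) / (2 * a)) + Q * (Real.exp (-(a * δ ^ 2)) / (2 * a))) := by
        gcongr
        exact (norm_add_le _ _).trans (add_le_add hp2 hp1)
    _ = _ := by
        rw [hQ, show -ξ - 1 = -(ξ + 1) by ring, Real.rpow_neg hδ.le,
          show -ξ = -(ξ - 1) + -1 by ring, Real.rpow_add hα, Real.rpow_neg hα.le (ξ - 1),
          Real.rpow_neg_one, show -(γ ^ 2 * δ ^ 2 / 5) = -(a * δ ^ 2) by rw [ha]; ring,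
          show γ ^ 2 = 5 * a by rw [ha]; ring]
        field_simp
        ring

/-- For `ξ ≥ 3/2` the function `gammaChar` is integrable with a uniform bound, and rescaling gives
`1 / α`. At `ξ = 1` this would diverge logarithmically; for `ξ ≤ 3/2` the decay exponent `1/2` is
used together with the Gaussian, which yields the second term because `ξ - 1 ≤ 1/2` and `σ / α ≤ 1`.
-/
theorem exists_norm_integral_le_of_gammaChar_bound :
    ∃ C : ℝ, 0 < C ∧ ∀ (ξ α σ δ L : ℝ) (F : ℝ → ℂ), 1 ≤ ξ → 0 < α → 0 < σ → σ ≤ α → 0 ≤ δ → 0 ≤ L →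
      (∀ θ, |θ| ≤ δ → ‖F θ‖ ≤ L * (‖gammaChar ξ (α * θ)‖ * Real.exp (-(1 / 4 * σ ^ 2 * θ ^ 2)))) →
      ‖∫ θ in (-δ)..δ, F θ‖ ≤ C * (L * (1 / α + 1 / σ * (σ / α) ^ (ξ - 1))) := by
  obtain ⟨C, hC, h⟩ := exists_mul_norm_integral_le_of_gaussian_bound (p₀ := -1 / 2) 0
    (c := 1 / 4) (by norm_num) (by norm_num)
  set J : ℝ := ∫ t in Set.Ioi (0 : ℝ), (1 + t ^ 2) ^ (-(3 / 2 : ℝ) / 2) with hJ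
  have hJ0 : 0 ≤ J := setIntegral_nonneg measurableSet_Ioi fun t _ => by positivity
  refine ⟨C + 2 * J, by positivity, fun ξ α σ δ L F hξ hα hσ hσα hδ hL hF => ?_⟩
  have hs : 0 < σ / α := by positivity
  have hs1 : σ / α ≤ 1 := (div_le_one hα).2 hσα
  have k1 : 0 ≤ 1 / α := by positivity
  have k2 : 0 ≤ 1 / σ * (σ / α) ^ (ξ - 1) := by positivity
  rcases le_total ξ (3 / 2) with hle | hle
  · have key := h 0 (1 / 2) α σ δ L F (by norm_num) (by norm_num) hα hσ hδ hL (fun θ hθ hθδ => by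
      refine (hF θ hθδ).trans ?_
      have h1 := norm_gammaChar_mul_le (ξ := ξ) (η := 1 / 2) (by norm_num) (by linarith) hα hθ
      rw [Real.rpow_zero, mul_one]
      gcongr)
    have h2 : ‖∫ θ in (-δ)..δ, F θ‖ ≤ C * (L * (1 / σ * (σ / α) ^ (1 / 2 : ℝ))) := by
      have e : α * (C * (L * (1 / σ * (σ / α) ^ (1 / 2 : ℝ)))) =
          C * (L * σ ^ (-0 : ℝ) * (σ / α) ^ (1 / 2 - 1 : ℝ)) := by
        rw [Real.rpow_sub_one hs.ne', neg_zero, Real.rpow_zero]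
        field_simp
      rw [← e] at key
      exact le_of_mul_le_mul_left key hα
    have h3 : (σ / α) ^ (1 / 2 : ℝ) ≤ (σ / α) ^ (ξ - 1) :=
      Real.rpow_le_rpow_of_exponent_ge hs hs1 (by linarith)
    calc _ ≤ C * (L * (1 / σ * (σ / α) ^ (1 / 2 : ℝ))) := h2
      _ ≤ (C + 2 * J) * (L * (1 / α + 1 / σ * (σ / α) ^ (ξ - 1))) := by
          have : 1 / σ * (σ / α) ^ (1 / 2 : ℝ) ≤ 1 / α + 1 / σ * (σ / α) ^ (ξ - 1) := by
            have : 1 / σ * (σ / α) ^ (1 / 2 : ℝ) ≤ 1 / σ * (σ / α) ^ (ξ - 1) := by gcongr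
            linarith
          gcongr
          linarith
  · have hint : Integrable (fun t : ℝ => (1 + t ^ 2) ^ (-(3 / 2 : ℝ) / 2)) := by
      have := integrable_rpow_neg_one_add_norm_sq (E := ℝ) (r := 3 / 2) (μ := volume) (by norm_num)
      simpa only [Real.norm_eq_abs, sq_abs] using this
    have key := norm_intervalIntegral_le_two_mul_integral_Ioi (F := F)
      (f := fun x => L * (1 + (α * x) ^ 2) ^ (-(3 / 2 : ℝ) / 2)) hδ
      ((hint.comp_mul_left' hα.ne').const_mul L).integrableOn (fun x _ => by positivity)
      (fun θ hθ hθδ => by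
        refine (hF θ hθδ).trans ?_
        have h1 : ‖gammaChar ξ (α * θ)‖ ≤ (1 + (α * |θ|) ^ 2) ^ (-(3 / 2 : ℝ) / 2) := by
          rw [norm_gammaChar, mul_pow, mul_pow, sq_abs]
          refine Real.rpow_le_rpow_of_exponent_le ?_ (by linarith)
          have : 0 ≤ α ^ 2 * θ ^ 2 := by positivity
          linarith
        have h2 : Real.exp (-(1 / 4 * σ ^ 2 * θ ^ 2)) ≤ 1 :=
          Real.exp_le_one_iff.2 (by have : 0 ≤ 1 / 4 * σ ^ 2 * θ ^ 2 := by positivity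
                                    linarith)
        calc _ ≤ L * ((1 + (α * |θ|) ^ 2) ^ (-(3 / 2 : ℝ) / 2) * 1) := by gcongr
          _ = _ := by rw [mul_one])
    have hcv := integral_comp_mul_left_Ioi (fun t : ℝ => (1 + t ^ 2) ^ (-(3 / 2 : ℝ) / 2)) 0 hα
    rw [mul_zero, ← hJ, smul_eq_mul] at hcv
    rw [integral_const_mul, hcv] at key
    calc _ ≤ 2 * J * (L * (1 / α)) := by refine key.trans_eq ?_; rw [one_div]; ring
      _ ≤ (C + 2 * J) * (L * (1 / α + 1 / σ * (σ / α) ^ (ξ - 1))) := by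
          gcongr
          · linarith
          · linarith

/-! ### Integration by parts against the oscillating phase. -/

theorem hasDerivAt_gammaChar_mul (ξ α θ : ℝ) :
    HasDerivAt (fun θ : ℝ => gammaChar ξ (α * θ))
      (gammaChar ξ (α * θ) * (ξ * (Complex.I * α / (1 - Complex.I * (α * θ : ℝ))))) θ := by
  have h0 := one_sub_I_mul_mem_slitPlane (α * θ)
  have h1 : HasDerivAt (fun θ : ℝ => 1 - Complex.I * ((α * θ : ℝ) : ℂ)) (-(Complex.I * α)) θ := by
    have h2 : HasDerivAt (fun θ : ℝ => ((α * θ : ℝ) : ℂ)) ((α : ℝ) : ℂ) θ := by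
      have := ((hasDerivAt_id θ).const_mul α).ofReal_comp
      simpa using! this
    exact (h2.const_mul Complex.I).const_sub 1
  have h3 := ((h1.clog_real h0).const_mul (-(ξ : ℂ))).cexp
  refine h3.congr_deriv ?_
  simp only [gammaChar]
  ring

/-- Differentiation costs a factor `α / |1 - iαθ|`, which the weight `|θ|` cancels. The weight will
come from `Ψ θ - 1 = O(θ)`. -/
theorem norm_deriv_gammaChar_mul_le {ξ α θ : ℝ} (hξ : 0 ≤ ξ) (hα : 0 ≤ α) :
    |θ| * ‖gammaChar ξ (α * θ) * (ξ * (Complex.I * α / (1 - Complex.I * (α * θ : ℝ))))‖ ≤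
      ξ * ‖gammaChar ξ (α * θ)‖ := by
  have hD : 0 < ‖1 - Complex.I * ((α * θ : ℝ) : ℂ)‖ := by
    rw [norm_one_sub_I_mul]; positivity
  have h1 : |θ| * (α / ‖1 - Complex.I * ((α * θ : ℝ) : ℂ)‖) ≤ 1 := by
    rw [← mul_div_assoc, div_le_one hD, norm_one_sub_I_mul]
    refine Real.le_sqrt_of_sq_le ?_
    rw [mul_pow, sq_abs, mul_pow]
    nlinarith
  rw [norm_mul, norm_mul, norm_div, norm_mul, Complex.norm_I, one_mul, Complex.norm_real,
    Complex.norm_real, Real.norm_eq_abs, Real.norm_eq_abs, abs_of_nonneg hξ, abs_of_nonneg hα]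
  calc _ = (ξ * ‖gammaChar ξ (α * θ)‖) * (|θ| * (α / ‖1 - Complex.I * ((α * θ : ℝ) : ℂ)‖)) := by ring
    _ ≤ (ξ * ‖gammaChar ξ (α * θ)‖) * 1 := by gcongr
    _ = _ := mul_one _

theorem norm_integral_mul_cexp_le {h h' : ℝ → ℂ} {a δ : ℝ} (ha : a ≠ 0)
    (hd : ∀ θ, HasDerivAt h (h' θ) θ)
    (hi : IntervalIntegrable h' volume (-δ) δ) :
    ‖∫ θ in (-δ)..δ, h θ * Complex.exp (-(Complex.I * (a : ℂ) * θ))‖ ≤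
      1 / |a| * (‖h δ‖ + ‖h (-δ)‖ +
        ‖∫ θ in (-δ)..δ, h' θ * Complex.exp (-(Complex.I * (a : ℂ) * θ))‖) := by
  have haC : (a : ℂ) ≠ 0 := by exact_mod_cast ha
  set k : ℂ := (-(Complex.I * (a : ℂ)))⁻¹ with hk
  have hkn : ‖k‖ = 1 / |a| := by simp [hk]
  have hv : ∀ θ : ℝ, HasDerivAt (fun θ : ℝ => k * Complex.exp (-(Complex.I * (a : ℂ) * θ)))
      (Complex.exp (-(Complex.I * (a : ℂ) * θ))) θ := by
    intro θ
    have h1 : HasDerivAt (fun θ : ℝ => -(Complex.I * (a : ℂ) * (θ : ℂ))) (-(Complex.I * (a : ℂ))) θ := by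
      have := (Complex.ofRealCLM.hasDerivAt (x := θ)).const_mul (Complex.I * (a : ℂ))
      simpa using! this.neg
    refine (h1.cexp.const_mul k).congr_deriv ?_
    rw [hk]
    field_simp
  have hparts := intervalIntegral.integral_mul_deriv_eq_deriv_mul (a := -δ) (b := δ)
    (fun θ _ => hd θ) (fun θ _ => hv θ) hi (Continuous.intervalIntegrable (by fun_prop) _ _)
  rw [hparts]
  have e : ∫ θ in (-δ)..δ, h' θ * (k * Complex.exp (-(Complex.I * (a : ℂ) * θ))) =
      k * ∫ θ in (-δ)..δ, h' θ * Complex.exp (-(Complex.I * (a : ℂ) * θ)) := by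
    rw [← intervalIntegral.integral_const_mul]
    congr 1 with θ
    ring
  rw [e]
  refine (norm_sub_le _ _).trans ?_
  refine (add_le_add (norm_sub_le _ _) le_rfl).trans_eq ?_
  rw [norm_mul, norm_mul, norm_mul, norm_mul, norm_mul, norm_cexp_neg_I_mul, norm_cexp_neg_I_mul,
    hkn]
  ring

theorem norm_sub_one_le_of_norm_deriv_le {Ψ : ℝ → ℂ} {A δ : ℝ} (hΨ : ∀ θ, DifferentiableAt ℝ Ψ θ)
    (hΨ' : ∀ θ, |θ| ≤ δ → ‖deriv Ψ θ‖ ≤ A) (h1 : Ψ 0 = 1) {θ : ℝ} (hθ : |θ| ≤ δ) :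
    ‖Ψ θ - 1‖ ≤ A * |θ| := by
  have hδ : 0 ≤ δ := (abs_nonneg _).trans hθ
  have := (convex_closedBall (0 : ℝ) δ).norm_image_sub_le_of_norm_deriv_le (f := Ψ)
    (fun x _ => hΨ x) (fun x hx => hΨ' x (by simpa using hx)) (x := 0) (y := θ)
    (by simpa using hδ) (by simpa using hθ)
  simpa [h1] using this

/-- With `u = σ²θ²`, this absorbs the polynomial factor created by differentiating the Gaussian, at
the price of half the decay rate. -/
theorem one_add_mul_exp_neg_le {u : ℝ} :
    (1 + u) * Real.exp (-(u / 2)) ≤ 4 * Real.exp (-(u / 4)) := by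
  have h1 := Real.add_one_le_exp (u / 4)
  have h2 : 1 + u ≤ 4 * Real.exp (u / 4) := by linarith
  calc _ ≤ 4 * Real.exp (u / 4) * Real.exp (-(u / 2)) := by gcongr
    _ = _ := by rw [mul_assoc, ← Real.exp_add]; ring_nf

/-- Replacing a smooth correction factor by `1`, by integration by parts. -/
theorem exists_mul_norm_integral_correction_le {M A ε : ℝ} (hM : 0 ≤ M) (hA : 0 ≤ A) (hε : 0 < ε) :
    ∃ C : ℝ, 0 < C ∧ ∀ (ξ α σ δ r y : ℝ) (Ψ : ℝ → ℂ), 1 ≤ ξ → ξ ≤ M → 0 < α → 0 < σ → σ ≤ α → 0 < δ →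
      δ ≤ 2 → 1 ≤ σ * δ → r ≤ 1 → ε ≤ |y| → (∀ θ, DifferentiableAt ℝ Ψ θ) →
      (∀ θ, |θ| ≤ δ → ‖deriv Ψ θ‖ ≤ A) → Ψ 0 = 1 →
      α * ‖∫ θ in (-δ)..δ, gammaChar ξ (α * θ) * (Ψ θ - 1) * (Real.exp (-(σ ^ 2 * θ ^ 2 / 2)) : ℂ) *
          Complex.exp (-(Complex.I * ((α * y : ℝ) : ℂ) * θ))‖ ≤
        C * (1 / α + (σ * δ) ^ (-r) * (σ / α) ^ (ξ - 1)) := by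
  obtain ⟨C, hC, hW⟩ := exists_norm_integral_le_of_gammaChar_bound
  set L : ℝ := 4 * (A * (M + 1)) with hL
  have hL0 : 0 ≤ L := by positivity
  refine ⟨1 / ε * (4 * A + C * L * 2) + 1, by positivity, ?_⟩
  intro ξ α σ δ r y Ψ hξ hξM hα hσ hσα hδ hδ2 hσδ hr hy hΨ hΨ' hΨ0
  have hy0 : 0 < |y| := hε.trans_le hy
  have hs : 0 < σ / α := by positivity
  have hs1 : σ / α ≤ 1 := (div_le_one hα).2 hσα
  set b : ℝ → ℂ := fun θ => gammaChar ξ (α * θ) with hb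
  set b' : ℝ → ℂ := fun θ => gammaChar ξ (α * θ) *
    (ξ * (Complex.I * α / (1 - Complex.I * (α * θ : ℝ)))) with hb'
  set G : ℝ → ℂ := fun θ => (Real.exp (-(σ ^ 2 * θ ^ 2 / 2)) : ℂ) with hG
  set h : ℝ → ℂ := fun θ => b θ * (Ψ θ - 1) * G θ with hh
  set h' : ℝ → ℂ := fun θ => (b' θ * (Ψ θ - 1) + b θ * deriv Ψ θ) * G θ +
    b θ * (Ψ θ - 1) * (-(σ ^ 2 * θ : ℝ) * G θ) with hh'
  have hGn : ∀ θ, ‖G θ‖ = Real.exp (-(σ ^ 2 * θ ^ 2 / 2)) := fun θ => by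
    rw [hG, Complex.norm_real, Real.norm_eq_abs, Real.abs_exp]
  have hGd : ∀ θ, HasDerivAt G (-(σ ^ 2 * θ : ℝ) * G θ) θ := by
    intro θ
    have h1 : HasDerivAt (fun θ : ℝ => -(σ ^ 2 * θ ^ 2 / 2)) (-(σ ^ 2 * θ)) θ := by
      refine ((((hasDerivAt_pow 2 θ).const_mul (σ ^ 2)).div_const 2).neg).congr_deriv ?_
      norm_num
      ring
    refine h1.exp.ofReal_comp.congr_deriv ?_
    simp only [hG]
    push_cast
    ring
  have hd : ∀ θ, HasDerivAt h (h' θ) θ := fun θ =>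
    ((hasDerivAt_gammaChar_mul ξ α θ).mul ((hΨ θ).hasDerivAt.sub_const 1)).mul (hGd θ)
  -- The constant `L` does not involve `α`: this is where the vanishing of `Ψ - 1` at `0` pays for
  -- the derivative of `gammaChar`.
  have hbn : ∀ θ, |θ| ≤ δ → ‖h' θ‖ ≤
      L * (‖gammaChar ξ (α * θ)‖ * Real.exp (-(1 / 4 * σ ^ 2 * θ ^ 2))) := by
    intro θ hθ
    have k1 := norm_sub_one_le_of_norm_deriv_le hΨ hΨ' hΨ0 hθ
    have k2 := norm_deriv_gammaChar_mul_le (θ := θ) (ξ := ξ) (by linarith) hα.le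
    have k3 := hΨ' θ hθ
    have m1 : ‖b' θ * (Ψ θ - 1)‖ ≤ A * (M * ‖b θ‖) := by
      rw [norm_mul]
      calc ‖b' θ‖ * ‖Ψ θ - 1‖ ≤ ‖b' θ‖ * (A * |θ|) := by gcongr
        _ = A * (|θ| * ‖b' θ‖) := by ring
        _ ≤ A * (ξ * ‖b θ‖) := by gcongr
        _ ≤ _ := by gcongr
    have m2 : ‖b θ * deriv Ψ θ‖ ≤ A * ‖b θ‖ := by
      rw [norm_mul, mul_comm]; gcongr
    have m3 : ‖b θ * (Ψ θ - 1) * (-(σ ^ 2 * θ : ℝ) * G θ)‖ ≤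
        A * ‖b θ‖ * (σ ^ 2 * θ ^ 2) * ‖G θ‖ := by
      rw [norm_mul, norm_mul, norm_mul, norm_neg, Complex.norm_real, Real.norm_eq_abs, abs_mul,
        abs_of_nonneg (sq_nonneg σ)]
      calc _ ≤ ‖b θ‖ * (A * |θ|) * (σ ^ 2 * |θ| * ‖G θ‖) := by gcongr
        _ = A * ‖b θ‖ * (σ ^ 2 * |θ| ^ 2) * ‖G θ‖ := by ring
        _ = _ := by rw [sq_abs]
    calc ‖h' θ‖ ≤ (A * (M * ‖b θ‖) + A * ‖b θ‖) * ‖G θ‖ + A * ‖b θ‖ * (σ ^ 2 * θ ^ 2) * ‖G θ‖ := by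
          refine (norm_add_le _ _).trans (add_le_add ?_ m3)
          rw [norm_mul]
          gcongr
          exact (norm_add_le _ _).trans (add_le_add m1 m2)
      _ ≤ A * (M + 1) * ‖b θ‖ * ((1 + σ ^ 2 * θ ^ 2) * ‖G θ‖) := by
          have : 0 ≤ A * M * ‖b θ‖ * (σ ^ 2 * θ ^ 2) * ‖G θ‖ := by positivity
          linarith
      _ ≤ A * (M + 1) * ‖b θ‖ * (4 * Real.exp (-(σ ^ 2 * θ ^ 2 / 4))) := by
          rw [hGn]
          exact mul_le_mul_of_nonneg_left one_add_mul_exp_neg_le (by positivity)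
      _ = _ := by
          rw [hL, show -(1 / 4 * σ ^ 2 * θ ^ 2) = -(σ ^ 2 * θ ^ 2 / 4) by ring]
          ring
  -- `deriv Ψ` is only bounded, not continuous, so measurability is taken from `h'` being a
  -- derivative.
  have hint : IntervalIntegrable h' volume (-δ) δ := by
    refine (intervalIntegrable_const (c := L)).mono_fun' ?_ ?_
    · have e : h' = deriv h := by ext θ; rw [(hd θ).deriv]
      rw [e]
      exact (measurable_deriv h).aestronglyMeasurable
    · filter_upwards [ae_restrict_mem measurableSet_uIoc] with θ hθ
      rw [Set.uIoc_of_le (by linarith)] at hθ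
      refine (hbn θ (abs_le.2 ⟨hθ.1.le, hθ.2⟩)).trans ?_
      have h2 : Real.exp (-(1 / 4 * σ ^ 2 * θ ^ 2)) ≤ 1 :=
        Real.exp_le_one_iff.2 (by have : 0 ≤ 1 / 4 * σ ^ 2 * θ ^ 2 := by positivity
                                  linarith)
      have h3 := norm_gammaChar_le_one (ξ := ξ) (by linarith) (α * θ)
      calc _ ≤ L * (1 * 1) := by gcongr
        _ = L := by ring
  have hya : α * y ≠ 0 := mul_ne_zero hα.ne' (abs_pos.1 hy0)
  have hIBP := norm_integral_mul_cexp_le hya hd hint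
  have hW' := hW ξ α σ δ L (fun θ => h' θ * Complex.exp (-(Complex.I * ((α * y : ℝ) : ℂ) * θ)))
    hξ hα hσ hσα hδ.le hL0 (fun θ hθ => by
      rw [norm_mul, norm_cexp_neg_I_mul, mul_one]; exact hbn θ hθ)
  have hw1 : (σ * δ) ^ (-1 : ℝ) ≤ (σ * δ) ^ (-r) := rpow_le_rpow_neg_of_one_le hσδ hr
  set R : ℝ := (σ * δ) ^ (-r) * (σ / α) ^ (ξ - 1) with hR
  have hR0 : 0 ≤ R := by positivity
  have hbd : ∀ θ, |θ| = δ → ‖h θ‖ ≤ 2 * A * R := by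
    intro θ hθ
    have hθ0 : θ ≠ 0 := abs_pos.1 (by rw [hθ]; exact hδ)
    have k1 := norm_sub_one_le_of_norm_deriv_le hΨ hΨ' hΨ0 hθ.le
    have k2 := norm_gammaChar_mul_le (ξ := ξ) (η := ξ) (by linarith) le_rfl hα hθ0
    have k3 : ‖G θ‖ ≤ 1 := by
      rw [hGn]
      exact Real.exp_le_one_iff.2 (by have : 0 ≤ σ ^ 2 * θ ^ 2 / 2 := by positivity
                                      linarith)
    have k4 : (α * |θ|) ^ (-ξ) ≤ R := by
      -- At the endpoints the decay is `(σδ) ^ (-ξ) (σ / α) ^ ξ`; both exponents may be weakened, to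
      -- `-r` and `ξ - 1`, because `σδ ≥ 1` and `σ / α ≤ 1`.
      have e : α * |θ| = (σ * δ) * (σ / α)⁻¹ := by rw [hθ]; field_simp
      rw [e, Real.mul_rpow (by positivity) (by positivity), Real.inv_rpow hs.le,
        ← Real.rpow_neg hs.le, neg_neg, hR]
      gcongr 1
      · exact rpow_le_rpow_neg_of_one_le hσδ (by linarith)
      · exact Real.rpow_le_rpow_of_exponent_ge hs hs1 (by linarith)
    rw [hh, norm_mul, norm_mul]
    calc _ ≤ R * (A * 2) * 1 := by
          gcongr
          · exact k2.trans k4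
          · refine k1.trans ?_
            rw [hθ]; gcongr
      _ = _ := by ring
  have hσR : 1 / σ * (σ / α) ^ (ξ - 1) ≤ 2 * R := by
    have : 1 / σ ≤ 2 * (σ * δ) ^ (-r) := by
      calc 1 / σ = δ * (σ * δ) ^ (-1 : ℝ) := by rw [Real.rpow_neg_one]; field_simp
        _ ≤ 2 * (σ * δ) ^ (-r) := by gcongr
    rw [hR, ← mul_assoc]
    gcongr
  have hα0 : 0 ≤ 1 / α := by positivity
  calc α * ‖∫ θ in (-δ)..δ, h θ * Complex.exp (-(Complex.I * ((α * y : ℝ) : ℂ) * θ))‖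
      ≤ α * (1 / |α * y| * (2 * A * R + 2 * A * R + C * (L * (1 / α + 2 * R)))) := by
        gcongr
        refine hIBP.trans ?_
        gcongr
        · exact hbd δ (abs_of_pos hδ)
        · exact hbd (-δ) (by rw [abs_neg, abs_of_pos hδ])
        · exact hW'.trans (by gcongr)
    -- The factor `1 / |αy|` gained by parts cancels the prefactor `α`.
    _ = 1 / |y| * (2 * A * R + 2 * A * R + C * (L * (1 / α + 2 * R))) := by
        rw [abs_mul, abs_of_pos hα]; field_simp
    _ ≤ 1 / ε * (2 * A * R + 2 * A * R + C * (L * (1 / α + 2 * R))) := by gcongr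
    _ ≤ 1 / ε * ((4 * A + C * L * 2) * (1 / α + R)) := by
        gcongr
        have : 0 ≤ A * (1 / α) := by positivity
        have : 0 ≤ C * L * (1 / α) := by positivity
        linarith
    _ ≤ _ := by
        have : 0 ≤ 1 / α + R := by positivity
        linarith

theorem mul_integral_comp_mul_left_gammaChar (ξ σ y : ℝ) {α : ℝ} (hα : 0 < α) :
    (α : ℂ) * ∫ θ : ℝ, gammaChar ξ (α * θ) * (Real.exp (-(σ ^ 2 * θ ^ 2 / 2)) : ℂ) *
        Complex.exp (-(Complex.I * ((α * y : ℝ) : ℂ) * θ)) =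
      ∫ t : ℝ, gammaChar ξ t * (Real.exp (-((σ / α) ^ 2 * t ^ 2 / 2)) : ℂ) *
        Complex.exp (-(Complex.I * y * t)) := by
  have h := Measure.integral_comp_mul_left (fun t : ℝ => gammaChar ξ t *
    (Real.exp (-((σ / α) ^ 2 * t ^ 2 / 2)) : ℂ) * Complex.exp (-(Complex.I * y * t))) α
  rw [abs_of_pos (inv_pos.2 hα)] at h
  have e : ∀ θ : ℝ, gammaChar ξ (α * θ) * (Real.exp (-((σ / α) ^ 2 * (α * θ) ^ 2 / 2)) : ℂ) *
      Complex.exp (-(Complex.I * y * (α * θ : ℝ))) = gammaChar ξ (α * θ) *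
        (Real.exp (-(σ ^ 2 * θ ^ 2 / 2)) : ℂ) *
        Complex.exp (-(Complex.I * ((α * y : ℝ) : ℂ) * θ)) := by
    intro θ
    congr 2
    · congr 3
      field_simp
    · push_cast; ring_nf
  simp_rw [e] at h
  rw [h, Complex.real_smul, ← mul_assoc]
  have : (α : ℂ) ≠ 0 := by exact_mod_cast hα.ne'
  push_cast
  rw [mul_inv_cancel₀ this, one_mul]

/-- The Fourier-analytic core of the gamma approximation. -/
theorem exists_norm_fourier_sub_gammaPDFReal_le {M A L c r ε : ℝ} (hM : 0 ≤ M) (hA : 0 ≤ A)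
    (hL : 0 ≤ L) (hc : 0 < c) (hr : 0 < r) (hr1 : r ≤ 1) (hε : 0 < ε) :
    ∃ K : ℝ, ∀ (ξ α σ β γ δ y : ℝ) (Ψ φ Φ : ℝ → ℂ), 1 ≤ ξ → ξ ≤ M → 0 < α → 0 < σ → σ ≤ α →
      0 ≤ β → 0 < γ → 0 < δ → δ ≤ 2 → 1 ≤ σ * δ → (σ * δ) ^ (-r) = 2 * (β / σ ^ (2 + r)) →
      ε ≤ |y| → (∀ θ, DifferentiableAt ℝ Ψ θ) → (∀ θ, |θ| ≤ δ → ‖deriv Ψ θ‖ ≤ A) → Ψ 0 = 1 →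
      Continuous φ →
      (∀ θ, |θ| ≤ δ → ‖φ θ - (Real.exp (-(σ ^ 2 * θ ^ 2 / 2)) : ℂ)‖ ≤
        L * β * |θ| ^ (2 + r) * Real.exp (-(c * σ ^ 2 * θ ^ 2))) →
      Continuous Φ →
      (∀ θ, |θ| ≤ δ → Φ θ = gammaChar ξ (α * θ) * Ψ θ * φ θ *
        Complex.exp (-(Complex.I * ((α * y : ℝ) : ℂ) * θ))) →
      (∀ θ, δ ≤ |θ| → |θ| ≤ Real.pi →
        ‖Φ θ‖ ≤ L * ((α * |θ|) ^ (-ξ) * Real.exp (-(γ ^ 2 * θ ^ 2 / 5)))) →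
      ‖(α : ℂ) * ((1 / (2 * Real.pi) : ℂ) * ∫ θ in (-Real.pi)..Real.pi, Φ θ) -
          (gammaPDFReal ξ 1 y : ℂ)‖ ≤ K * gammaError α ξ r σ β γ δ := by
  obtain ⟨C1, hC1, h1⟩ := exists_norm_integral_sub_gaussian_le (M := L) (r := r) hL hr hc
  obtain ⟨C2, hC2, h2⟩ := exists_mul_norm_integral_correction_le hM hA hε
  obtain ⟨C3, hC3, h3⟩ := exists_abs_integral_gammaChar_sub_le M hε
  refine ⟨5 * L + C1 * (1 + 2 * A) * (L + 1) + 2 * C2 + 8 + C3, ?_⟩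
  intro ξ α σ β γ δ y Ψ φ Φ hξ hξM hα hσ hσα hβ hγ hδ hδ2 hσδ hT hy hΨ hΨ' hΨ0 hφc hφ hΦc hΦ hΦ2
  have hs : 0 < σ / α := by positivity
  set e : ℝ → ℂ := fun θ => Complex.exp (-(Complex.I * ((α * y : ℝ) : ℂ) * θ)) with he
  set b : ℝ → ℂ := fun θ => gammaChar ξ (α * θ) with hb
  set G : ℝ → ℂ := fun θ => (Real.exp (-(σ ^ 2 * θ ^ 2 / 2)) : ℂ) with hG
  have hec : Continuous e := by fun_prop
  have hbc : Continuous b := (continuous_gammaChar ξ).comp (continuous_const_mul α)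
  have hGc : Continuous G := by fun_prop
  have hΨc : Continuous Ψ := continuous_iff_continuousAt.2 fun θ => (hΨ θ).continuousAt
  have hen : ∀ θ, ‖e θ‖ = 1 := fun θ => norm_cexp_neg_I_mul _ _
  -- Consecutive integrals differ by one replacement: cutting at `δ`, `φ` by `G`, `Ψ` by `1`, and
  -- `[-δ, δ]` by the whole line. Only the last integral is computed through the gamma density.
  set I₁ : ℂ := ∫ θ in (-Real.pi)..Real.pi, Φ θ
  set I₂ : ℂ := ∫ θ in (-δ)..δ, Φ θ with hI₂
  set I₃ : ℂ := ∫ θ in (-δ)..δ, b θ * Ψ θ * G θ * e θ with hI₃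
  set I₄ : ℂ := ∫ θ in (-δ)..δ, b θ * G θ * e θ with hI₄
  set I₅ : ℂ := ∫ θ : ℝ, b θ * G θ * e θ with hI₅
  set T : ℝ := β / σ ^ (2 + r) with hTdef
  have hT0 : 0 ≤ T := by positivity
  have hσδr : (σ * δ) ^ (-r) ≤ 1 := Real.rpow_le_one_of_one_le_of_nonpos hσδ (by linarith)
  have hΨb : ∀ θ, |θ| ≤ δ → ‖Ψ θ * e θ‖ ≤ 1 + 2 * A := by
    intro θ hθ
    have k1 := norm_sub_one_le_of_norm_deriv_le hΨ hΨ' hΨ0 hθ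
    have k2 : ‖Ψ θ‖ ≤ ‖Ψ θ - 1‖ + ‖(1 : ℂ)‖ := by
      simpa using norm_add_le (Ψ θ - 1) 1
    rw [norm_one] at k2
    rw [norm_mul, hen, mul_one]
    have k3 : A * |θ| ≤ A * 2 := by gcongr; exact hθ.trans hδ2
    linarith
  have b1 : α * ‖I₁ - I₂‖ ≤ 5 * L * (Real.exp (-(γ ^ 2 * δ ^ 2 / 5)) /
      (γ ^ 2 * δ ^ (ξ + 1) * α ^ (ξ - 1))) :=
    mul_norm_integral_sub_truncation_le_exp hξ hα hγ hδ (hδ2.trans Real.two_le_pi) hΦc hL hΦ2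
  have b2 : α * ‖I₂ - I₃‖ ≤ C1 * ((1 + 2 * A) * (L * (T * (σ / α) ^ (ξ - 1)) + (σ / α) ^ 2)) := by
    have h := h1 ξ α σ (L * β) δ (1 + 2 * A) (fun θ => φ θ - G θ) (fun θ => Ψ θ * e θ) hξ hα hσ hσα
      hδ.le (by positivity) (by positivity) (by rw [mul_div_assoc]; nlinarith) hΨb hφ
    have hI : I₂ - I₃ = ∫ θ in (-δ)..δ, gammaChar ξ (α * θ) * (Ψ θ * e θ) * (φ θ - G θ) := by
      rw [hI₂, hI₃, ← intervalIntegral.integral_sub (hΦc.intervalIntegrable _ _)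
        (Continuous.intervalIntegrable (by fun_prop) _ _)]
      refine intervalIntegral.integral_congr fun θ hθ => ?_
      rw [Set.uIcc_of_le (by linarith)] at hθ
      simp only [hΦ θ (abs_le.2 hθ), hb, he]
      ring
    rw [hI]
    refine h.trans_eq ?_
    rw [mul_div_assoc]
    ring
  have b3 : α * ‖I₃ - I₄‖ ≤ C2 * (1 / α + 2 * (T * (σ / α) ^ (ξ - 1))) := by
    have h := h2 ξ α σ δ r y Ψ hξ hξM hα hσ hσα hδ hδ2 hσδ hr1 hy hΨ hΨ' hΨ0
    have hI : I₃ - I₄ = ∫ θ in (-δ)..δ, b θ * (Ψ θ - 1) * G θ * e θ := by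
      rw [hI₃, hI₄, ← intervalIntegral.integral_sub (Continuous.intervalIntegrable (by fun_prop) _ _)
        (Continuous.intervalIntegrable (by fun_prop) _ _)]
      congr 1 with θ
      ring
    rw [hI]
    refine h.trans_eq ?_
    rw [hT]; ring
  have b4 : α * ‖I₄ - I₅‖ ≤ 8 * (T * (σ / α) ^ (ξ - 1)) := by
    have h := mul_norm_integral_sub_truncation_le (y := y) hξ hr1 hα hσ hδ hσδ
    rw [norm_sub_rev]
    refine h.trans_eq ?_
    rw [hT]; ring
  have b5 : ‖(α : ℂ) * ((1 / (2 * Real.pi) : ℂ) * I₅) - (gammaPDFReal ξ 1 y : ℂ)‖ ≤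
      C3 * (σ / α) ^ 2 := by
    have h := h3 ξ hξ hξM (σ / α) hs y hy
    rw [← mul_integral_comp_mul_left_gammaChar ξ σ y hα, mul_left_comm] at h
    exact h
  set k : ℂ := (1 / (2 * Real.pi) : ℂ) with hk
  have hk1 : ‖k‖ ≤ 1 := by
    rw [hk, show (1 / (2 * Real.pi) : ℂ) = ((1 / (2 * Real.pi) : ℝ) : ℂ) by push_cast; rfl,
      Complex.norm_real, Real.norm_eq_abs, abs_of_pos (by positivity), div_le_one (by positivity)]
    linarith [Real.two_le_pi]
  have hterm : ∀ (z : ℂ) (R : ℝ), α * ‖z‖ ≤ R → ‖(α : ℂ) * (k * z)‖ ≤ R := by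
    intro z R hz
    rw [norm_mul, norm_mul, Complex.norm_real, Real.norm_eq_abs, abs_of_pos hα]
    calc α * (‖k‖ * ‖z‖) ≤ α * (1 * ‖z‖) := by gcongr
      _ ≤ R := by rwa [one_mul]
  have hdec : (α : ℂ) * (k * I₁) - (gammaPDFReal ξ 1 y : ℂ) =
      (α : ℂ) * (k * (I₁ - I₂)) + (α : ℂ) * (k * (I₂ - I₃)) + (α : ℂ) * (k * (I₃ - I₄)) +
        (α : ℂ) * (k * (I₄ - I₅)) + ((α : ℂ) * (k * I₅) - (gammaPDFReal ξ 1 y : ℂ)) := by ring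
  rw [hdec]
  have hsum := norm_add_le_of_le (norm_add_le_of_le (norm_add_le_of_le (norm_add_le_of_le
    (hterm _ _ b1) (hterm _ _ b2)) (hterm _ _ b3)) (hterm _ _ b4)) b5
  refine hsum.trans ?_
  rw [gammaError, ← hTdef]
  set e1 := (σ / α) ^ 2
  set e2 := 1 / α
  set e4 := T * (σ / α) ^ (ξ - 1)
  set e5 := Real.exp (-(γ ^ 2 * δ ^ 2 / 5)) / (γ ^ 2 * δ ^ (ξ + 1) * α ^ (ξ - 1))
  have p1 : 0 ≤ e1 := by positivity
  have p2 : 0 ≤ e2 := by positivity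
  -- This summand of the error is merely nonnegative slack; the other four already cover all
  -- replacements.
  have p3 : 0 ≤ T * (σ / α) ^ (2 + r) := by positivity
  have p4 : 0 ≤ e4 := by positivity
  have p5 : 0 ≤ e5 := by positivity
  have q1 : L * e4 + e1 ≤ (L + 1) * (e1 + e4) := by nlinarith
  set B := C1 * (1 + 2 * A) with hB
  have hB0 : 0 ≤ B := by positivity
  have q2 : C1 * ((1 + 2 * A) * (L * e4 + e1)) ≤ B * (L + 1) * (e1 + e4) := by
    have := mul_le_mul_of_nonneg_left q1 hB0
    calc _ = B * (L * e4 + e1) := by rw [hB]; ring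
      _ ≤ _ := this
      _ = _ := by ring
  set E := e1 + e2 + T * (σ / α) ^ (2 + r) + e4 + e5 with hE
  have r1 : 5 * L * e5 ≤ 5 * L * E := by gcongr; linarith
  have r2 : B * (L + 1) * (e1 + e4) ≤ B * (L + 1) * E := by gcongr; linarith
  have r3 : C2 * (e2 + 2 * e4) ≤ C2 * (2 * E) := by gcongr; linarith
  have r4 : 8 * e4 ≤ 8 * E := by gcongr; linarith
  have r5 : C3 * e1 ≤ C3 * E := by gcongr; linarith
  linarith

/-! ### Characteristic functions of integer-valued variables -/

/-- Integrating a derivative bound in this form raises the order of a Taylor estimate by one;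
negative arguments are later reached by conjugation. -/
theorem norm_le_of_norm_deriv_le_boundary {f f' : ℝ → ℂ} {B B' : ℝ → ℝ} (hf : ∀ x, HasDerivAt f (f' x) x)
    (hB : ∀ x, HasDerivAt B (B' x) x) (h0 : ‖f 0‖ ≤ B 0) (h : ∀ x, 0 ≤ x → ‖f' x‖ ≤ B' x) {x : ℝ}
    (hx : 0 ≤ x) : ‖f x‖ ≤ B x :=
  image_norm_le_of_norm_deriv_right_le_deriv_boundary (a := 0) (b := x)
    (fun y _ => (hf y).continuousAt.continuousWithinAt) (fun y _ => (hf y).hasDerivWithinAt) h0 hB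
    (fun y hy => h y hy.1) ⟨hx, le_rfl⟩

theorem hasDerivAt_cexp_I_mul (x : ℝ) :
    HasDerivAt (fun x : ℝ => Complex.exp (Complex.I * x)) (Complex.I * Complex.exp (Complex.I * x)) x := by
  have h1 : HasDerivAt (fun x : ℝ => Complex.I * (x : ℂ)) Complex.I x := by
    simpa using! (Complex.ofRealCLM.hasDerivAt (x := x)).const_mul Complex.I
  simpa [mul_comm] using h1.cexp

theorem conj_cexp_I_mul (x : ℝ) :
    (starRingEnd ℂ) (Complex.exp (Complex.I * x)) = Complex.exp (Complex.I * ((-x : ℝ) : ℂ)) := by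
  rw [← Complex.exp_conj]
  simp

theorem norm_cexp_I_mul_sub_one_sub_le (x : ℝ) :
    ‖Complex.exp (Complex.I * x) - 1 - Complex.I * x‖ ≤ x ^ 2 / 2 := by
  have hpos : ∀ x : ℝ, 0 ≤ x → ‖Complex.exp (Complex.I * x) - 1 - Complex.I * x‖ ≤ x ^ 2 / 2 := by
    intro x hx
    refine norm_le_of_norm_deriv_le_boundary
      (f := fun x : ℝ => Complex.exp (Complex.I * x) - 1 - Complex.I * x)
      (f' := fun x => Complex.I * Complex.exp (Complex.I * x) - Complex.I)
      (B := fun x => x ^ 2 / 2) (B' := fun x => x) (fun y => ?_) (fun y => ?_) (by simp)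
      (fun y hy => ?_) hx
    · refine ((hasDerivAt_cexp_I_mul y).sub_const 1).sub ?_
      simpa using! (Complex.ofRealCLM.hasDerivAt (x := y)).const_mul Complex.I
    · refine ((hasDerivAt_pow 2 y).div_const 2).congr_deriv ?_
      norm_num
    · rw [show Complex.I * Complex.exp (Complex.I * y) - Complex.I =
        Complex.I * (Complex.exp (Complex.I * y) - 1) by ring, norm_mul, Complex.norm_I, one_mul]
      exact Real.norm_exp_I_mul_ofReal_sub_one_le.trans (by rw [Real.norm_of_nonneg hy])
  rcases le_total 0 x with h | h
  · exact hpos x h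
  · have := hpos (-x) (by linarith)
    rw [← RCLike.norm_conj, map_sub, map_sub, conj_cexp_I_mul]
    simpa using this

theorem norm_cexp_I_mul_taylor_two_le (x : ℝ) :
    ‖Complex.exp (Complex.I * x) - 1 - Complex.I * x + (x : ℂ) ^ 2 / 2‖ ≤ |x| ^ 3 / 6 := by
  have hpos : ∀ x : ℝ, 0 ≤ x →
      ‖Complex.exp (Complex.I * x) - 1 - Complex.I * x + (x : ℂ) ^ 2 / 2‖ ≤ x ^ 3 / 6 := by
    intro x hx
    refine norm_le_of_norm_deriv_le_boundary
      (f := fun x : ℝ => Complex.exp (Complex.I * x) - 1 - Complex.I * x + (x : ℂ) ^ 2 / 2)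
      (f' := fun x => Complex.I * Complex.exp (Complex.I * x) - Complex.I + x)
      (B := fun x => x ^ 3 / 6) (B' := fun x => x ^ 2 / 2) (fun y => ?_) (fun y => ?_) (by simp)
      (fun y hy => ?_) hx
    · refine HasDerivAt.add (((hasDerivAt_cexp_I_mul y).sub_const 1).sub ?_) ?_
      · simpa using! (Complex.ofRealCLM.hasDerivAt (x := y)).const_mul Complex.I
      · have := ((Complex.ofRealCLM.hasDerivAt (x := y)).pow 2).div_const 2
        refine this.congr_deriv ?_
        simp
    · refine ((hasDerivAt_pow 3 y).div_const 6).congr_deriv ?_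
      norm_num
      ring
    · rw [show Complex.I * Complex.exp (Complex.I * y) - Complex.I + y =
        Complex.I * (Complex.exp (Complex.I * y) - 1 - Complex.I * y) by
          linear_combination (y : ℂ) * Complex.I_mul_I, norm_mul,
        Complex.norm_I, one_mul]
      exact norm_cexp_I_mul_sub_one_sub_le y
  rcases le_total 0 x with h | h
  · rw [abs_of_nonneg h]; exact hpos x h
  · have := hpos (-x) (by linarith)
    rw [abs_of_nonpos h, ← RCLike.norm_conj, map_add, map_sub, map_sub, conj_cexp_I_mul,
      map_div₀, Complex.conj_ofNat]
    simpa using this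

/-- The bound interpolates between `x ^ 2` and `|x| ^ 3 / 6`. A constant strictly below `1` is
essential: it leaves the positive Gaussian rate `(1 - 2 ^ (-r)) / 2` on `|θ| ≤ δ`. -/
theorem norm_cexp_I_mul_taylor_le_rpow (x : ℝ) {r : ℝ} (hr : 0 < r) (hr1 : r ≤ 1) :
    ‖Complex.exp (Complex.I * x) - 1 - Complex.I * x + (x : ℂ) ^ 2 / 2‖ ≤
      2 ^ (-r) * |x| ^ (2 + r) := by
  rcases eq_or_ne x 0 with rfl | hx
  · simp; positivity
  have hx0 : 0 < |x| := abs_pos.2 hx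
  have h1 : ‖Complex.exp (Complex.I * x) - 1 - Complex.I * x + (x : ℂ) ^ 2 / 2‖ ≤ |x| ^ 2 := by
    refine (norm_add_le_of_le (norm_cexp_I_mul_sub_one_sub_le x) (le_refl _)).trans ?_
    rw [norm_div, norm_pow, Complex.norm_real, Real.norm_eq_abs, sq_abs]
    norm_num
  have e : 2 ^ (-r) * |x| ^ (2 + r) = |x| ^ 2 * (|x| / 2) ^ r := by
    rw [Real.div_rpow hx0.le two_pos.le, Real.rpow_add hx0, Real.rpow_neg two_pos.le, Real.rpow_two]
    ring
  rw [e]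
  rcases le_total 1 (|x| / 2) with h | h
  · exact h1.trans (le_mul_of_one_le_right (by positivity) (Real.one_le_rpow h hr.le))
  · refine (norm_cexp_I_mul_taylor_two_le x).trans ?_
    have : |x| / 2 ≤ (|x| / 2) ^ r := by
      simpa using Real.rpow_le_rpow_of_exponent_ge (by positivity) h hr1
    calc |x| ^ 3 / 6 ≤ |x| ^ 2 * (|x| / 2) := by nlinarith [pow_pos hx0 3]
      _ ≤ _ := by gcongr

/-! ### Moments and characteristic function of a single queue. -/

theorem qVar_eq {Ω : Type*} [MeasurableSpace Ω] {P : Measure Ω} {Y : Ω → ℕ} (hY : Measurable Y) :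
    qVar P Y = ∫ ω, ((Y ω : ℝ) - qMean P Y) ^ 2 ∂P := by
  have hY' : Measurable (fun ω => (Y ω : ℝ)) := measurable_from_nat.comp hY
  rw [qVar, variance_eq_integral hY'.aemeasurable]
  rfl

section SingleVariable

variable {Ω : Type*} [MeasurableSpace Ω] {P : Measure Ω} [IsProbabilityMeasure P] {Y : Ω → ℕ}

theorem qCharFun_zero (P : Measure Ω) [IsProbabilityMeasure P] (Y : Ω → ℕ) : qCharFun P Y 0 = 1 := by
  simp [qCharFun]

theorem qCharFun_eq (P : Measure Ω) (Y : Ω → ℕ) (θ : ℝ) : qCharFun P Y θ =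
    ∫ ω, Complex.exp (Complex.I * ((((Y ω : ℝ) - qMean P Y) * θ : ℝ) : ℂ)) ∂P := by
  rw [qCharFun]
  congr 1 with ω
  push_cast
  ring_nf

theorem norm_qCharFun_le_one (P : Measure Ω) [IsProbabilityMeasure P] (Y : Ω → ℕ) (θ : ℝ) :
    ‖qCharFun P Y θ‖ ≤ 1 := by
  rw [qCharFun_eq]
  refine (norm_integral_le_of_norm_le_const (C := 1) (Eventually.of_forall fun ω => ?_)).trans ?_
  · rw [Complex.norm_exp]; simp
  · simp

theorem continuous_qCharFun (hY : Measurable Y) : Continuous (qCharFun P Y) := by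
  rw [show qCharFun P Y = fun θ => qCharFun P Y θ from rfl]
  simp_rw [qCharFun_eq]
  have hY' : Measurable (fun ω => (Y ω : ℝ)) := measurable_from_nat.comp hY
  refine continuous_of_dominated (bound := fun _ => 1) (fun θ => ?_) (fun θ => ?_)
    (integrable_const _) (Eventually.of_forall fun ω => by fun_prop)
  · exact Measurable.aestronglyMeasurable (by fun_prop)
  · refine Eventually.of_forall fun ω => ?_
    rw [Complex.norm_exp]; simp

theorem integral_sub_qMean (hint : Integrable (fun ω => (Y ω : ℝ)) P) :
    ∫ ω, ((Y ω : ℝ) - qMean P Y) ∂P = 0 := by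
  rw [integral_sub hint (integrable_const _)]
  simp [qMean]

theorem hasDerivAt_qCharFun_zero (hY : Measurable Y) (hint : Integrable (fun ω => (Y ω : ℝ)) P) :
    HasDerivAt (qCharFun P Y) 0 0 := by
  have hY' : Measurable (fun ω => (Y ω : ℝ)) := measurable_from_nat.comp hY
  have hc : Integrable (fun ω => (Y ω : ℝ) - qMean P Y) P := hint.sub (integrable_const _)
  have h := hasDerivAt_integral_of_dominated_loc_of_deriv_le (μ := P) (𝕜 := ℝ) (x₀ := 0)
    (s := Set.univ)
    (F := fun θ ω => Complex.exp (Complex.I * ((((Y ω : ℝ) - qMean P Y) * θ : ℝ) : ℂ)))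
    (F' := fun θ ω => (((Y ω : ℝ) - qMean P Y : ℝ) : ℂ) *
      (Complex.I * Complex.exp (Complex.I * ((((Y ω : ℝ) - qMean P Y) * θ : ℝ) : ℂ))))
    (bound := fun ω => |(Y ω : ℝ) - qMean P Y|) Filter.univ_mem
    (Eventually.of_forall fun θ => Measurable.aestronglyMeasurable (by fun_prop))
    (by simp) (Measurable.aestronglyMeasurable (by fun_prop))
    (Eventually.of_forall fun ω θ _ => ?_) hc.abs (Eventually.of_forall fun ω θ _ => ?_)
  · have h2 := h.2
    simp only [mul_zero, Complex.ofReal_zero, Complex.exp_zero, mul_one] at h2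
    rw [integral_mul_const, integral_complex_ofReal, integral_sub_qMean hint] at h2
    simp only [Complex.ofReal_zero, zero_mul] at h2
    rw [show qCharFun P Y = fun θ => qCharFun P Y θ from rfl]
    simp_rw [qCharFun_eq]
    exact h2
  · rw [norm_mul, norm_mul, Complex.norm_I, one_mul, Complex.norm_real, Real.norm_eq_abs,
      Complex.norm_exp]
    simp
  · have h1 : HasDerivAt (fun θ : ℝ => ((Y ω : ℝ) - qMean P Y) * θ) ((Y ω : ℝ) - qMean P Y) θ := by
      simpa using (hasDerivAt_id θ).const_mul ((Y ω : ℝ) - qMean P Y)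
    have := (hasDerivAt_cexp_I_mul (((Y ω : ℝ) - qMean P Y) * θ)).scomp θ h1
    simpa [Function.comp_def] using this

theorem memLp_sub_qMean {p : ENNReal} (hmom : MemLp (fun ω => (Y ω : ℝ)) p P) :
    MemLp (fun ω => (Y ω : ℝ) - qMean P Y) p P := hmom.sub (memLp_const _)

theorem integrable_sub_qMean_sq {r : ℝ} (hr : 0 < r)
    (hmom : MemLp (fun ω => (Y ω : ℝ)) (ENNReal.ofReal (2 + r)) P) :
    Integrable (fun ω => ((Y ω : ℝ) - qMean P Y) ^ 2) P := by
  refine ((memLp_sub_qMean hmom).mono_exponent ?_).integrable_sq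
  rw [← ENNReal.ofReal_ofNat]
  exact ENNReal.ofReal_le_ofReal (by linarith)

theorem integrable_abs_sub_qMean_rpow {r : ℝ} (hr : 0 < r)
    (hmom : MemLp (fun ω => (Y ω : ℝ)) (ENNReal.ofReal (2 + r)) P) :
    Integrable (fun ω => |(Y ω : ℝ) - qMean P Y| ^ (2 + r)) P := by
  have := (memLp_sub_qMean hmom).integrable_norm_rpow (by simp; linarith) (by simp)
  rw [ENNReal.toReal_ofReal (by linarith)] at this
  exact this

theorem qVar_nonneg (P : Measure Ω) (Y : Ω → ℕ) : 0 ≤ qVar P Y := variance_nonneg _ _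

theorem qAbsMoment_nonneg (P : Measure Ω) (Y : Ω → ℕ) (s : ℝ) : 0 ≤ qAbsMoment P Y s :=
  integral_nonneg fun ω => by positivity

theorem norm_qCharFun_sub_taylor_le (hY : Measurable Y) (hint : Integrable (fun ω => (Y ω : ℝ)) P)
    {r : ℝ} (hr : 0 < r) (hr1 : r ≤ 1)
    (hmom : MemLp (fun ω => (Y ω : ℝ)) (ENNReal.ofReal (2 + r)) P) (θ : ℝ) :
    ‖qCharFun P Y θ - ((1 - qVar P Y * θ ^ 2 / 2 : ℝ) : ℂ)‖ ≤
      2 ^ (-r) * (qAbsMoment P Y (2 + r) * |θ| ^ (2 + r)) := by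
  set W : Ω → ℝ := fun ω => (Y ω : ℝ) - qMean P Y with hW
  have hY' : Measurable (fun ω => (Y ω : ℝ)) := measurable_from_nat.comp hY
  have hWm : Measurable W := hY'.sub_const _
  have hi1 : Integrable (fun ω => Complex.exp (Complex.I * ((W ω * θ : ℝ) : ℂ))) P := by
    refine Integrable.mono' (integrable_const (1 : ℝ))
      (Measurable.aestronglyMeasurable (by fun_prop)) (Eventually.of_forall fun ω => ?_)
    rw [Complex.norm_exp]; simp
  have hi2 : Integrable (fun ω => ((W ω : ℝ) : ℂ)) P := (hint.sub (integrable_const _)).ofReal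
  have hi3 : Integrable (fun ω => ((W ω ^ 2 : ℝ) : ℂ)) P := (integrable_sub_qMean_sq hr hmom).ofReal
  have hi4 := integrable_abs_sub_qMean_rpow hr hmom
  have e : qCharFun P Y θ - ((1 - qVar P Y * θ ^ 2 / 2 : ℝ) : ℂ) =
      ∫ ω, (Complex.exp (Complex.I * ((W ω * θ : ℝ) : ℂ)) - 1 - Complex.I * ((W ω * θ : ℝ) : ℂ) +
        ((W ω * θ : ℝ) : ℂ) ^ 2 / 2) ∂P := by
    have e1 : ∀ ω, Complex.exp (Complex.I * ((W ω * θ : ℝ) : ℂ)) - 1 - Complex.I * ((W ω * θ : ℝ) : ℂ) +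
        ((W ω * θ : ℝ) : ℂ) ^ 2 / 2 = (Complex.exp (Complex.I * ((W ω * θ : ℝ) : ℂ)) - 1 -
          (Complex.I * θ) * ((W ω : ℝ) : ℂ)) + ((θ : ℂ) ^ 2 / 2) * ((W ω ^ 2 : ℝ) : ℂ) := by
      intro ω; push_cast; ring
    have h12 : Integrable (fun ω => Complex.exp (Complex.I * ((W ω * θ : ℝ) : ℂ)) - 1) P :=
      hi1.sub (integrable_const (1 : ℂ))
    have h123 : Integrable (fun ω => Complex.exp (Complex.I * ((W ω * θ : ℝ) : ℂ)) - 1 -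
        (Complex.I * θ) * ((W ω : ℝ) : ℂ)) P := h12.sub (hi2.const_mul _)
    simp_rw [e1]
    rw [integral_add h123 (hi3.const_mul _),
      integral_sub h12 (hi2.const_mul _), integral_sub hi1 (integrable_const _),
      integral_const_mul, integral_const_mul, integral_complex_ofReal, integral_complex_ofReal,
      integral_sub_qMean hint, ← qVar_eq hY, ← qCharFun_eq]
    simp
    ring
  rw [e]
  have e2 : 2 ^ (-r) * (qAbsMoment P Y (2 + r) * |θ| ^ (2 + r)) =
      ∫ ω, 2 ^ (-r) * |θ| ^ (2 + r) * |W ω| ^ (2 + r) ∂P := by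
    rw [integral_const_mul, qAbsMoment]
    ring
  rw [e2]
  refine norm_integral_le_of_norm_le (hi4.const_mul _) (Eventually.of_forall fun ω => ?_)
  refine (norm_cexp_I_mul_taylor_le_rpow (W ω * θ) hr hr1).trans_eq ?_
  rw [abs_mul, Real.mul_rpow (abs_nonneg _) (abs_nonneg _)]
  ring

/-- Jensen's inequality for the convex function `t ↦ t ^ ((2 + r) / 2)` applied to the squared
deviation. -/
theorem qVar_rpow_le_qAbsMoment (hY : Measurable Y) {r : ℝ} (hr : 0 < r)
    (hmom : MemLp (fun ω => (Y ω : ℝ)) (ENNReal.ofReal (2 + r)) P) :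
    √(qVar P Y) ^ (2 + r) ≤ qAbsMoment P Y (2 + r) := by
  have e : ∀ x : ℝ, (x ^ 2) ^ ((2 + r) / 2) = |x| ^ (2 + r) := by
    intro x
    rw [← sq_abs, ← Real.rpow_natCast, ← Real.rpow_mul (abs_nonneg x)]
    congr 1
    push_cast; ring
  have h := (convexOn_rpow (p := (2 + r) / 2) (by linarith)).map_integral_le (μ := P)
    (f := fun ω => ((Y ω : ℝ) - qMean P Y) ^ 2)
    (Real.continuous_rpow_const (by linarith)).continuousOn isClosed_Ici
    (Eventually.of_forall fun ω => Set.mem_Ici.2 (sq_nonneg _)) (integrable_sub_qMean_sq hr hmom)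
    ((integrable_abs_sub_qMean_rpow hr hmom).congr (Eventually.of_forall fun ω => (e _).symm))
  rw [← qVar_eq hY] at h
  simp only [e] at h
  rw [qAbsMoment]
  refine le_trans (le_of_eq ?_) h
  rw [Real.sqrt_eq_rpow, ← Real.rpow_mul (qVar_nonneg P Y)]
  congr 1
  ring

/-- These are the inputs of the product comparison, and they hold for every `θ`: `δ` is defined from
totals, so `|θ| ≤ δ` does not make the variance term of an individual queue small. The middle
inequality lets an absolute error be read as one relative to the exponential, losing only a factor
`e`. -/
theorem norm_qCharFun_le_exp (hY : Measurable Y) (hint : Integrable (fun ω => (Y ω : ℝ)) P)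
    {r : ℝ} (hr : 0 < r) (hr1 : r ≤ 1)
    (hmom : MemLp (fun ω => (Y ω : ℝ)) (ENNReal.ofReal (2 + r)) P) (θ : ℝ) :
    ‖qCharFun P Y θ‖ ≤ Real.exp (-(qVar P Y * θ ^ 2 / 2) +
        2 ^ (-r) * (qAbsMoment P Y (2 + r) * |θ| ^ (2 + r))) ∧
      -1 ≤ -(qVar P Y * θ ^ 2 / 2) + 2 ^ (-r) * (qAbsMoment P Y (2 + r) * |θ| ^ (2 + r)) ∧
      ‖qCharFun P Y θ - (Real.exp (-(qVar P Y * θ ^ 2 / 2)) : ℂ)‖ ≤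
        2 * (qAbsMoment P Y (2 + r) * |θ| ^ (2 + r)) := by
  set v := qVar P Y with hv
  have hv0 : 0 ≤ v := qVar_nonneg P Y
  set u : ℝ := √v * |θ| with hu
  have hu0 : 0 ≤ u := by positivity
  have hu2 : v * θ ^ 2 = u ^ 2 := by rw [hu, mul_pow, Real.sq_sqrt hv0, sq_abs]
  set B : ℝ := qAbsMoment P Y (2 + r) * |θ| ^ (2 + r) with hB
  have hB0 : 0 ≤ B := mul_nonneg (qAbsMoment_nonneg _ _ _) (by positivity)
  have huB : u ^ (2 + r) ≤ B := by
    rw [hu, Real.mul_rpow (Real.sqrt_nonneg _) (abs_nonneg _), hB]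
    gcongr
    exact qVar_rpow_le_qAbsMoment hY hr hmom
  have hT := norm_qCharFun_sub_taylor_le hY hint hr hr1 hmom θ
  rw [← hB, ← hv, hu2] at hT
  rw [hu2]
  have h2r : (2 : ℝ) ^ (-r) ≤ 1 := Real.rpow_le_one_of_one_le_of_nonpos one_le_two (by linarith)
  have h2r0 : (0 : ℝ) < 2 ^ (-r) := by positivity
  -- When the Taylor polynomial `1 - u²/2` would be negative, the moment inequality makes the
  -- exponent nonnegative, so the trivial bound `1` suffices.
  have hkey : 2 < u ^ 2 → u ^ 2 / 2 ≤ 2 ^ (-r) * B := by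
    intro h
    have hupos : 0 < u := by
      by_contra hcon
      have : u = 0 := le_antisymm (not_lt.1 hcon) hu0
      rw [this] at h; norm_num at h
    have h1 : (1 / 2 : ℝ) ≤ (u / 2) ^ r := by
      rcases le_total 1 (u / 2) with h' | h'
      · exact le_trans (by norm_num) (Real.one_le_rpow h' hr.le)
      · have : u / 2 ≤ (u / 2) ^ r := by
          simpa using Real.rpow_le_rpow_of_exponent_ge (by positivity) h' hr1
        have : 1 ≤ u := by nlinarith
        linarith
    have h2 : 2 ^ (-r) * u ^ (2 + r) = u ^ 2 * (u / 2) ^ r := by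
      rw [Real.div_rpow hu0 two_pos.le, Real.rpow_add hupos, Real.rpow_neg two_pos.le, Real.rpow_two]
      ring
    calc u ^ 2 / 2 = u ^ 2 * (1 / 2) := by ring
      _ ≤ u ^ 2 * (u / 2) ^ r := by gcongr
      _ = 2 ^ (-r) * u ^ (2 + r) := h2.symm
      _ ≤ _ := by gcongr
  refine ⟨?_, ?_, ?_⟩
  · rcases le_or_gt (u ^ 2) 2 with h | h
    · have h1 : ‖qCharFun P Y θ‖ ≤ ‖qCharFun P Y θ - ((1 - u ^ 2 / 2 : ℝ) : ℂ)‖ +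
          ‖((1 - u ^ 2 / 2 : ℝ) : ℂ)‖ := by
        have := norm_sub_norm_le (qCharFun P Y θ) ((1 - u ^ 2 / 2 : ℝ) : ℂ)
        linarith
      rw [Complex.norm_real, Real.norm_eq_abs, abs_of_nonneg (by linarith)] at h1
      have := Real.add_one_le_exp (-(u ^ 2 / 2) + 2 ^ (-r) * B)
      linarith
    · refine (norm_qCharFun_le_one P Y θ).trans (Real.one_le_exp ?_)
      linarith [hkey h]
  · rcases le_or_gt (u ^ 2) 2 with h | h
    · have : 0 ≤ 2 ^ (-r) * B := by positivity
      linarith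
    · linarith [hkey h]
  · have h1 : |1 - u ^ 2 / 2 - Real.exp (-(u ^ 2 / 2))| ≤ u ^ (2 + r) := by
      set w := u ^ 2 / 2 with hw
      have hw0 : 0 ≤ w := by positivity
      have k1 := Real.add_one_le_exp (-w)
      have k2 : Real.exp (-w) ≤ 1 := by simpa using hw0
      rcases eq_or_lt_of_le hu0 with h0 | h0
      · have : w = 0 := by rw [hw, ← h0]; norm_num
        rw [this, ← h0, Real.zero_rpow (by linarith)]; simp
      rw [abs_of_nonpos (by linarith), Real.rpow_add h0, Real.rpow_two]
      rcases le_total 1 u with h | h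
      · have : 1 ≤ u ^ r := Real.one_le_rpow h hr.le
        nlinarith
      · have k3 : u ≤ u ^ r := by
          simpa using Real.rpow_le_rpow_of_exponent_ge h0 h hr1
        have hw1 : w ≤ 1 := by nlinarith
        have k4 : Real.exp (-w) ≤ 1 - w + w ^ 2 := by
          have k5 : (1 + w) * Real.exp (-w) ≤ 1 := by
            have := Real.add_one_le_exp w
            calc (1 + w) * Real.exp (-w) ≤ Real.exp w * Real.exp (-w) := by gcongr; linarith
              _ = 1 := by rw [← Real.exp_add]; simp
          have k6 : Real.exp (-w) ≤ 1 / (1 + w) := by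
            rw [le_div_iff₀ (by linarith)]; linarith
          refine k6.trans ?_
          rw [div_le_iff₀ (by linarith)]
          nlinarith [pow_nonneg hw0 3]
        have k7 : w ^ 2 ≤ u ^ 2 * u := by
          rw [hw]; nlinarith [pow_pos h0 3]
        have : u ^ 2 * u ≤ u ^ 2 * u ^ r := by gcongr
        linarith
    have h2 : qCharFun P Y θ - (Real.exp (-(u ^ 2 / 2)) : ℂ) =
        (qCharFun P Y θ - ((1 - u ^ 2 / 2 : ℝ) : ℂ)) +
          ((1 - u ^ 2 / 2 - Real.exp (-(u ^ 2 / 2)) : ℝ) : ℂ) := by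
      push_cast; ring
    rw [h2]
    refine (norm_add_le _ _).trans ?_
    rw [Complex.norm_real, Real.norm_eq_abs]
    have : 2 ^ (-r) * B ≤ 1 * B := by gcongr
    linarith

end SingleVariable

/-! ### Pairing the atoms at `2j` and `2j + 1`. -/

theorem HasSum.pairs {E : Type*} [NormedAddCommGroup E] {c : ℕ → E} {a : E} (h : HasSum c a) :
    HasSum (fun j => c (2 * j) + c (2 * j + 1)) a := by
  have h1 : HasSum (fun p : ℕ × Fin 2 => c (p.1 * 2 + p.2)) a :=
    ((Nat.divModEquiv 2).symm.hasSum_iff (f := c)).2 h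
  refine h1.prod_fiberwise fun j => ?_
  have := hasSum_fintype fun i : Fin 2 => c (j * 2 + i)
  simpa [Fin.sum_univ_two, mul_comm] using this

theorem hasSum_integral_comp_nat {Ω : Type*} [MeasurableSpace Ω] {P : Measure Ω} {Y : Ω → ℕ} {E : Type*} [NormedAddCommGroup E] [NormedSpace ℝ E]
    [CompleteSpace E] (hY : Measurable Y) {f : ℕ → E} (hf : Integrable (fun ω => f (Y ω)) P) :
    HasSum (fun j => P.real {ω | Y ω = j} • f j) (∫ ω, f (Y ω) ∂P) := by
  have hm : ∀ j : ℕ, MeasurableSet {ω | Y ω = j} := fun j => hY (measurableSet_singleton j)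
  have hU : ⋃ j : ℕ, {ω | Y ω = j} = Set.univ := by ext ω; simp
  have hd : Pairwise (Function.onFun Disjoint fun j : ℕ => {ω | Y ω = j}) := by
    intro i j hij
    refine Set.disjoint_left.2 fun ω h1 h2 => hij ?_
    rw [← h1, ← h2]
  have h := hasSum_integral_iUnion (μ := P) (f := fun ω => f (Y ω)) hm hd
    (by rw [hU]; exact hf.integrableOn)
  rw [hU, setIntegral_univ] at h
  refine h.congr_fun fun j => ?_
  rw [setIntegral_congr_fun (g := fun _ => f j) (hm j) (fun ω hω => by
    simp only [Set.mem_ofPred_eq] at hω; simp only [hω]), setIntegral_const]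

section SingleVariable

variable {Ω : Type*} [MeasurableSpace Ω] {P : Measure Ω} [IsProbabilityMeasure P] {Y : Ω → ℕ}

theorem hasSum_pointProb (P : Measure Ω) [IsProbabilityMeasure P] (hY : Measurable Y) :
    HasSum (fun j => P.real {ω | Y ω = j}) 1 := by
  have := hasSum_integral_comp_nat (P := P) hY (f := fun _ => (1 : ℝ)) (integrable_const _)
  simpa using this

/-- The summand of `γ²`. -/
noncomputable def pairGamma (p q : ℝ) : ℝ := p * q / (p + q)

theorem pairGamma_nonneg {p q : ℝ} (hp : 0 ≤ p) (hq : 0 ≤ q) : 0 ≤ pairGamma p q := by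
  unfold pairGamma; positivity

theorem pairGamma_le_add {p q : ℝ} (hp : 0 ≤ p) (hq : 0 ≤ q) : pairGamma p q ≤ p + q := by
  rcases (add_nonneg hp hq).eq_or_lt with h | h
  · rw [pairGamma, ← h, div_zero]
  · rw [pairGamma, div_le_iff₀ h]; nlinarith

/-- After multiplication by `p + q`, the difference of the two sides is exactly `(p a + q (a + 1)) ^
2`. Summed over pairs, with `a` the deviation of `2j` from the mean, it yields `γ² ≤ σ²`. -/
theorem pairGamma_le_sq {p q : ℝ} (hp : 0 ≤ p) (hq : 0 ≤ q) (a : ℝ) :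
    pairGamma p q ≤ p * a ^ 2 + q * (a + 1) ^ 2 := by
  rcases (add_nonneg hp hq).eq_or_lt with h | h
  · rw [pairGamma, ← h, div_zero]; positivity
  · rw [pairGamma, div_le_iff₀ h]; nlinarith [sq_nonneg (p * a + q * (a + 1))]

/-- The squared norm is `(p + q)² - 2pq (1 - cos θ)`. With `g = pq / (p + q)` this equals the square
of the right-hand side minus `g² (1 - cos θ)²`. -/
theorem norm_add_mul_cexp_le {p q : ℝ} (hp : 0 ≤ p) (hq : 0 ≤ q) (θ : ℝ) :
    ‖(p : ℂ) + q * Complex.exp (Complex.I * θ)‖ ≤ p + q - pairGamma p q * (1 - Real.cos θ) := by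
  have hc1 := Real.cos_le_one θ
  have hc2 := Real.neg_one_le_cos θ
  rcases (add_nonneg hp hq).eq_or_lt with h | h
  · have hp0 : p = 0 := by linarith
    have hq0 : q = 0 := by linarith
    simp [hp0, hq0, pairGamma]
  have hg := pairGamma_nonneg hp hq
  have hpq : pairGamma p q * (p + q) = p * q := by rw [pairGamma]; field_simp
  have hle : 2 * pairGamma p q ≤ p + q := by
    have : 2 * (p * q) ≤ (p + q) * (p + q) := by nlinarith [mul_nonneg hp hq]
    rw [← hpq] at this
    nlinarith
  refine abs_le_of_sq_le_sq' ?_ ?_ |>.2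
  · rw [← Complex.normSq_eq_norm_sq, Complex.normSq_apply, mul_comm Complex.I]
    simp only [Complex.add_re, Complex.ofReal_re, Complex.mul_re, Complex.exp_ofReal_mul_I_re,
      Complex.ofReal_im, Complex.exp_ofReal_mul_I_im, zero_mul, sub_zero, Complex.add_im,
      Complex.mul_im, add_zero, zero_add]
    have e1 : (p + q * Real.cos θ) * (p + q * Real.cos θ) + q * Real.sin θ * (q * Real.sin θ) =
        (p + q) ^ 2 - 2 * (p * q) * (1 - Real.cos θ) := by
      linear_combination q ^ 2 * Real.sin_sq_add_cos_sq θ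
    rw [e1, ← hpq]
    nlinarith [sq_nonneg (pairGamma p q * (1 - Real.cos θ))]
  · nlinarith

theorem summable_pairGamma (P : Measure Ω) [IsProbabilityMeasure P] (hY : Measurable Y) :
    Summable fun j : ℕ => pairGamma (P.real {ω | Y ω = 2 * j}) (P.real {ω | Y ω = 2 * j + 1}) :=
  Summable.of_nonneg_of_le (fun _ => pairGamma_nonneg measureReal_nonneg measureReal_nonneg)
    (fun _ => pairGamma_le_add measureReal_nonneg measureReal_nonneg)
    (hasSum_pointProb P hY).pairs.summable

theorem qGammaSq_nonneg (P : Measure Ω) (Y : Ω → ℕ) : 0 ≤ qGammaSq P Y :=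
  tsum_nonneg fun j => by positivity

/-- The triangle inequality is applied to pairs of adjacent atoms, keeping the cancellation inside
each pair; then `1 - x ≤ e^{-x}`. -/
theorem norm_qCharFun_le_exp_gamma (hY : Measurable Y) (θ : ℝ) :
    ‖qCharFun P Y θ‖ ≤ Real.exp (-(qGammaSq P Y * (1 - Real.cos θ))) := by
  set m := qMean P Y with hm
  have hint : Integrable (fun ω => Complex.exp (Complex.I * ((((Y ω : ℝ) - m) * θ : ℝ) : ℂ))) P := by
    have hY' : Measurable (fun ω => (Y ω : ℝ)) := measurable_from_nat.comp hY
    refine Integrable.mono' (integrable_const (1 : ℝ))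
      (Measurable.aestronglyMeasurable (by fun_prop)) (Eventually.of_forall fun ω => ?_)
    rw [Complex.norm_exp]; simp
  have h1 := (hasSum_integral_comp_nat (P := P) hY
    (f := fun j => Complex.exp (Complex.I * ((((j : ℝ) - m) * θ : ℝ) : ℂ))) hint).pairs
  rw [← qCharFun_eq] at h1
  have h2 := ((hasSum_pointProb P hY).pairs).sub
    ((summable_pairGamma P hY).hasSum.mul_right (1 - Real.cos θ))
  have h3 : ‖qCharFun P Y θ‖ ≤ 1 - qGammaSq P Y * (1 - Real.cos θ) := by
    rw [← h1.tsum_eq]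
    refine tsum_of_norm_bounded h2 fun j => ?_
    have e : P.real {ω | Y ω = 2 * j} • Complex.exp (Complex.I * (((((2 * j : ℕ) : ℝ) - m) * θ : ℝ) : ℂ)) +
        P.real {ω | Y ω = 2 * j + 1} •
          Complex.exp (Complex.I * (((((2 * j + 1 : ℕ) : ℝ) - m) * θ : ℝ) : ℂ)) =
        Complex.exp (Complex.I * (((((2 * j : ℕ) : ℝ) - m) * θ : ℝ) : ℂ)) *
          ((P.real {ω | Y ω = 2 * j} : ℂ) + P.real {ω | Y ω = 2 * j + 1} *
            Complex.exp (Complex.I * θ)) := by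
      rw [mul_add, mul_left_comm, ← Complex.exp_add, Complex.real_smul, Complex.real_smul,
        mul_comm (Complex.exp _)]
      congr 3
      push_cast
      ring
    rw [e, norm_mul, Complex.norm_exp]
    simp only [Complex.mul_re, Complex.I_re, zero_mul, Complex.I_im, Complex.ofReal_im, mul_zero,
      sub_self, Real.exp_zero, one_mul]
    exact norm_add_mul_cexp_le measureReal_nonneg measureReal_nonneg θ
  refine h3.trans ?_
  have := Real.add_one_le_exp (-(qGammaSq P Y * (1 - Real.cos θ)))
  linarith

theorem qGammaSq_le_qVar (hY : Measurable Y)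
    (hint : Integrable (fun ω => ((Y ω : ℝ) - qMean P Y) ^ 2) P) : qGammaSq P Y ≤ qVar P Y := by
  have h1 := (hasSum_integral_comp_nat (P := P) hY
    (f := fun j => ((j : ℝ) - qMean P Y) ^ 2) hint).pairs
  rw [← qVar_eq hY] at h1
  refine hasSum_le (fun j => ?_) (summable_pairGamma P hY).hasSum h1
  have := pairGamma_le_sq (p := P.real {ω | Y ω = 2 * j}) (q := P.real {ω | Y ω = 2 * j + 1})
    measureReal_nonneg measureReal_nonneg (((2 * j : ℕ) : ℝ) - qMean P Y)
  refine this.trans_eq ?_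
  simp only [smul_eq_mul]
  push_cast
  ring

/-- Integrality enters here. Let `W = Y - m` and let `a` be the integer nearest to `m`. Since `W` is
centred, the variance is the mean of `W² + (m - a) W = W (Y - a)`, which vanishes at `Y = a`;
elsewhere `|W| ≥ 1/2`, so a higher power costs only a constant. This gives `δ ≤ 2`, inside the
period. -/
theorem qVar_le_qAbsMoment (hY : Measurable Y) (hint : Integrable (fun ω => (Y ω : ℝ)) P)
    {r : ℝ} (hr : 0 < r) (hmom : MemLp (fun ω => (Y ω : ℝ)) (ENNReal.ofReal (2 + r)) P) :
    qVar P Y ≤ 2 * 2 ^ r * qAbsMoment P Y (2 + r) := by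
  set m := qMean P Y with hm
  have ha := abs_sub_round m
  set a : ℤ := round m
  have hi2 := integrable_sub_qMean_sq hr hmom
  have hi1 : Integrable (fun ω => (Y ω : ℝ) - m) P := hint.sub (integrable_const _)
  have e : qVar P Y = ∫ ω, (((Y ω : ℝ) - m) ^ 2 + (m - a) * ((Y ω : ℝ) - m)) ∂P := by
    rw [integral_add hi2 (hi1.const_mul _), integral_const_mul, integral_sub_qMean hint,
      ← qVar_eq hY, mul_zero, add_zero]
  rw [e, qAbsMoment, ← integral_const_mul]
  refine integral_mono (hi2.add (hi1.const_mul _))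
    ((integrable_abs_sub_qMean_rpow hr hmom).const_mul _) fun ω => ?_
  simp only
  set W : ℝ := (Y ω : ℝ) - m with hW
  rcases eq_or_ne ((Y ω : ℤ)) a with h | h
  · have h' : (Y ω : ℝ) = a := by exact_mod_cast h
    have : W ^ 2 + (m - a) * W = 0 := by rw [hW, h']; ring
    rw [this]; positivity
  · have h1 : (1 : ℝ) ≤ |(Y ω : ℝ) - a| := by
      have : (1 : ℤ) ≤ |(Y ω : ℤ) - a| := Int.one_le_abs (sub_ne_zero.2 h)
      exact_mod_cast this
    have h2 : |(Y ω : ℝ) - a| ≤ |W| + |m - a| := by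
      rw [show (Y ω : ℝ) - a = W + (m - a) by rw [hW]; ring]
      exact abs_add_le _ _
    have hW1 : 1 / 2 ≤ |W| := by linarith
    have hW0 : 0 < |W| := by linarith
    have h3 : (m - a) * W ≤ |W| * |W| := by
      refine (le_abs_self _).trans ?_
      rw [abs_mul]
      exact mul_le_mul_of_nonneg_right (by linarith) hW0.le
    have h4 : (1 : ℝ) ≤ 2 ^ r * |W| ^ r := by
      rw [← Real.mul_rpow two_pos.le hW0.le]
      exact Real.one_le_rpow (by linarith) hr.le
    rw [Real.rpow_add hW0, Real.rpow_two]
    calc W ^ 2 + (m - a) * W ≤ 2 * |W| ^ 2 * 1 := by rw [sq_abs]; nlinarith [sq_abs W]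
      _ ≤ 2 * |W| ^ 2 * (2 ^ r * |W| ^ r) := by gcongr
      _ = _ := by ring

end SingleVariable

/-! ### Fourier inversion for integer-valued variables -/

theorem integral_cexp_int_mul (k : ℤ) :
    ∫ θ in (-Real.pi)..Real.pi, Complex.exp (Complex.I * (k : ℂ) * θ) =
      if k = 0 then 2 * (Real.pi : ℂ) else 0 := by
  split_ifs with h
  · simp [h]; ring
  · have hk : Complex.I * (k : ℂ) ≠ 0 := mul_ne_zero Complex.I_ne_zero (by exact_mod_cast h)
    rw [integral_exp_mul_complex hk]
    have : Complex.exp (Complex.I * (k : ℂ) * (Real.pi : ℝ)) =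
        Complex.exp (Complex.I * (k : ℂ) * ((-Real.pi : ℝ) : ℂ)) :=
      Complex.exp_eq_exp_iff_exists_int.2 ⟨k, by push_cast; ring⟩
    rw [this, sub_self, zero_div]

theorem fourier_inversion_int {Ω : Type*} [MeasurableSpace Ω] {P : Measure Ω} [IsProbabilityMeasure P]
    {Z : Ω → ℤ} (hZ : Measurable Z) (x : ℤ) :
    (1 / (2 * Real.pi) : ℂ) * ∫ θ in (-Real.pi)..Real.pi,
      (∫ ω, Complex.exp (Complex.I * (Z ω : ℂ) * θ) ∂P) * Complex.exp (-(Complex.I * (x : ℂ) * θ)) =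
    ((P.real {ω | Z ω = x} : ℝ) : ℂ) := by
  have hZ' : Measurable (fun ω => (Z ω : ℂ)) :=
    (measurable_from_top (f := fun z : ℤ => (z : ℂ))).comp hZ
  have hpi : -Real.pi ≤ Real.pi := by linarith [Real.pi_pos]
  have hn : ∀ (θ : ℝ) (k : ℤ), ‖Complex.exp (Complex.I * (k : ℂ) * θ)‖ = 1 := by
    intro θ k; rw [Complex.norm_exp]; simp
  have e1 : ∀ θ : ℝ, (∫ ω, Complex.exp (Complex.I * (Z ω : ℂ) * θ) ∂P) *
      Complex.exp (-(Complex.I * (x : ℂ) * θ)) =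
      ∫ ω, Complex.exp (Complex.I * ((Z ω - x : ℤ) : ℂ) * θ) ∂P := by
    intro θ
    rw [← integral_mul_const]
    congr 1 with ω
    rw [← Complex.exp_add]
    congr 1
    push_cast
    ring
  simp_rw [e1]
  rw [intervalIntegral.integral_of_le hpi, integral_integral_swap]
  · have e2 : ∀ ω, ∫ θ in Set.Ioc (-Real.pi) Real.pi,
        Complex.exp (Complex.I * ((Z ω - x : ℤ) : ℂ) * θ) =
          Set.indicator {ω | Z ω = x} (fun _ => 2 * (Real.pi : ℂ)) ω := by
      intro ω
      rw [← intervalIntegral.integral_of_le hpi, integral_cexp_int_mul]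
      simp only [Set.indicator, Set.mem_ofPred_eq, sub_eq_zero]
    simp_rw [e2]
    have hm : MeasurableSet {ω | Z ω = x} := hZ (measurableSet_singleton x)
    rw [integral_indicator hm, setIntegral_const, Complex.real_smul]
    have : (Real.pi : ℂ) ≠ 0 := by exact_mod_cast Real.pi_ne_zero
    field_simp
  · refine Integrable.mono' (integrable_const (1 : ℝ)) ?_ (Eventually.of_forall fun p => ?_)
    · refine Measurable.aestronglyMeasurable ?_
      simp only [Function.uncurry_def]
      push_cast
      fun_prop
    · simp only [Function.uncurry_def]
      exact (hn _ _).le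

/-- The individual means need not be integers, but their sum is, so the product belongs to a lattice
variable and can be inverted over one period. -/
theorem prod_qCharFun_eq {Ω : Type*} [MeasurableSpace Ω] {P : Measure Ω} {n : ℕ}
    {X : Fin n → Ω → ℕ} (hX : ∀ k, Measurable (X k)) (hind : iIndepFun X P) {N : ℕ}
    (hmean : ∑ k, qMean P (X k) = N) (θ : ℝ) :
    ∏ k, qCharFun P (X k) θ =
      ∫ ω, Complex.exp (Complex.I * ((((∑ k, X k ω : ℕ) : ℤ) - (N : ℤ) : ℤ) : ℂ) * θ) ∂P := by
  have h := hind.integral_fun_prod_comp (μ := P) (f := fun k (j : ℕ) =>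
    Complex.exp (Complex.I * (((j : ℝ) - qMean P (X k) : ℝ) : ℂ) * (θ : ℂ)))
    (fun k => (hX k).aemeasurable) (fun k => measurable_from_nat.aestronglyMeasurable)
  simp only [qCharFun]
  rw [← h]
  congr 1 with ω
  rw [← Complex.exp_sum, ← Finset.sum_mul, ← Finset.mul_sum, ← Complex.ofReal_sum,
    Finset.sum_sub_distrib, hmean]
  push_cast
  rfl

/-! ### Products -/

/-- Telescoping with errors measured relative to the common majorants `E k`, so that the decay of
the whole product survives and only the `D k` are summed. -/
theorem norm_prod_sub_prod_le {ι : Type*} (A : Finset ι) {a b : ι → ℂ} {E D : ι → ℝ}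
    (hE : ∀ k ∈ A, 0 < E k) (ha : ∀ k ∈ A, ‖a k‖ ≤ E k) (hb : ∀ k ∈ A, ‖b k‖ ≤ E k)
    (hD : ∀ k ∈ A, ‖a k - b k‖ ≤ D k * E k) :
    ‖∏ k ∈ A, a k - ∏ k ∈ A, b k‖ ≤ (∑ k ∈ A, D k) * ∏ k ∈ A, E k := by
  classical
  induction A using Finset.induction_on with
  | empty => simp
  | insert i s hi ih =>
    have ih' := ih (fun k hk => hE k (Finset.mem_insert_of_mem hk))
      (fun k hk => ha k (Finset.mem_insert_of_mem hk)) (fun k hk => hb k (Finset.mem_insert_of_mem hk))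
      (fun k hk => hD k (Finset.mem_insert_of_mem hk))
    have hi' := Finset.mem_insert_self i s
    rw [Finset.prod_insert hi, Finset.prod_insert hi, Finset.prod_insert hi, Finset.sum_insert hi]
    have e : a i * ∏ k ∈ s, a k - b i * ∏ k ∈ s, b k =
        (a i - b i) * ∏ k ∈ s, a k + b i * (∏ k ∈ s, a k - ∏ k ∈ s, b k) := by ring
    have hP : ‖∏ k ∈ s, a k‖ ≤ ∏ k ∈ s, E k := by
      rw [norm_prod]
      exact Finset.prod_le_prod (fun k _ => norm_nonneg _)
        fun k hk => ha k (Finset.mem_insert_of_mem hk)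
    rw [e]
    refine (norm_add_le _ _).trans ?_
    rw [norm_mul, norm_mul]
    have hEi := hE i hi'
    have hDi := hD i hi'
    calc _ ≤ (D i * E i) * ∏ k ∈ s, E k + E i * ((∑ k ∈ s, D k) * ∏ k ∈ s, E k) := by
          refine add_le_add ?_ ?_
          · exact mul_le_mul hDi hP (norm_nonneg _) ((norm_nonneg _).trans hDi)
          · exact mul_le_mul (hb i hi') ih' (norm_nonneg _) hEi.le
      _ = _ := by ring

/-! ### Totals over a finite family of queues. -/

section Family

variable {ι Ω : Type*} [MeasurableSpace Ω] {P : Measure Ω} [IsProbabilityMeasure P]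
  {X : ι → Ω → ℕ} {A : Finset ι}

theorem totSigma_sq (P : Measure Ω) (X : ι → Ω → ℕ) (A : Finset ι) :
    totSigma P X A ^ 2 = ∑ k ∈ A, qVar P (X k) :=
  Real.sq_sqrt (Finset.sum_nonneg fun k _ => qVar_nonneg P (X k))

theorem totGamma_sq (P : Measure Ω) (X : ι → Ω → ℕ) (A : Finset ι) :
    totGamma P X A ^ 2 = ∑ k ∈ A, qGammaSq P (X k) :=
  Real.sq_sqrt (Finset.sum_nonneg fun k _ => qGammaSq_nonneg P (X k))

theorem totMoment_nonneg (P : Measure Ω) (X : ι → Ω → ℕ) (A : Finset ι) (s : ℝ) :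
    0 ≤ totMoment P X A s := Finset.sum_nonneg fun k _ => qAbsMoment_nonneg P (X k) s

theorem norm_prod_qCharFun_sub_gaussian_le (hX : ∀ k, Measurable (X k))
    (hint : ∀ k, Integrable (fun ω => (X k ω : ℝ)) P) {r : ℝ} (hr : 0 < r) (hr1 : r ≤ 1)
    (hmom : ∀ k ∈ A, MemLp (fun ω => (X k ω : ℝ)) (ENNReal.ofReal (2 + r)) P) {θ : ℝ}
    (hθ : 2 * (totMoment P X A (2 + r) * |θ| ^ (2 + r)) ≤ totSigma P X A ^ 2 * θ ^ 2) :
    ‖∏ k ∈ A, qCharFun P (X k) θ - (Real.exp (-(totSigma P X A ^ 2 * θ ^ 2 / 2)) : ℂ)‖ ≤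
      2 * Real.exp 1 * totMoment P X A (2 + r) * |θ| ^ (2 + r) *
        Real.exp (-((1 - 2 ^ (-r)) / 2 * totSigma P X A ^ 2 * θ ^ 2)) := by
  set w : ι → ℝ := fun k => -(qVar P (X k) * θ ^ 2 / 2) +
    2 ^ (-r) * (qAbsMoment P (X k) (2 + r) * |θ| ^ (2 + r)) with hw
  have hsum : ∑ k ∈ A, w k = -(totSigma P X A ^ 2 * θ ^ 2 / 2) +
      2 ^ (-r) * (totMoment P X A (2 + r) * |θ| ^ (2 + r)) := by
    rw [totSigma_sq, totMoment, Finset.sum_add_distrib, Finset.sum_neg_distrib, ← Finset.mul_sum,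
      Finset.sum_mul, Finset.sum_mul, Finset.sum_div]
  have hG : (Real.exp (-(totSigma P X A ^ 2 * θ ^ 2 / 2)) : ℂ) =
      ∏ k ∈ A, (Real.exp (-(qVar P (X k) * θ ^ 2 / 2)) : ℂ) := by
    rw [totSigma_sq, ← Complex.ofReal_prod, ← Real.exp_sum, Finset.sum_neg_distrib, Finset.sum_mul,
      Finset.sum_div]
  have hk := fun k (hk : k ∈ A) => norm_qCharFun_le_exp (hX k) (hint k) hr hr1 (hmom k hk) θ
  have h := norm_prod_sub_prod_le A (a := fun k => qCharFun P (X k) θ)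
    (b := fun k => (Real.exp (-(qVar P (X k) * θ ^ 2 / 2)) : ℂ)) (E := fun k => Real.exp (w k))
    (D := fun k => 2 * Real.exp 1 * (qAbsMoment P (X k) (2 + r) * |θ| ^ (2 + r)))
    (fun k _ => Real.exp_pos _) (fun k h => (hk k h).1) (fun k h => ?_) (fun k h => ?_)
  · rw [hG]
    refine h.trans ?_
    rw [← Real.exp_sum, hsum, ← Finset.mul_sum, ← Finset.sum_mul, ← totMoment, ← mul_assoc]
    have hM := totMoment_nonneg P X A (2 + r)
    gcongr
    have : 2 ^ (-r) * (2 * (totMoment P X A (2 + r) * |θ| ^ (2 + r))) ≤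
      2 ^ (-r) * (totSigma P X A ^ 2 * θ ^ 2) := by gcongr
    linarith
  · rw [Complex.norm_real, Real.norm_eq_abs, Real.abs_exp]
    refine Real.exp_le_exp.2 ?_
    simp only [hw]
    have := qAbsMoment_nonneg P (X k) (2 + r)
    have : 0 ≤ 2 ^ (-r) * (qAbsMoment P (X k) (2 + r) * |θ| ^ (2 + r)) := by positivity
    linarith
  · have h1 := (hk k h).2.1
    have h2 := (hk k h).2.2
    have hB : 0 ≤ qAbsMoment P (X k) (2 + r) * |θ| ^ (2 + r) :=
      mul_nonneg (qAbsMoment_nonneg _ _ _) (by positivity)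
    -- The exponent is at least `-1`; this is the origin of the factor `e` in the bound.
    have h3 : 1 ≤ Real.exp 1 * Real.exp (w k) := by
      rw [← Real.exp_add]
      refine Real.one_le_exp ?_
      simp only [hw]; linarith
    calc _ ≤ 2 * (qAbsMoment P (X k) (2 + r) * |θ| ^ (2 + r)) * 1 := by rw [mul_one]; exact h2
      _ ≤ 2 * (qAbsMoment P (X k) (2 + r) * |θ| ^ (2 + r)) * (Real.exp 1 * Real.exp (w k)) := by gcongr
      _ = _ := by ring

/-- The sharp constant on this interval is `2 / π²`, and `π² ≤ 10`; hence the `5` in the exponential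
error. -/
theorem one_sub_cos_ge {θ : ℝ} (hθ : |θ| ≤ Real.pi) : θ ^ 2 / 5 ≤ 1 - Real.cos θ := by
  have h := Real.cos_le_one_sub_mul_cos_sq hθ
  have hpi : Real.pi ^ 2 ≤ 10 := by nlinarith [Real.pi_lt_d2, Real.pi_pos]
  have : 1 / 5 ≤ 2 / Real.pi ^ 2 := by
    rw [div_le_div_iff₀ (by norm_num) (by positivity)]; linarith
  nlinarith [sq_nonneg θ]

theorem norm_prod_qCharFun_le_exp_gamma (hX : ∀ k, Measurable (X k)) {θ : ℝ} (hθ : |θ| ≤ Real.pi) :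
    ‖∏ k ∈ A, qCharFun P (X k) θ‖ ≤ Real.exp (-(totGamma P X A ^ 2 * θ ^ 2 / 5)) := by
  rw [norm_prod, totGamma_sq]
  refine (Finset.prod_le_prod (fun k _ => norm_nonneg _) fun k _ =>
    norm_qCharFun_le_exp_gamma (hX k) θ).trans ?_
  rw [← Real.exp_sum, Finset.sum_neg_distrib, ← Finset.sum_mul]
  refine Real.exp_le_exp.2 (neg_le_neg ?_)
  rw [mul_div_assoc]
  have : 0 ≤ ∑ k ∈ A, qGammaSq P (X k) := Finset.sum_nonneg fun k _ => qGammaSq_nonneg P (X k)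
  gcongr
  exact one_sub_cos_ge hθ

theorem totGamma_le_totSigma (hX : ∀ k, Measurable (X k)) {r : ℝ} (hr : 0 < r)
    (hmom : ∀ k ∈ A, MemLp (fun ω => (X k ω : ℝ)) (ENNReal.ofReal (2 + r)) P) :
    totGamma P X A ≤ totSigma P X A :=
  Real.sqrt_le_sqrt (Finset.sum_le_sum fun k hk =>
    qGammaSq_le_qVar (hX k) (integrable_sub_qMean_sq hr (hmom k hk)))

theorem totSigma_sq_le (hX : ∀ k, Measurable (X k)) (hint : ∀ k, Integrable (fun ω => (X k ω : ℝ)) P)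
    {r : ℝ} (hr : 0 < r)
    (hmom : ∀ k ∈ A, MemLp (fun ω => (X k ω : ℝ)) (ENNReal.ofReal (2 + r)) P) :
    totSigma P X A ^ 2 ≤ 2 * 2 ^ r * totMoment P X A (2 + r) := by
  rw [totSigma_sq, totMoment, Finset.mul_sum]
  exact Finset.sum_le_sum fun k hk => qVar_le_qAbsMoment (hX k) (hint k) hr (hmom k hk)

end Family

/-! ### The factor carrying the algebraic singularity -/

/-- The reciprocal `1 - α (e^{iθ} - 1)` of the pole factor. -/
noncomputable def poleDenom (α θ : ℝ) : ℂ := 1 - α * (Complex.exp (Complex.I * θ) - 1)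

theorem poleFactor_eq_inv {ρ : ℝ} (hρ : ρ < 1) (θ : ℝ) :
    poleFactor ρ θ = (poleDenom (poleScale ρ) θ)⁻¹ := by
  have h : (1 - (ρ : ℂ)) ≠ 0 := by
    rw [sub_ne_zero]
    exact_mod_cast hρ.ne'
  have e : poleDenom (poleScale ρ) θ = (1 - (ρ : ℂ) * Complex.exp (Complex.I * θ)) / (1 - ρ) := by
    rw [poleDenom, poleScale]
    push_cast
    field_simp
    ring
  rw [e, inv_div, poleFactor]

theorem poleDenom_re (α θ : ℝ) : (poleDenom α θ).re = 1 + α * (1 - Real.cos θ) := by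
  rw [poleDenom, mul_comm Complex.I]
  simp [Complex.exp_ofReal_mul_I_re]
  ring

theorem one_le_poleDenom_re {α : ℝ} (hα : 0 ≤ α) (θ : ℝ) : 1 ≤ (poleDenom α θ).re := by
  rw [poleDenom_re]
  have := Real.cos_le_one θ
  nlinarith

theorem poleDenom_mem_slitPlane {α : ℝ} (hα : 0 ≤ α) (θ : ℝ) :
    poleDenom α θ ∈ Complex.slitPlane :=
  Or.inl (lt_of_lt_of_le one_pos (one_le_poleDenom_re hα θ))

theorem one_le_norm_poleDenom {α : ℝ} (hα : 0 ≤ α) (θ : ℝ) : 1 ≤ ‖poleDenom α θ‖ :=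
  (one_le_poleDenom_re hα θ).trans (Complex.re_le_norm _)

theorem poleDenom_ne_zero {α : ℝ} (hα : 0 ≤ α) (θ : ℝ) : poleDenom α θ ≠ 0 :=
  Complex.slitPlane_ne_zero (poleDenom_mem_slitPlane hα θ)

/-- The squared norm is `1 + 2α (1 - cos θ) + 2α² (1 - cos θ)`, and its last term is at least `α²θ²
/ 4` over the whole period. -/
theorem mul_abs_le_two_mul_norm_poleDenom {α : ℝ} (hα : 0 ≤ α) {θ : ℝ} (hθ : |θ| ≤ Real.pi) :
    α * |θ| ≤ 2 * ‖poleDenom α θ‖ := by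
  have h1 : ‖poleDenom α θ‖ ^ 2 = (1 + α * (1 - Real.cos θ)) ^ 2 + (α * Real.sin θ) ^ 2 := by
    rw [← Complex.normSq_eq_norm_sq, Complex.normSq_apply, poleDenom_re]
    have : (poleDenom α θ).im = -(α * Real.sin θ) := by
      rw [poleDenom, mul_comm Complex.I]
      simp [Complex.exp_ofReal_mul_I_im]
    rw [this]; ring
  have h2 := one_sub_cos_ge hθ
  have h3 : θ ^ 2 / 4 ≤ 2 * (1 - Real.cos θ) := by nlinarith [sq_nonneg θ]
  refine abs_le_of_sq_le_sq' ?_ (by positivity) |>.2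
  rw [mul_pow, mul_pow, sq_abs, h1]
  have h4 : (1 + α * (1 - Real.cos θ)) ^ 2 + (α * Real.sin θ) ^ 2 =
      1 + 2 * (α * (1 - Real.cos θ)) + α ^ 2 * (2 * (1 - Real.cos θ)) := by
    linear_combination α ^ 2 * Real.sin_sq_add_cos_sq θ
  rw [h4]
  have h5 : 0 ≤ α * (1 - Real.cos θ) := mul_nonneg hα (by linarith [Real.cos_le_one θ])
  have h6 : α ^ 2 * (θ ^ 2 / 4) ≤ α ^ 2 * (2 * (1 - Real.cos θ)) := by gcongr
  linarith

theorem poleFactor_cpow_eq {ρ : ℝ} (hρ0 : 0 ≤ ρ) (hρ : ρ < 1) (ξ θ : ℝ) :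
    poleFactor ρ θ ^ (ξ : ℂ) = Complex.exp (-(ξ : ℂ) * Complex.log (poleDenom (poleScale ρ) θ)) := by
  have hα : 0 ≤ poleScale ρ := div_nonneg hρ0 (by linarith)
  rw [poleFactor_eq_inv hρ, Complex.cpow_def_of_ne_zero (inv_ne_zero (poleDenom_ne_zero hα θ)),
    Complex.log_inv _ (Complex.slitPlane_arg_ne_pi (poleDenom_mem_slitPlane hα θ))]
  ring_nf

theorem norm_exp_neg_mul_log_poleDenom {α : ℝ} (hα : 0 ≤ α) (ξ θ : ℝ) :
    ‖Complex.exp (-(ξ : ℂ) * Complex.log (poleDenom α θ))‖ = ‖poleDenom α θ‖ ^ (-ξ) := by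
  have h : 0 < ‖poleDenom α θ‖ := norm_pos_iff.2 (poleDenom_ne_zero hα θ)
  rw [Complex.norm_exp, ← Complex.ofReal_neg, Complex.re_ofReal_mul, Complex.log_re,
    Real.rpow_def_of_pos h]
  ring_nf

theorem hasDerivAt_poleDenom (α θ : ℝ) :
    HasDerivAt (poleDenom α) (-(α * (Complex.I * Complex.exp (Complex.I * θ)))) θ :=
  (((hasDerivAt_cexp_I_mul θ).sub_const 1).const_mul (α : ℂ)).const_sub 1

/-- The logarithm of the ratio of `1 - iαθ` and `1 - α (e^{iθ} - 1)`. -/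
noncomputable def poleLogRatio (α θ : ℝ) : ℂ :=
  Complex.log (1 - Complex.I * (α * θ : ℝ)) - Complex.log (poleDenom α θ)

theorem poleLogRatio_zero (α : ℝ) : poleLogRatio α 0 = 0 := by
  simp [poleLogRatio, poleDenom]

theorem hasDerivAt_poleLogRatio {α : ℝ} (hα : 0 ≤ α) (θ : ℝ) :
    HasDerivAt (poleLogRatio α) (-(Complex.I * α) / (1 - Complex.I * (α * θ : ℝ)) -
      -(α * (Complex.I * Complex.exp (Complex.I * θ))) / poleDenom α θ) θ := by
  have h1 : HasDerivAt (fun θ : ℝ => 1 - Complex.I * ((α * θ : ℝ) : ℂ)) (-(Complex.I * α)) θ := by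
    have h2 : HasDerivAt (fun θ : ℝ => ((α * θ : ℝ) : ℂ)) ((α : ℝ) : ℂ) θ := by
      have := ((hasDerivAt_id θ).const_mul α).ofReal_comp
      simpa using! this
    exact (h2.const_mul Complex.I).const_sub 1
  exact (h1.clog_real (one_sub_I_mul_mem_slitPlane _)).sub
    ((hasDerivAt_poleDenom α θ).clog_real (poleDenom_mem_slitPlane hα θ))

/-- Each quotient has size `α` near `0`. Over a common denominator the leading parts cancel, leaving
at most `α (|θ| + αθ² / 2)`, which is matched by `|1 - iαθ| ≥ α|θ|` and by the lower bounds `1` and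
`α|θ| / 2` for `poleDenom`. -/
theorem norm_deriv_poleLogRatio_le {α : ℝ} (hα : 0 ≤ α) {θ : ℝ} (hθ : |θ| ≤ Real.pi) :
    ‖-(Complex.I * α) / (1 - Complex.I * (α * θ : ℝ)) -
      -(α * (Complex.I * Complex.exp (Complex.I * θ))) / poleDenom α θ‖ ≤ 2 := by
  set D : ℂ := 1 - Complex.I * (α * θ : ℝ) with hD
  have hD0 : D ≠ 0 := Complex.slitPlane_ne_zero (one_sub_I_mul_mem_slitPlane _)
  have hN0 := poleDenom_ne_zero hα θ
  have hDn : α * |θ| ≤ ‖D‖ := by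
    rw [hD, norm_one_sub_I_mul]
    refine Real.le_sqrt_of_sq_le ?_
    rw [mul_pow, sq_abs, mul_pow]; linarith
  have hN1 := one_le_norm_poleDenom hα θ
  have hN2 := mul_abs_le_two_mul_norm_poleDenom hα hθ
  have e : -(Complex.I * α) / D - -(α * (Complex.I * Complex.exp (Complex.I * θ))) / poleDenom α θ =
      Complex.I * α * ((Complex.exp (Complex.I * θ) - 1) +
        α * Complex.exp (Complex.I * θ) * (1 - Complex.exp (Complex.I * ((-θ : ℝ) : ℂ)) - Complex.I * θ)) /
        (D * poleDenom α θ) := by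
    have h1 : Complex.exp (Complex.I * θ) * Complex.exp (Complex.I * ((-θ : ℝ) : ℂ)) = 1 := by
      rw [← Complex.exp_add]; simp
    have h2 : α * Complex.exp (Complex.I * θ) *
        (1 - Complex.exp (Complex.I * ((-θ : ℝ) : ℂ)) - Complex.I * θ) =
        α * (Complex.exp (Complex.I * θ) - 1 - Complex.I * θ * Complex.exp (Complex.I * θ)) := by
      linear_combination (-(α : ℂ)) * h1
    rw [h2, div_sub_div _ _ hD0 hN0]
    congr 1
    rw [hD, poleDenom]
    push_cast
    ring
  have hexp : ‖Complex.exp (Complex.I * θ)‖ = 1 := by rw [Complex.norm_exp]; simp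
  have k1 : ‖Complex.exp (Complex.I * θ) - 1‖ ≤ |θ| := Real.norm_exp_I_mul_ofReal_sub_one_le
  have k2 : ‖1 - Complex.exp (Complex.I * ((-θ : ℝ) : ℂ)) - Complex.I * θ‖ ≤ θ ^ 2 / 2 := by
    have := norm_cexp_I_mul_sub_one_sub_le (-θ)
    rw [← norm_neg, neg_sq] at this
    refine le_trans (le_of_eq ?_) this
    congr 1
    push_cast
    ring
  have hDpos : 0 < ‖D‖ := norm_pos_iff.2 hD0
  have hNpos : 0 < ‖poleDenom α θ‖ := norm_pos_iff.2 hN0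
  rw [e, norm_div, norm_mul, norm_mul, norm_mul, Complex.norm_I, one_mul, Complex.norm_real,
    Real.norm_eq_abs, abs_of_nonneg hα, div_le_iff₀ (by positivity)]
  have hnum : ‖(Complex.exp (Complex.I * θ) - 1) +
        α * Complex.exp (Complex.I * θ) *
          (1 - Complex.exp (Complex.I * ((-θ : ℝ) : ℂ)) - Complex.I * θ)‖ ≤ |θ| + α * (θ ^ 2 / 2) := by
    refine norm_add_le_of_le k1 ?_
    rw [norm_mul, norm_mul, hexp, mul_one, Complex.norm_real, Real.norm_eq_abs, abs_of_nonneg hα]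
    gcongr
  calc _ ≤ α * (|θ| + α * (θ ^ 2 / 2)) := by gcongr
    _ = (α * |θ|) * (1 + α * |θ| / 2) := by rw [← sq_abs θ]; ring
    _ ≤ ‖D‖ * (2 * ‖poleDenom α θ‖) := by
        gcongr
        linarith
    _ = _ := by ring

theorem norm_le_of_norm_deriv_le_of_zero {w w' : ℝ → ℂ} {A δ : ℝ} (hw : ∀ θ, HasDerivAt w (w' θ) θ)
    (hA : ∀ θ, |θ| ≤ δ → ‖w' θ‖ ≤ A) (h0 : w 0 = 0) {θ : ℝ} (hθ : |θ| ≤ δ) : ‖w θ‖ ≤ A * |θ| := by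
  have hδ : 0 ≤ δ := (abs_nonneg _).trans hθ
  have := (convex_closedBall (0 : ℝ) δ).norm_image_sub_le_of_norm_hasDerivWithin_le (f := w)
    (fun x _ => (hw x).hasDerivWithinAt) (fun x hx => hA x (by simpa using hx)) (x := 0) (y := θ)
    (by simpa using hδ) (by simpa using hθ)
  simpa [h0] using this

theorem norm_prod_le_pow {ι : Type*} (s : Finset ι) {f : ι → ℂ} {b : ℝ} {N : ℕ} (hb : 1 ≤ b)
    (hf : ∀ k ∈ s, ‖f k‖ ≤ b) (hs : s.card ≤ N) : ‖∏ k ∈ s, f k‖ ≤ b ^ N := by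
  rw [norm_prod]
  calc ∏ k ∈ s, ‖f k‖ ≤ ∏ _k ∈ s, b := Finset.prod_le_prod (fun _ _ => norm_nonneg _) hf
    _ = b ^ s.card := Finset.prod_const b
    _ ≤ b ^ N := pow_le_pow_right₀ hb hs

/-- The correction `Ψ` collects the product of the `ψ k`, the bounded discrepancy between the means
and `α ξ k`, and the pole logarithm ratio. All constants are uniform because each `ξ k ≥ 1`, so
there are at most `M` factors. -/
theorem exists_saturable_factor (M B : ℝ) : ∃ A D : ℝ, 0 ≤ A ∧ 0 ≤ D ∧
    ∀ (n : ℕ) (F : Finset (Fin n)) (α : ℝ) (φ ψ : Fin n → ℝ → ℂ) (m ξ : Fin n → ℝ), 0 < α →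
      (∀ k ∈ F, ∀ θ : ℝ, φ k θ = Complex.exp (-(Complex.I * (m k : ℂ) * (θ : ℂ))) *
        Complex.exp (-(ξ k : ℂ) * Complex.log (poleDenom α θ)) * ψ k θ) →
      (∀ k ∈ F, φ k 0 = 1) → (∀ k ∈ F, HasDerivAt (φ k) 0 0) →
      (∀ k ∈ F, ∀ θ : ℝ, DifferentiableAt ℝ (ψ k) θ ∧ ‖deriv (ψ k) θ‖ ≤ B) →
      (∀ k ∈ F, 1 ≤ ξ k) → ∑ k ∈ F, ξ k ≤ M →
      ∃ Ψ : ℝ → ℂ, (∀ θ, DifferentiableAt ℝ Ψ θ) ∧ Ψ 0 = 1 ∧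
        (∀ θ, |θ| ≤ 2 → ‖deriv Ψ θ‖ ≤ A) ∧
        (∀ θ, ∏ k ∈ F, φ k θ = gammaChar (∑ k ∈ F, ξ k) (α * θ) * Ψ θ *
          Complex.exp (-(Complex.I * ((α * ∑ k ∈ F, ξ k : ℝ) : ℂ) * θ))) ∧
        (∀ θ, θ ≠ 0 → |θ| ≤ Real.pi →
          ‖∏ k ∈ F, φ k θ‖ ≤ D * (α * |θ|) ^ (-∑ k ∈ F, ξ k)) := by
  set N : ℕ := ⌈M⌉₊ with hN
  -- A bound for `ψ k` on the period, from `ψ k 0 = 1`, the derivative bound and `π ≤ 4`.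
  set b : ℝ := 1 + |B| * 4 with hb
  have hb1 : 1 ≤ b := by rw [hb]; have := abs_nonneg B; linarith
  set W : ℝ := |M| * |B| + 2 * |M| with hW
  have hW0 : 0 ≤ W := by positivity
  refine ⟨N * (b ^ N * |B|) * Real.exp (W * 2) + b ^ N * (Real.exp (W * 2) * W), 2 ^ M * b ^ N,
    by positivity, by positivity, ?_⟩
  intro n F α φ ψ m ξ hα hφ hφ0 hφd hψ hξ hξM
  set Ξ : ℝ := ∑ k ∈ F, ξ k with hΞ
  have hcardR : (F.card : ℝ) ≤ Ξ := by
    have := Finset.card_nsmul_le_sum F ξ 1 hξ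
    simpa using this
  have hcard : F.card ≤ N := by
    have : (F.card : ℝ) ≤ N := hcardR.trans (hξM.trans (Nat.le_ceil M))
    exact_mod_cast this
  have hΞ0 : 0 ≤ Ξ := (Nat.cast_nonneg _).trans hcardR
  have hΞM : Ξ ≤ |M| := hξM.trans (le_abs_self M)
  have hψ0 : ∀ k ∈ F, ψ k 0 = 1 := by
    intro k hk
    have h := hφ k hk 0
    rw [hφ0 k hk] at h
    simpa [poleDenom] using h.symm
  -- Differentiating the factorization at `0`, where the centred characteristic function is
  -- stationary, gives `deriv (ψ k) 0 = i (m k - α ξ k)`.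
  have hmξ : ∀ k ∈ F, |m k - α * ξ k| ≤ |B| := by
    intro k hk
    have h1 : HasDerivAt (fun θ : ℝ => -(Complex.I * (m k : ℂ) * (θ : ℂ))) (-(Complex.I * (m k : ℂ))) 0 := by
      have := (Complex.ofRealCLM.hasDerivAt (x := (0 : ℝ))).const_mul (Complex.I * (m k : ℂ))
      simpa using! this.neg
    have h2 := (((hasDerivAt_poleDenom α 0).clog_real (poleDenom_mem_slitPlane hα.le 0)).const_mul
      (-(ξ k : ℂ))).cexp
    have h3 := (h1.cexp.mul h2).mul (hψ k hk 0).1.hasDerivAt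
    have h4 : HasDerivAt (φ k) _ 0 := h3.congr_of_eventuallyEq
      (Eventually.of_forall fun θ => hφ k hk θ)
    have h5 := h4.unique (hφd k hk)
    simp only [Pi.mul_apply, hψ0 k hk] at h5
    simp only [poleDenom, Complex.ofReal_zero, mul_zero, Complex.exp_zero, sub_self, sub_zero,
      Complex.log_one, neg_zero, mul_one, one_mul, div_one] at h5
    have h6 : deriv (ψ k) 0 = Complex.I * ((m k - α * ξ k : ℝ) : ℂ) := by
      push_cast
      linear_combination h5
    have h7 := (hψ k hk 0).2
    rw [h6, norm_mul, Complex.norm_I, one_mul, Complex.norm_real, Real.norm_eq_abs] at h7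
    exact h7.trans (le_abs_self B)
  set κ : ℝ := ∑ k ∈ F, (m k - α * ξ k) with hκ
  have hκle : |κ| ≤ |M| * |B| := by
    calc |κ| ≤ ∑ k ∈ F, |m k - α * ξ k| := Finset.abs_sum_le_sum_abs _ _
      _ ≤ ∑ _k ∈ F, |B| := Finset.sum_le_sum hmξ
      _ = F.card * |B| := by rw [Finset.sum_const, nsmul_eq_mul]
      _ ≤ |M| * |B| := by gcongr; exact hcardR.trans hΞM
  have hψb : ∀ k ∈ F, ∀ θ, |θ| ≤ Real.pi → ‖ψ k θ‖ ≤ b := by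
    intro k hk θ hθ
    have h1 := norm_sub_one_le_of_norm_deriv_le (δ := |θ|) (fun θ => (hψ k hk θ).1)
      (fun θ _ => (hψ k hk θ).2.trans (le_abs_self B)) (hψ0 k hk) le_rfl
    have h2 := norm_sub_norm_le (ψ k θ) 1
    rw [norm_one] at h2
    have h3 : |B| * |θ| ≤ |B| * 4 := by gcongr; exact hθ.trans Real.pi_le_four
    rw [hb]; linarith
  set Q : ℝ → ℂ := fun θ => ∏ k ∈ F, ψ k θ with hQ
  set Q' : ℝ → ℂ := fun θ => ∑ k ∈ F, (∏ l ∈ F.erase k, ψ l θ) • deriv (ψ k) θ with hQ'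
  have hQd : ∀ θ, HasDerivAt Q (Q' θ) θ := fun θ => by
    classical
    have := HasDerivAt.fun_finsetProd (u := F) (f := ψ) (f' := fun k => deriv (ψ k) θ) (x := θ)
      (fun k hk => (hψ k hk θ).1.hasDerivAt)
    convert! this
  have hQn : ∀ θ, |θ| ≤ Real.pi → ‖Q θ‖ ≤ b ^ N := fun θ hθ =>
    norm_prod_le_pow F hb1 (fun k hk => hψb k hk θ hθ) hcard
  have hQ'n : ∀ θ, |θ| ≤ Real.pi → ‖Q' θ‖ ≤ N * (b ^ N * |B|) := by
    intro θ hθ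
    calc ‖Q' θ‖ ≤ ∑ k ∈ F, ‖(∏ l ∈ F.erase k, ψ l θ) • deriv (ψ k) θ‖ := norm_sum_le _ _
      _ ≤ ∑ _k ∈ F, b ^ N * |B| := by
          refine Finset.sum_le_sum fun k hk => ?_
          rw [norm_smul]
          refine mul_le_mul ?_ ((hψ k hk θ).2.trans (le_abs_self B)) (norm_nonneg _) (by positivity)
          exact norm_prod_le_pow _ hb1 (fun l hl => hψb l (Finset.mem_of_mem_erase hl) θ hθ)
            ((Finset.card_le_card (Finset.erase_subset k F)).trans hcard)
      _ = F.card * (b ^ N * |B|) := by rw [Finset.sum_const, nsmul_eq_mul]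
      _ ≤ _ := by gcongr
  set w : ℝ → ℂ := fun θ => -(Complex.I * (κ : ℂ) * θ) + Ξ * poleLogRatio α θ with hw
  set w' : ℝ → ℂ := fun θ => -(Complex.I * (κ : ℂ)) +
    Ξ * (-(Complex.I * α) / (1 - Complex.I * (α * θ : ℝ)) -
      -(α * (Complex.I * Complex.exp (Complex.I * θ))) / poleDenom α θ) with hw'
  have hwd : ∀ θ, HasDerivAt w (w' θ) θ := by
    intro θ
    have h1 : HasDerivAt (fun θ : ℝ => -(Complex.I * (κ : ℂ) * (θ : ℂ))) (-(Complex.I * (κ : ℂ))) θ := by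
      have := (Complex.ofRealCLM.hasDerivAt (x := θ)).const_mul (Complex.I * (κ : ℂ))
      simpa using! this.neg
    exact h1.add ((hasDerivAt_poleLogRatio hα.le θ).const_mul (Ξ : ℂ))
  have hw'n : ∀ θ, |θ| ≤ Real.pi → ‖w' θ‖ ≤ W := by
    intro θ hθ
    refine norm_add_le_of_le ?_ ?_
    · rw [norm_neg, norm_mul, Complex.norm_I, one_mul, Complex.norm_real]; exact hκle
    · rw [norm_mul, Complex.norm_real, Real.norm_eq_abs, abs_of_nonneg hΞ0, mul_comm]
      exact mul_le_mul (norm_deriv_poleLogRatio_le hα.le hθ) hΞM hΞ0 two_pos.le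
  have hw0 : w 0 = 0 := by simp [hw, poleLogRatio_zero]
  have hexpw : ∀ θ, |θ| ≤ 2 → ‖Complex.exp (w θ)‖ ≤ Real.exp (W * 2) := by
    intro θ hθ
    rw [Complex.norm_exp]
    refine Real.exp_le_exp.2 ((Complex.re_le_norm _).trans ?_)
    refine (norm_le_of_norm_deriv_le_of_zero hwd hw'n hw0 (hθ.trans Real.two_le_pi)).trans ?_
    gcongr
  have hΨd : ∀ θ, HasDerivAt (fun θ => Q θ * Complex.exp (w θ))
      (Q' θ * Complex.exp (w θ) + Q θ * (Complex.exp (w θ) * w' θ)) θ :=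
    fun θ => (hQd θ).mul (hwd θ).cexp
  have hprod : ∀ θ, ∏ k ∈ F, φ k θ = Complex.exp (-(Complex.I * ((∑ k ∈ F, m k : ℝ) : ℂ) * θ)) *
      Complex.exp (-(Ξ : ℂ) * Complex.log (poleDenom α θ)) * Q θ := by
    intro θ
    rw [Finset.prod_congr rfl fun k hk => hφ k hk θ, Finset.prod_mul_distrib,
      Finset.prod_mul_distrib, ← Complex.exp_sum, ← Complex.exp_sum]
    congr 3
    · rw [Finset.sum_neg_distrib, ← Finset.sum_mul, ← Finset.mul_sum, Complex.ofReal_sum]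
    · rw [← Finset.sum_mul, Finset.sum_neg_distrib, hΞ, Complex.ofReal_sum]
  refine ⟨fun θ => Q θ * Complex.exp (w θ), fun θ => (hΨd θ).differentiableAt, ?_, ?_, ?_, ?_⟩
  · simp only [hw0, Complex.exp_zero, mul_one, hQ]
    exact Finset.prod_eq_one hψ0
  · intro θ hθ
    have hθπ := hθ.trans Real.two_le_pi
    rw [(hΨd θ).deriv]
    refine norm_add_le_of_le ?_ ?_
    · rw [norm_mul]
      exact mul_le_mul (hQ'n θ hθπ) (hexpw θ hθ) (norm_nonneg _) (by positivity)
    · rw [norm_mul, norm_mul]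
      exact mul_le_mul (hQn θ hθπ) (mul_le_mul (hexpw θ hθ) (hw'n θ hθπ) (norm_nonneg _)
        (by positivity)) (by positivity) (by positivity)
  · intro θ
    rw [hprod]
    have e : Complex.exp (-(Complex.I * ((∑ k ∈ F, m k : ℝ) : ℂ) * θ)) *
        Complex.exp (-(Ξ : ℂ) * Complex.log (poleDenom α θ)) =
        gammaChar Ξ (α * θ) * Complex.exp (w θ) *
          Complex.exp (-(Complex.I * ((α * Ξ : ℝ) : ℂ) * θ)) := by
      rw [gammaChar, ← Complex.exp_add, ← Complex.exp_add, ← Complex.exp_add]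
      congr 1
      have hm : (∑ k ∈ F, m k : ℝ) = κ + α * Ξ := by
        rw [hκ, Finset.sum_sub_distrib, ← Finset.mul_sum]; ring
      rw [hm]
      simp only [hw, poleLogRatio]
      push_cast
      ring
    rw [e]
    ring
  · intro θ hθ0 hθ
    have hθpos : 0 < |θ| := abs_pos.2 hθ0
    rw [hprod, norm_mul, norm_mul, norm_cexp_neg_I_mul, one_mul,
      norm_exp_neg_mul_log_poleDenom hα.le]
    have h1 : ‖poleDenom α θ‖ ^ (-Ξ) ≤ 2 ^ M * (α * |θ|) ^ (-Ξ) := by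
      have h2 : α * |θ| / 2 ≤ ‖poleDenom α θ‖ := by
        linarith [mul_abs_le_two_mul_norm_poleDenom hα.le hθ]
      calc ‖poleDenom α θ‖ ^ (-Ξ) ≤ (α * |θ| / 2) ^ (-Ξ) :=
            Real.rpow_le_rpow_of_nonpos (by positivity) h2 (by linarith)
        _ = 2 ^ Ξ * (α * |θ|) ^ (-Ξ) := by
            rw [Real.div_rpow (by positivity) two_pos.le, Real.rpow_neg two_pos.le]
            field_simp
        _ ≤ _ := by
            gcongr
            exact one_le_two
    calc _ ≤ (2 ^ M * (α * |θ|) ^ (-Ξ)) * b ^ N :=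
          mul_le_mul h1 (hQn θ hθ) (norm_nonneg _) (by positivity)
      _ = _ := by ring

/-! ### The gamma approximation -/

section Delta

variable {σ β r : ℝ}

theorem delta_rpow_eq (hβ : 0 < β) (hr : 0 < r) :
    (((1 / 2) * (σ ^ 2 / β)) ^ (1 / r)) ^ r = σ ^ 2 / (2 * β) := by
  rw [← Real.rpow_mul (by positivity), one_div_mul_cancel hr.ne', Real.rpow_one]
  field_simp

theorem delta_le_two {δ : ℝ} (hβ : 0 < β) (hr : 0 < r) (hδ : 0 ≤ δ)
    (h : δ ^ r = σ ^ 2 / (2 * β)) (hσβ : σ ^ 2 ≤ 2 * 2 ^ r * β) : δ ≤ 2 := by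
  rw [← Real.rpow_le_rpow_iff hδ two_pos.le hr, h, div_le_iff₀ (by positivity)]
  linarith

/-- This turns the truncation errors at `δ`, of size `(σδ) ^ (-r)`, into the ratio `β / σ ^ (2 + r)`
of the stated error. -/
theorem mul_delta_rpow_neg {δ : ℝ} (hσ : 0 < σ) (hβ : 0 < β) (hδ : 0 ≤ δ)
    (h : δ ^ r = σ ^ 2 / (2 * β)) : (σ * δ) ^ (-r) = 2 * (β / σ ^ (2 + r)) := by
  rw [Real.rpow_neg (by positivity), Real.mul_rpow hσ.le hδ, h, Real.rpow_add hσ, Real.rpow_two]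
  have := Real.rpow_pos_of_pos hσ r
  field_simp

/-- The cut-off `δ` is chosen exactly so that the Taylor remainder stays below the variance term up
to `|θ| = δ`. -/
theorem two_mul_moment_mul_le {δ θ : ℝ} (hβ : 0 < β) (hr : 0 < r)
    (h : δ ^ r = σ ^ 2 / (2 * β)) (hθ : |θ| ≤ δ) :
    2 * (β * |θ| ^ (2 + r)) ≤ σ ^ 2 * θ ^ 2 := by
  rcases (abs_nonneg θ).eq_or_lt with h0 | h0
  · rw [← h0, Real.zero_rpow (by linarith)]
    simp only [mul_zero]
    positivity
  · have h1 : |θ| ^ r ≤ σ ^ 2 / (2 * β) := h ▸ Real.rpow_le_rpow h0.le hθ hr.le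
    rw [le_div_iff₀ (by positivity)] at h1
    rw [Real.rpow_add h0, Real.rpow_two, sq_abs]
    nlinarith [mul_le_mul_of_nonneg_right h1 (sq_nonneg θ)]

end Delta

theorem mainTheorem7
    (C : ∀ n : ℕ+, ClosedNetwork n)
    {Ω : ℕ+ → Type*} [∀ n, MeasurableSpace (Ω n)]
    (P : ∀ n, Measure (Ω n)) [∀ n, IsProbabilityMeasure (P n)]
    (lam : ℕ+ → ℝ) (X : ∀ n : ℕ+, Fin n → Ω n → ℕ)
    -- the open system attached to the closed network, with mean total queue length `m_n`
    (hX : ∀ n, (C n).IsOpenSystem (P n) (lam n) (X n))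
    (hint : ∀ n k, Integrable (fun ω => (X n k ω : ℝ)) (P n))
    (hmean : ∀ n, ∑ k, qMean (P n) (X n k) = (C n).customers)
    -- the saturable queues and the algebraic singularity of their generating functions
    (ρ : ℕ+ → ℝ) (hρ : ∀ n, 0 ≤ ρ n ∧ ρ n < 1)
    (F : ∀ n : ℕ+, Finset (Fin n)) (hF : ∀ n, (F n).Nonempty)
    (ξ : ∀ n : ℕ+, Fin n → ℝ) (ψ : ∀ n : ℕ+, Fin n → ℝ → ℂ)
    (hφ : ∀ n, ∀ k ∈ F n, ∀ θ : ℝ, qCharFun (P n) (X n k) θ =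
      Complex.exp (-(Complex.I * (qMean (P n) (X n k) : ℂ) * (θ : ℂ))) *
        poleFactor (ρ n) θ ^ (ξ n k : ℂ) * ψ n k θ)
    (hψ : ∃ B : ℝ, ∀ n, ∀ k ∈ F n, ∀ θ : ℝ,
      DifferentiableAt ℝ (ψ n k) θ ∧ ‖deriv (ψ n k) θ‖ ≤ B)
    (hξ : ∃ ξmax : ℝ, ∀ n, ∀ k ∈ F n, 1 ≤ ξ n k ∧ ξ n k < ξmax)
    -- finite moments of order `2 + r` of the other queues
    (r : ℝ) (hr : 0 < r ∧ r ≤ 1)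
    (hmom : ∀ n, ∀ k ∉ F n, MemLp (fun ω => (X n k ω : ℝ)) (ENNReal.ofReal (2 + r)) (P n))
    -- heavy traffic conditions
    (hρ1 : Tendsto ρ atTop (𝓝 1))
    (hξb : ∃ M : ℝ, ∀ n, ∑ k ∈ F n, ξ n k ≤ M)
    (hσ : Tendsto (fun n => totSigma (P n) (X n) (F n)ᶜ / poleScale (ρ n)) atTop (𝓝 0))
    (hδγ : Tendsto (fun n => totDelta (P n) (X n) (F n)ᶜ r * totGamma (P n) (X n) (F n)ᶜ)
      atTop atTop) :
    ∀ ε : ℝ, 0 < ε → ∃ K : ℝ, ∀ᶠ n in atTop, ∀ x : ℤ,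
      ε ≤ |(∑ k ∈ F n, ξ n k) + x / poleScale (ρ n)| →
      |poleScale (ρ n) *
            (P n).real {ω | ((∑ k, X n k ω : ℕ) : ℤ) - ((C n).customers : ℤ) = x} -
          gammaPDFReal (∑ k ∈ F n, ξ n k) 1 ((∑ k ∈ F n, ξ n k) + x / poleScale (ρ n))| ≤
        K * gammaError (poleScale (ρ n)) (∑ k ∈ F n, ξ n k) r
          (totSigma (P n) (X n) (F n)ᶜ) (totMoment (P n) (X n) (F n)ᶜ (2 + r))
          (totGamma (P n) (X n) (F n)ᶜ) (totDelta (P n) (X n) (F n)ᶜ r) := by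
  intro ε hε
  obtain ⟨hr0, hr1⟩ := hr
  obtain ⟨M, hM⟩ := hξb
  obtain ⟨B, hB⟩ := hψ
  obtain ⟨ξmax, hξ⟩ := hξ
  obtain ⟨A, D, hA, hD, hsat⟩ := exists_saturable_factor M B
  have hc : 0 < (1 - (2 : ℝ) ^ (-r)) / 2 := by
    have := Real.rpow_lt_one_of_one_lt_of_neg one_lt_two (neg_lt_zero.2 hr0)
    linarith
  have hL : 0 ≤ max D (2 * Real.exp 1) := le_max_of_le_left hD
  obtain ⟨K, hK⟩ := exists_norm_fourier_sub_gammaPDFReal_le (abs_nonneg M) hA hL hc hr0 hr1 hε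
  refine ⟨K, ?_⟩
  -- Of the limits only `ρ > 0`, `σ ≤ α` and `δγ ≥ 1` are needed; the constant is already uniform.
  filter_upwards [hρ1.eventually_const_lt one_pos, hσ.eventually_le_const one_pos,
    hδγ.eventually_ge_atTop 1] with n hρ0 hσα hδγ1 x hx
  have hα : 0 < poleScale (ρ n) := div_pos hρ0 (sub_pos.2 (hρ n).2)
  have hmeas := (hX n).measurable
  have hmom' : ∀ k ∈ (F n)ᶜ, MemLp (fun ω => (X n k ω : ℝ)) (ENNReal.ofReal (2 + r)) (P n) :=
    fun k hk => hmom n k (Finset.mem_compl.1 hk)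
  have hγσ := totGamma_le_totSigma (A := (F n)ᶜ) hmeas hr0 hmom'
  have hσβ := totSigma_sq_le (A := (F n)ᶜ) hmeas (hint n) hr0 hmom'
  have hβ0 := totMoment_nonneg (P n) (X n) (F n)ᶜ (2 + r)
  have hgauss := fun θ => norm_prod_qCharFun_sub_gaussian_le (A := (F n)ᶜ) (θ := θ)
    hmeas (hint n) hr0 hr1 hmom'
  have hgam := fun θ => norm_prod_qCharFun_le_exp_gamma (P := P n) (A := (F n)ᶜ) (θ := θ) hmeas
  have hδdef : totDelta (P n) (X n) (F n)ᶜ r = ((1 / 2) *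
    (totSigma (P n) (X n) (F n)ᶜ ^ 2 / totMoment (P n) (X n) (F n)ᶜ (2 + r))) ^ (1 / r) := rfl
  have hγ0 : 0 ≤ totGamma (P n) (X n) (F n)ᶜ := Real.sqrt_nonneg _
  obtain ⟨Ψ, hΨd, hΨ0, hΨA, hΨF, hΨD⟩ := hsat n (F n) (poleScale (ρ n))
    (fun k => qCharFun (P n) (X n k)) (ψ n) (fun k => qMean (P n) (X n k)) (ξ n) hα
    (fun k hk θ => by rw [hφ n k hk θ, poleFactor_cpow_eq (hρ n).1 (hρ n).2])
    (fun k _ => qCharFun_zero _ _) (fun k _ => hasDerivAt_qCharFun_zero (hmeas k) (hint n k))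
    (hB n) (fun k hk => (hξ n k hk).1) (hM n)
  have hξ1 : 1 ≤ ∑ k ∈ F n, ξ n k := by
    obtain ⟨k, hk⟩ := hF n
    exact (hξ n k hk).1.trans (Finset.single_le_sum (f := ξ n)
      (fun l hl => zero_le_one.trans (hξ n l hl).1) hk)
  have hξM : ∑ k ∈ F n, ξ n k ≤ |M| := (hM n).trans (le_abs_self M)
  set α := poleScale (ρ n)
  set σ := totSigma (P n) (X n) (F n)ᶜ
  set β := totMoment (P n) (X n) (F n)ᶜ (2 + r)
  set γ := totGamma (P n) (X n) (F n)ᶜ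
  set δ := totDelta (P n) (X n) (F n)ᶜ r
  set Ξ := ∑ k ∈ F n, ξ n k
  have hδ0 : 0 ≤ δ := hδdef ▸ Real.rpow_nonneg (by positivity) _
  -- All nondegeneracy follows from `δγ ≥ 1`: `δ` and `γ` are positive, then `σ ≥ γ` is, and then
  -- `β` is because it dominates a multiple of `σ²`.
  have hδ : 0 < δ := hδ0.lt_of_ne fun h => by rw [← h, zero_mul] at hδγ1; linarith
  have hγ : 0 < γ := hγ0.lt_of_ne fun h => by rw [← h, mul_zero] at hδγ1; linarith
  have hσ0 : 0 < σ := hγ.trans_le hγσ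
  have hβ : 0 < β := hβ0.lt_of_ne fun h => by
    rw [← h, mul_zero] at hσβ
    exact absurd hσβ (not_le.2 (by positivity))
  have hδr : δ ^ r = σ ^ 2 / (2 * β) := by rw [hδdef, delta_rpow_eq hβ hr0]
  have hδ2 := delta_le_two hβ hr0 hδ0 hδr hσβ
  have hσδ : 1 ≤ σ * δ := by nlinarith
  -- The phase of the saturable factor and that of the inversion at `x` merge into the single
  -- frequency `αy`.
  have hαy : α * (Ξ + x / α) = α * Ξ + x := by field_simp
  set Φ : ℝ → ℂ := fun θ =>
    (∏ k, qCharFun (P n) (X n k) θ) * Complex.exp (-(Complex.I * (x : ℂ) * θ))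
  have hsplit : ∀ θ, ∏ k, qCharFun (P n) (X n k) θ =
      (∏ k ∈ F n, qCharFun (P n) (X n k) θ) * ∏ k ∈ (F n)ᶜ, qCharFun (P n) (X n k) θ :=
    fun θ => (Finset.prod_mul_prod_compl _ _).symm
  have hmain := hK Ξ α σ β γ δ (Ξ + x / α) Ψ
    (fun θ => ∏ k ∈ (F n)ᶜ, qCharFun (P n) (X n k) θ) Φ hξ1 hξM hα hσ0
    ((div_le_one hα).1 hσα) hβ0 hγ hδ hδ2 hσδ (mul_delta_rpow_neg hσ0 hβ hδ0 hδr) hx hΨd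
    (fun θ hθ => hΨA θ (hθ.trans hδ2)) hΨ0
    (continuous_finsetProd _ fun k _ => continuous_qCharFun (hmeas k)) ?_ ?_ ?_ ?_
  · have hinv := fourier_inversion_int (P := P n)
      (Z := fun ω => ((∑ k, X n k ω : ℕ) : ℤ) - ((C n).customers : ℤ))
      ((measurable_from_nat.comp (Finset.measurable_sum _ fun k _ => hmeas k)).sub_const _) x
    simp_rw [← prod_qCharFun_eq hmeas (hX n).indep (hmean n)] at hinv
    rw [hinv, ← Complex.ofReal_mul, ← Complex.ofReal_sub, Complex.norm_real,
      Real.norm_eq_abs] at hmain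
    exact hmain
  · intro θ hθ
    refine (hgauss θ (two_mul_moment_mul_le hβ hr0 hδr hθ)).trans ?_
    have := Real.rpow_nonneg (abs_nonneg θ) (2 + r)
    gcongr
    exact le_max_right _ _
  · exact (continuous_finsetProd _ fun k _ => continuous_qCharFun (hmeas k)).mul (by fun_prop)
  · intro θ _
    simp only [Φ]
    rw [hsplit, hΨF, hαy, mul_right_comm _ (Complex.exp _), mul_assoc _ (Complex.exp _),
      ← Complex.exp_add]
    congr 2
    push_cast
    ring
  · intro θ hθδ hθπ
    have hθ0 : θ ≠ 0 := abs_pos.1 (hδ.trans_le hθδ)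
    have hphase := norm_cexp_neg_I_mul (x : ℝ) θ
    rw [Complex.ofReal_intCast] at hphase
    simp only [Φ]
    rw [hsplit, norm_mul, hphase, mul_one, norm_mul, ← mul_assoc]
    refine mul_le_mul ((hΨD θ hθ0 hθπ).trans ?_) (hgam θ hθπ) (norm_nonneg _) (by positivity)
    gcongr
    exact le_max_left _ _
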